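/- Let $\lambda_1,\lambda_2\in C^1([0,1])$ with $\lambda_1>\lambda_2>0$, let $A\in C([0,1];\mathbb R^{4\times4})$ have zero diagonal, written in $2\times 2$ blocks $A^{--},A^{-+},A^{+-},A^{++}$, and let $B\in\mathbb R^{2\times2}$ be invertible. Put $\Lambda=\mathrm{diag}(\lambda_1,\lambda_2)$, $\tilde\Lambda=\mathrm{diag}(\Lambda,-\Lambda)$, $\phi_i(z)=\int_0^z d\zeta/\lambda_i(\zeta)$, $\psi_i=\phi_i^{-1}$, $\tau_i=\phi_i(1)$, $\Delta\tau=\tau_2-\tau_1$. Consider the first-order (Timoshenko) system for $x=(x^-,x^+)=(x_1^-,x_2^-,x_1^+,x_2^+)$ on $[0,1]\times[0,\infty)$, $$\partial_t x^-=\Lambda\partial_z x^-+A^{--}x^-+A^{-+}x^+,\quad \partial_t x^+=-\Lambda\partial_z x^++A^{+-}x^-+A^{++}x^+,\quad x^+(0,t)=-x^-(0,t),\quad x^-(1,t)=x^+(1,t)+Bu(t).\tag{1}$$ Then there are functions $a_0^-,a_0^+\in C([0,1])$ and a matrix kernel $K(z,\zeta)\in\mathbb R^{4\times4}$ on $0\le\zeta\le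 z\le1$, continuous up to the boundary on each of the two parts into which the curve $\phi_1(z)=\phi_2(\zeta)$ divides this triangle, that solves the kernel equations $$\tilde\Lambda(z)\partial_zK(z,\zeta)+\partial_\zeta\big(K(z,\zeta)\tilde\Lambda(\zeta)\big)=K(z,\zeta)A(\zeta),\qquad K(z,z)\tilde\Lambda(z)-\tilde\Lambda(z)K(z,z)=A(z),$$ $$(K^{--}(z,0)+K^{-+}(z,0))\Lambda(0)=\begin{bmatrix}0&0\\a_0^-(z)&0\end{bmatrix},\qquad -(K^{+-}(z,0)+K^{++}(z,0))\Lambda(0)=\begin{bmatrix}0&0\\a_0^+(z)&0\end{bmatrix}\quad(z>0)$$ (the PDE being understood in integrated form along its characteristics), such that the following holds. Let $\bar a_0^\mp=a_0^\mp\circ\psi_2$, let $\tilde a_0(\tau)=\bar a_0^-(\Delta\tau-\tau)h(\Delta\tau-\tau)+\bar a_0^+(\tau-\Delta\tau)h(\tau-\Delta\tau)$ with the Heaviside function $h$, and introduce the new input $\bar u=(\bar u_1,\bar u_2)$ by $$u(t)=B^{-1}\Big(\bar u(t)-x^+(1,t)+\int_0^1K^{--}(1,\zeta)x^-(\zeta,t)+K^{-+}(1,\zeta)x^+(\zeta,t)\,d\zeta\Big).\tag{2}$$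 The hyperbolic controller form (HCF) with input $\bar u$ is, for $t\ge0$ and $i=1,2$, $$\partial_t\eta_i(\tau,t)=\partial_\tau\eta_i(\tau,t),\ \ \tau\in[0,2\tau_i),\qquad \eta_1(2\tau_1,t)=-\bar u_1(t),$$ $$\eta_2(2\tau_2,t)=-\bar u_2(t)+\int_{\tau_1}^{2\tau_1}\bar a_0^-(\tau_1+\tau_2-\tau)\eta_1(\tau,t)\,d\tau-\int_0^{\Delta\tau+\tau_2}\tilde a_0(\tau)\bar u_1(t+\tau)\,d\tau.\tag{3}$$ For a prediction $v$ of the first input, integrable on $[0,\Delta\tau+\tau_2]$, let $T_v$ be the map $x\mapsto\bar x\mapsto\eta$ given by the Volterra transformation $\bar x(z)=x(z)-\int_0^zK(z,\zeta)x(\zeta)\,d\zeta$, followed by $$\eta_1(\tau)=\bar x_1^+(\psi_1(\tau_1-\tau))\ (\tau<\tau_1),\qquad \eta_1(\tau)=-\bar x_1^-(\psi_1(\tau-\tau_1))\ (\tau_1\le\tau\le2\tau_1),$$ and, for $0\le\tau<\tau_2$, $$\eta_2(\tau)=\bar x_2^+(\psi_2(\tau_2-\tau))-\int_{\tau_1}^{\min(2\tau_1,\tau_1+\tau)}\bar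 a_0^+(\Delta\tau-\tau+\sigma)\,\bar x_1^-(\psi_1(\sigma-\tau_1))\,d\sigma-\int_{\min(0,\tau-\tau_1)}^{\tau-\tau_1}\bar a_0^+(\tau_1+\tau_2-\tau+\sigma)\,v(\sigma)\,d\sigma,$$ and, for $\tau_2\le\tau\le2\tau_2$, $$\eta_2(\tau)=-\bar x_2^-(\psi_2(\tau-\tau_2))-\int_{\tau-\Delta\tau}^{\max(2\tau_1,\tau-\Delta\tau)}\bar a_0^+(\Delta\tau-\tau+\sigma)\,\bar x_1^-(\psi_1(\sigma-\tau_1))\,d\sigma-\int_{\tau_1}^{\min(2\tau_1,\tau-\Delta\tau)}\bar a_0^-(\tau-\Delta\tau-\sigma)\,\bar x_1^-(\psi_1(\sigma-\tau_1))\,d\sigma$$ $$\qquad-\int_{\max(0,\tau-\tau_2-\tau_1)}^{\tau-\tau_1}\bar a_0^+(\tau_1+\tau_2-\tau+\sigma)\,v(\sigma)\,d\sigma-\int_{\min(0,\tau-\tau_2-\tau_1)}^{\tau-\tau_2-\tau_1}\bar a_0^-(\tau-\tau_1-\tau_2-\sigma)\,v(\sigma)\,d\sigma.$$ Let $S_v$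 be the map $\eta\mapsto\bar x\mapsto x$ given by $\bar x_1^+(z)=\eta_1(\tau_1-\phi_1(z))$, $\bar x_1^-(z)=-\eta_1(\tau_1+\phi_1(z))$, $$\bar x_2^+(z)=\eta_2(\tau_2-\phi_2(z))-\int_{\tau_1}^{\min(2\tau_1,\tau_1+\tau_2-\phi_2(z))}\bar a_0^+(\phi_2(z)-\tau_1+\sigma)\eta_1(\sigma)\,d\sigma+\int_{\min(0,\Delta\tau-\phi_2(z))}^{\Delta\tau-\phi_2(z)}\bar a_0^+(\phi_2(z)+\tau_1+\sigma)v(\sigma)\,d\sigma,$$ $$\bar x_2^-(z)=-\eta_2(\tau_2+\phi_2(z))+\int_{\tau_1+\phi_2(z)}^{\max(2\tau_1,\tau_1+\phi_2(z))}\bar a_0^+(\sigma-\tau_1-\phi_2(z))\eta_1(\sigma)\,d\sigma+\int_{\tau_1}^{\min(2\tau_1,\tau_1+\phi_2(z))}\bar a_0^-(\phi_2(z)+\tau_1-\sigma)\eta_1(\sigma)\,d\sigma$$ $$\qquad-\int_{\max(0,\phi_2(z)-\tau_1)}^{\Delta\tau+\phi_2(z)}\bar a_0^+(\sigma+\tau_1-\phi_2(z))v(\sigma)\,d\sigma-\int_{\min(0,\phi_2(z)-\tau_1)}^{\phi_2(z)-\tau_1}\bar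 a_0^-(\phi_2(z)-\tau_1-\sigma)v(\sigma)\,d\sigma,$$ followed by $x(z)=\bar x(z)+\int_0^zK_I(z,\zeta)\bar x(\zeta)\,d\zeta$, where $K_I$ is a kernel, piecewise continuous like $K$, with $K_I(z,\zeta)=K(z,\zeta)+\int_\zeta^zK(z,\sigma)K_I(\sigma,\zeta)\,d\sigma$. (a) For every such $v$, $T_v$ is a bijection from $\{x\in C([0,1];\mathbb R^4): x^+(0)=-x^-(0)\}$ onto $C([0,2\tau_1])\times C([0,2\tau_2])$, with inverse $S_v$. (b) If $x$ is a classical ($C^1$) solution of (1) with input $u$ and $\bar u$ is given by (2), then $\eta(\cdot,t)=T_{\bar u_1(t+\cdot)}\,x(\cdot,t)$ is a classical solution of (3) with input $\bar u$, and $\eta_i(\tau,t)=y_i(t+\tau)$ for $t\ge0$, $\tau\in[0,2\tau_i]$, where $y(t)=\bar x^+(1,t)$. (c) Conversely, if $\eta$ is a classical ($C^1$) solution of (3) with input $\bar u$, then $x(\cdot,t)=S_{\bar u_1(t+\cdot)}\,\eta(\cdot,t)$ is a classical solution of (1) with the input $u$ given by (2). -/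

import Mathlib

open Set MeasureTheory

noncomputable section

namespace HCFBeam

/-- Indices of the four components: `Sum.inl` for the components of `x⁻`, `Sum.inr` for those
of `x⁺`; in both cases `0` is the fast and `1` the slow transport process. -/
abbrev Idx := Fin 2 ⊕ Fin 2

/-- `Λ(z) = diag(λ₁(z), λ₂(z))`, where `λ₁ = lam 0` and `λ₂ = lam 1`. -/
def Lam (lam : Fin 2 → ℝ → ℝ) (z : ℝ) : Matrix (Fin 2) (Fin 2) ℝ :=
  Matrix.diagonal fun k => lam k z

/-- The diagonal entries of `diag(Λ, -Λ)`. -/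
def speed (lam : Fin 2 → ℝ → ℝ) (i : Idx) (z : ℝ) : ℝ :=
  Sum.elim (fun k => lam k z) (fun k => -lam k z) i

/-- `diag(Λ(z), -Λ(z))`. -/
def LamT (lam : Fin 2 → ℝ → ℝ) (z : ℝ) : Matrix Idx Idx ℝ :=
  Matrix.diagonal fun i => speed lam i z

/-- `φᵢ(z) = ∫₀ᶻ dζ / λᵢ(ζ)`. -/
def phi (lam : Fin 2 → ℝ → ℝ) (i : Fin 2) (z : ℝ) : ℝ := ∫ ζ in (0 : ℝ)..z, 1 / lam i ζ

/-- The inverse `ψᵢ` of `φᵢ : [0,1] → [0,τᵢ]`. -/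
def psi (lam : Fin 2 → ℝ → ℝ) (i : Fin 2) (s : ℝ) : ℝ :=
  Function.invFunOn (phi lam i) (Icc 0 1) s

/-- The transport time `τᵢ = φᵢ(1)`. -/
def tau (lam : Fin 2 → ℝ → ℝ) (i : Fin 2) : ℝ := phi lam i 1

/-- `Δτ = τ₂ - τ₁`. -/
def dtau (lam : Fin 2 → ℝ → ℝ) : ℝ := tau lam 1 - tau lam 0

/-- `x` is a classical solution on `[0,1] × [0,∞)`, with input `u`, of
`∂ₜ x⁻ = Λ ∂_z x⁻ + A⁻⁻ x⁻ + A⁻⁺ x⁺`, `∂ₜ x⁺ = -Λ ∂_z x⁺ + A⁺⁻ x⁻ + A⁺⁺ x⁺`,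
`x⁺(0,t) = -x⁻(0,t)`, `x⁻(1,t) = x⁺(1,t) + B u(t)`. -/
structure IsBeamSolution (lam : Fin 2 → ℝ → ℝ) (A : ℝ → Matrix Idx Idx ℝ)
    (B : Matrix (Fin 2) (Fin 2) ℝ) (x : ℝ → ℝ → Idx → ℝ) (u : ℝ → Fin 2 → ℝ) : Prop where
  smooth : ContDiffOn ℝ 1 (fun p : ℝ × ℝ => x p.1 p.2) (Icc 0 1 ×ˢ Ici 0)
  pde : ∀ z ∈ Icc (0 : ℝ) 1, ∀ t ∈ Ici (0 : ℝ),
    derivWithin (fun s => x z s) (Ici 0) t =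
      Matrix.mulVec (LamT lam z) (derivWithin (fun ζ => x ζ t) (Icc 0 1) z) +
        Matrix.mulVec (A z) (x z t)
  bc_zero : ∀ t ∈ Ici (0 : ℝ), ∀ k, x 0 t (Sum.inr k) = -x 0 t (Sum.inl k)
  bc_one : ∀ t ∈ Ici (0 : ℝ), ∀ k,
    x 1 t (Sum.inl k) = x 1 t (Sum.inr k) + Matrix.mulVec B (u t) k

/-- The triangle `{(z,ζ) ∈ [0,1]² | ζ ≤ z}`. -/
def triangle : Set (ℝ × ℝ) := {p | 0 ≤ p.2 ∧ p.2 ≤ p.1 ∧ p.1 ≤ 1}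

/-- `K` is piecewise continuous on the triangle: it is continuous, up to the boundary, on each of
the two parts into which the curve `φ₁(z) = φ₂(ζ)` (the characteristic through the corner
`(0,0)`) divides the triangle. On the curve it takes the values from the side of the diagonal. -/
def PiecewiseContinuous (lam : Fin 2 → ℝ → ℝ) (K : ℝ → ℝ → Matrix Idx Idx ℝ) : Prop :=
  ∃ Ku Kl : ℝ × ℝ → Matrix Idx Idx ℝ,
    ContinuousOn Ku triangle ∧ ContinuousOn Kl triangle ∧
    ∀ p ∈ triangle,
      (phi lam 0 p.1 ≤ phi lam 1 p.2 → K p.1 p.2 = Ku p) ∧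
      (phi lam 1 p.2 < phi lam 0 p.1 → K p.1 p.2 = Kl p)

/-- The strictly lower triangular matrix `A₀^∓(z)` with the entry `a(z)`. -/
def Azero (a : ℝ → ℝ) (z : ℝ) : Matrix (Fin 2) (Fin 2) ℝ := !![0, 0; a z, 0]

/-- `K` solves the kernel equations on the triangle: with `Λ̃ = diag(Λ, -Λ)`,
`Λ̃(z) ∂_z K(z,ζ) + ∂_ζ (K(z,ζ) Λ̃(ζ)) = K(z,ζ) A(ζ)`, with boundary conditions on `ζ = 0` and
`ζ = z`. As `A` is only continuous, the PDE is meant in the broad sense, i.e. integrated along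
characteristics: the entry `(i,j)` of the PDE says that `g(z,ζ) = Kᵢⱼ(z,ζ) λ̃ⱼ(ζ)` satisfies
`λ̃ᵢ(z) ∂_z g + λ̃ⱼ(ζ) ∂_ζ g = λ̃ⱼ(ζ) (K(z,ζ) A(ζ))ᵢⱼ`, so the derivative of `g` along a
characteristic `Z' = λ̃ᵢ(Z)`, `W' = λ̃ⱼ(W)` is the right-hand side. The condition on `ζ = 0` is
not imposed at the corner `(0,0)`, where it is in general incompatible with that on `ζ = z`. -/
structure IsKernel (lam : Fin 2 → ℝ → ℝ) (A : ℝ → Matrix Idx Idx ℝ) (am ap : ℝ → ℝ)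
    (K : ℝ → ℝ → Matrix Idx Idx ℝ) : Prop where
  piecewise : PiecewiseContinuous lam K
  pde : ∀ (i j : Idx) (Z W : ℝ → ℝ) (r : ℝ), 0 ≤ r →
    (∀ s ∈ Icc 0 r, HasDerivWithinAt Z (speed lam i (Z s)) (Icc 0 r) s ∧
      HasDerivWithinAt W (speed lam j (W s)) (Icc 0 r) s ∧ (Z s, W s) ∈ triangle) →
    K (Z r) (W r) i j * speed lam j (W r) - K (Z 0) (W 0) i j * speed lam j (W 0) =
      ∫ s in (0 : ℝ)..r, speed lam j (W s) * (K (Z s) (W s) * A (W s)) i j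
  bc_zero_minus : ∀ z ∈ Ioc (0 : ℝ) 1,
    ((K z 0).toBlocks₁₁ + (K z 0).toBlocks₁₂) * Lam lam 0 = Azero am z
  bc_zero_plus : ∀ z ∈ Ioc (0 : ℝ) 1,
    -(((K z 0).toBlocks₂₁ + (K z 0).toBlocks₂₂) * Lam lam 0) = Azero ap z
  bc_diag : ∀ z ∈ Icc (0 : ℝ) 1, K z z * LamT lam z - LamT lam z * K z z = A z

/-- `K_I(z,ζ) = K(z,ζ) + ∫_ζ^z K(z,σ) K_I(σ,ζ) dσ`. -/
def IsInverseKernel (K KI : ℝ → ℝ → Matrix Idx Idx ℝ) : Prop :=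
  ∀ z ζ : ℝ, (z, ζ) ∈ triangle → ∀ i j : Idx,
    KI z ζ i j = K z ζ i j + ∫ σ in ζ..z, (K z σ * KI σ ζ) i j

/-- The Volterra transformation `x̄(z) = x(z) - ∫₀ᶻ K(z,ζ) x(ζ) dζ`. -/
def volterra (K : ℝ → ℝ → Matrix Idx Idx ℝ) (x : ℝ → Idx → ℝ) : ℝ → Idx → ℝ :=
  fun z i => x z i - ∫ ζ in (0 : ℝ)..z, Matrix.mulVec (K z ζ) (x ζ) i

/-- The inverse Volterra transformation `x(z) = x̄(z) + ∫₀ᶻ K_I(z,ζ) x̄(ζ) dζ`. -/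
def volterraInv (KI : ℝ → ℝ → Matrix Idx Idx ℝ) (xb : ℝ → Idx → ℝ) : ℝ → Idx → ℝ :=
  fun z i => xb z i + ∫ ζ in (0 : ℝ)..z, Matrix.mulVec (KI z ζ) (xb ζ) i

/-- The state feedback that introduces the new input `ū`:
`u = B⁻¹ (ū - x⁺(1) + ∫₀¹ K⁻⁻(1,ζ) x⁻(ζ) + K⁻⁺(1,ζ) x⁺(ζ) dζ)`. -/
def feedback (B : Matrix (Fin 2) (Fin 2) ℝ) (K : ℝ → ℝ → Matrix Idx Idx ℝ)
    (x : ℝ → Idx → ℝ) (ubar : Fin 2 → ℝ) : Fin 2 → ℝ :=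
  Matrix.mulVec B⁻¹ fun k => ubar k - x 1 (Sum.inr k) +
    ∫ ζ in (0 : ℝ)..1,
      (Matrix.mulVec (K 1 ζ).toBlocks₁₁ (fun l => x ζ (Sum.inl l)) k +
        Matrix.mulVec (K 1 ζ).toBlocks₁₂ (fun l => x ζ (Sum.inr l)) k)

/-- `ā₀^∓(s) = a₀^∓(ψ₂(s))`. -/
def abar (lam : Fin 2 → ℝ → ℝ) (a : ℝ → ℝ) (s : ℝ) : ℝ := a (psi lam 1 s)

/-- The Heaviside function. -/
def heaviside (s : ℝ) : ℝ := if 0 ≤ s then 1 else 0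

/-- `ã₀(s) = ā₀⁻(Δτ - s) h(Δτ - s) + ā₀⁺(s - Δτ) h(s - Δτ)`. -/
def atilde (lam : Fin 2 → ℝ → ℝ) (am ap : ℝ → ℝ) (s : ℝ) : ℝ :=
  abar lam am (dtau lam - s) * heaviside (dtau lam - s) +
    abar lam ap (s - dtau lam) * heaviside (s - dtau lam)

/-- `η = (η₁, η₂)` is a classical solution, for `t ≥ 0`, of the hyperbolic controller form with
input `ū`; `η i σ t` is `ηᵢ₊₁(σ,t)`. -/
structure IsHCFSolution (lam : Fin 2 → ℝ → ℝ) (am ap : ℝ → ℝ)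
    (η : Fin 2 → ℝ → ℝ → ℝ) (ubar : ℝ → Fin 2 → ℝ) : Prop where
  smooth : ∀ i, ContDiffOn ℝ 1 (fun p : ℝ × ℝ => η i p.1 p.2) (Icc 0 (2 * tau lam i) ×ˢ Ici 0)
  pde : ∀ i, ∀ σ ∈ Ico 0 (2 * tau lam i), ∀ t ∈ Ici (0 : ℝ),
    derivWithin (fun s => η i σ s) (Ici 0) t =
      derivWithin (fun ρ => η i ρ t) (Icc 0 (2 * tau lam i)) σ
  bc_one : ∀ t ∈ Ici (0 : ℝ), η 0 (2 * tau lam 0) t = -ubar t 0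
  bc_two : ∀ t ∈ Ici (0 : ℝ), η 1 (2 * tau lam 1) t =
    -ubar t 1 +
      (∫ σ in (tau lam 0)..(2 * tau lam 0),
        abar lam am (tau lam 0 + tau lam 1 - σ) * η 0 σ t) -
      ∫ σ in (0 : ℝ)..(dtau lam + tau lam 1), atilde lam am ap σ * ubar (t + σ) 0

/-- The states of the beam: continuous functions on `[0,1]` with `x⁺(0) = -x⁻(0)`. -/
def beamStates : Set (ℝ → Idx → ℝ) :=
  {ξ | ContinuousOn ξ (Icc 0 1) ∧ ∀ k, ξ 0 (Sum.inr k) = -ξ 0 (Sum.inl k)}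

/-- The states of the controller form: pairs of continuous functions on `[0,2τᵢ]`. -/
def hcfStates (lam : Fin 2 → ℝ → ℝ) : Set (Fin 2 → ℝ → ℝ) :=
  {e | ∀ i, ContinuousOn (e i) (Icc 0 (2 * tau lam i))}

/-- `x̄₂⁺(z)` from `η₁ = e 0`, `η₂ = e 1` and the predicted first input `v(s) = ū₁(t + s)`. -/
def barSlowPlus (lam : Fin 2 → ℝ → ℝ) (ap : ℝ → ℝ) (v : ℝ → ℝ) (e : Fin 2 → ℝ → ℝ)
    (z : ℝ) : ℝ :=
  e 1 (tau lam 1 - phi lam 1 z) -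
    (∫ σ in (tau lam 0)..(min (2 * tau lam 0) (tau lam 0 + tau lam 1 - phi lam 1 z)),
      abar lam ap (phi lam 1 z - tau lam 0 + σ) * e 0 σ) +
    ∫ σ in (min 0 (dtau lam - phi lam 1 z))..(dtau lam - phi lam 1 z),
      abar lam ap (phi lam 1 z + tau lam 0 + σ) * v σ

/-- `x̄₂⁻(z)` from `η₁ = e 0`, `η₂ = e 1` and the predicted first input `v(s) = ū₁(t + s)`. -/
def barSlowMinus (lam : Fin 2 → ℝ → ℝ) (am ap : ℝ → ℝ) (v : ℝ → ℝ) (e : Fin 2 → ℝ → ℝ)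
    (z : ℝ) : ℝ :=
  -e 1 (tau lam 1 + phi lam 1 z) +
    (∫ σ in (tau lam 0 + phi lam 1 z)..(max (2 * tau lam 0) (tau lam 0 + phi lam 1 z)),
      abar lam ap (-phi lam 1 z - tau lam 0 + σ) * e 0 σ) +
    (∫ σ in (tau lam 0)..(min (2 * tau lam 0) (tau lam 0 + phi lam 1 z)),
      abar lam am (phi lam 1 z + tau lam 0 - σ) * e 0 σ) -
    (∫ σ in (max 0 (phi lam 1 z - tau lam 0))..(dtau lam + phi lam 1 z),
      abar lam ap (-phi lam 1 z + tau lam 0 + σ) * v σ) -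
    ∫ σ in (min 0 (phi lam 1 z - tau lam 0))..(phi lam 1 z - tau lam 0),
      abar lam am (phi lam 1 z - tau lam 0 - σ) * v σ

/-- The map from the controller form state `e = η(·,t)`, with the predicted first input
`v(s) = ū₁(t + s)`, to `x̄(·,t)`. -/
def barOfEta (lam : Fin 2 → ℝ → ℝ) (am ap : ℝ → ℝ) (v : ℝ → ℝ) (e : Fin 2 → ℝ → ℝ) :
    ℝ → Idx → ℝ :=
  fun z => Sum.elim
    ![-e 0 (tau lam 0 + phi lam 0 z), barSlowMinus lam am ap v e z]
    ![e 0 (tau lam 0 - phi lam 0 z), barSlowPlus lam ap v e z]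

/-- `η₁` from `x̄`. -/
def etaFast (lam : Fin 2 → ℝ → ℝ) (xb : ℝ → Idx → ℝ) (s : ℝ) : ℝ :=
  if s < tau lam 0 then xb (psi lam 0 (tau lam 0 - s)) (Sum.inr 0)
  else -xb (psi lam 0 (s - tau lam 0)) (Sum.inl 0)

/-- `η₂` from `x̄` and the predicted first input `v(s) = ū₁(t + s)`. -/
def etaSlow (lam : Fin 2 → ℝ → ℝ) (am ap : ℝ → ℝ) (v : ℝ → ℝ) (xb : ℝ → Idx → ℝ)
    (s : ℝ) : ℝ :=
  if s < tau lam 1 then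
    xb (psi lam 1 (tau lam 1 - s)) (Sum.inr 1) -
      (∫ σ in (tau lam 0)..(min (2 * tau lam 0) (tau lam 0 + s)),
        abar lam ap (dtau lam - s + σ) * xb (psi lam 0 (σ - tau lam 0)) (Sum.inl 0)) -
      ∫ σ in (min 0 (s - tau lam 0))..(s - tau lam 0),
        abar lam ap (tau lam 0 + tau lam 1 - s + σ) * v σ
  else
    -xb (psi lam 1 (s - tau lam 1)) (Sum.inl 1) -
      (∫ σ in (s - dtau lam)..(max (2 * tau lam 0) (s - dtau lam)),
        abar lam ap (dtau lam - s + σ) * xb (psi lam 0 (σ - tau lam 0)) (Sum.inl 0)) -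
      (∫ σ in (tau lam 0)..(min (2 * tau lam 0) (s - dtau lam)),
        abar lam am (-dtau lam + s - σ) * xb (psi lam 0 (σ - tau lam 0)) (Sum.inl 0)) -
      (∫ σ in (max 0 (s - tau lam 1 - tau lam 0))..(s - tau lam 0),
        abar lam ap (tau lam 0 + tau lam 1 - s + σ) * v σ) -
      ∫ σ in (min 0 (s - tau lam 1 - tau lam 0))..(s - tau lam 1 - tau lam 0),
        abar lam am (-tau lam 0 - tau lam 1 + s - σ) * v σ

/-- The map from `x̄(·,t)`, with the predicted first input `v(s) = ū₁(t + s)`, to the controller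
form state `η(·,t)`. -/
def etaOfBar (lam : Fin 2 → ℝ → ℝ) (am ap : ℝ → ℝ) (v : ℝ → ℝ) (xb : ℝ → Idx → ℝ) :
    Fin 2 → ℝ → ℝ :=
  ![etaFast lam xb, etaSlow lam am ap v xb]

/-- The transformation `x(·,t) ↦ η(·,t)`, with the predicted first input `v(s) = ū₁(t + s)`. -/
def toHCF (lam : Fin 2 → ℝ → ℝ) (am ap : ℝ → ℝ) (K : ℝ → ℝ → Matrix Idx Idx ℝ) (v : ℝ → ℝ)
    (x : ℝ → Idx → ℝ) : Fin 2 → ℝ → ℝ :=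
  etaOfBar lam am ap v (volterra K x)

/-- The transformation `η(·,t) ↦ x(·,t)`, with the predicted first input `v(s) = ū₁(t + s)`. -/
def ofHCF (lam : Fin 2 → ℝ → ℝ) (am ap : ℝ → ℝ) (KI : ℝ → ℝ → Matrix Idx Idx ℝ) (v : ℝ → ℝ)
    (e : Fin 2 → ℝ → ℝ) : ℝ → Idx → ℝ :=
  volterraInv KI (barOfEta lam am ap v e)

end HCFBeam

end

open HCFBeam

/-!
# The hyperbolic controller form of a Timoshenko beam

*The kernel.* In the kernel equations every row is a system of its own. With the unknowns
`g_j = K_ij λ_j(ζ)` and the travel times `φ(z)`, `φ(ζ)` as coordinates, the characteristics are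
straight lines of slope `±1`, and the equations become a fixed point problem: the value at a point is
the value on the diagonal, or a value reflected at `ζ = 0`, plus an integral along a
characteristic. In the fast rows, the entry of the slow process of the same direction has two
prescriptions that need not match at the corner `(0,0)`, which causes a jump across the
characteristic `φ₁(z) = φ₂(ζ)`. The jump is known in advance: because `A` has zero diagonal, it is
constant. What remains is continuous. As `λ₁` exceeds `λ₂` by a factor, there is a linear function of
`φₖ(z)` and `φₖ(ζ)` that decreases along all characteristics of the rows of the process `k`; in the
corresponding exponential norm the operator is a contraction (`RowData.exists_solution`).

*The target system.* By the kernel equations, the Volterra transformation turns the beam equations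
into `∂ₜ yᵢ = λ̃ᵢ ∂_z yᵢ + αᵢ y₁⁻(0)`, `y⁺(0) = -y⁻(0)`, where `αᵢ = 0` for the fast components
(`Coeffs.hasDerivWithinAt_volterra`). The resolvent kernel gives the inverse transformation. That it
leads from the target system back to the beam follows from the forward direction, by solving an
ordinary differential equation and comparing (`Coeffs.hasDerivWithinAt_volterraInv`).

*The controller form.* A characteristic of the process `k` runs from `z = 1` along `yₖ⁺` to `z = 0`,
is reflected there, and returns along `yₖ⁻`. Unfolding `yₖ⁺` and `-yₖ⁻` to one function of the travel
time in `[0,2τₖ]` (`unfold`), all integrals in the transformation of the states and in its inverse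
merge into one convolution `conv` of the coupling `αᵢ` with the signal that consists of `η₁` and its
continuation by the predicted input. The transformation adds this convolution to the unfolded state
and the inverse subtracts it. As the fast process has no coupling, the signal is the same both times,
and the two maps are inverse to each other.

*The dynamics.* Integration of the target system along characteristics expresses the unfolded state
as the output `yₖ⁺(1)` at the time `t + r` minus the same convolution
(`Coeffs.IsTarget.unfold_eq_sub_conv`). Hence `ηₖ(τ,t)` is the output at the time `t + τ`, and the
boundary conditions of the controller form are this formula at `r = 2τₖ`. Conversely, a solution of
the controller form is a shift of two output signals, from which a solution of the target system can
be written down (`barState`).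
-/

open Set MeasureTheory Filter Topology

noncomputable section

namespace HCFBeam

/-! ### Parametric integrals with moving endpoints -/

/-- The integrand needs to be continuous in the parameter only at almost every integration variable,
as is the case for kernels with a jump across a curve. -/
lemma continuousAt_integral_moving {X : Type*} [TopologicalSpace X] [FirstCountableTopology X]
    {F : X → ℝ → ℝ} {bound : ℝ → ℝ} {a b : X → ℝ} {x₀ : X}
    (hmeas : ∀ x, AEStronglyMeasurable (F x) volume)
    (hbound : ∀ᶠ x in 𝓝 x₀, ∀ θ, |F x θ| ≤ bound θ)
    (hint : ∀ c d, IntervalIntegrable bound volume c d)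
    (hcont : ∀ᵐ θ, ContinuousAt (fun x => F x θ) x₀)
    (ha : ContinuousAt a x₀) (hb : ContinuousAt b x₀) :
    ContinuousAt (fun x => ∫ θ in (a x)..(b x), F x θ) x₀ := by
  have key : ∀ c : X → ℝ, ContinuousAt c x₀ →
      ContinuousAt (fun x => ∫ θ in (0 : ℝ)..(c x), F x θ) x₀ := by
    intro c hc
    have h := intervalIntegral.continuousAt_parametric_primitive_of_dominated (μ := volume)
      (F := F) (x₀ := x₀) bound (-(1 + |c x₀|)) (1 + |c x₀|) (a₀ := 0) (b₀ := c x₀)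
      (fun x => (hmeas x).restrict)
      (hbound.mono fun x hx => Eventually.of_forall fun θ => hx θ) (hint _ _)
      (ae_restrict_of_ae hcont)
      ⟨by have := abs_nonneg (c x₀); linarith, by have := abs_nonneg (c x₀); linarith⟩
      ⟨by have := neg_abs_le (c x₀); linarith, by have := le_abs_self (c x₀); linarith⟩
      (by simp)
    exact ContinuousAt.comp (f := fun x => (x, c x)) h (continuousAt_id.prodMk hc)
  have hI : ∀ᶠ x in 𝓝 x₀, ∀ c d, IntervalIntegrable (F x) volume c d := by
    filter_upwards [hbound] with x hx c d
    exact (hint c d).mono_fun' (hmeas x).restrict (Eventually.of_forall fun θ => hx θ)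
  have : (fun x => ∫ θ in (a x)..(b x), F x θ) =ᶠ[𝓝 x₀]
      fun x => (∫ θ in (0 : ℝ)..(b x), F x θ) - ∫ θ in (0 : ℝ)..(a x), F x θ := by
    filter_upwards [hI] with x hx
    rw [intervalIntegral.integral_interval_sub_left (hx _ _) (hx _ _)]
  rw [continuousAt_congr this]
  exact (key b hb).sub (key a ha)

/-- The lower endpoint is frozen at `b r₀`, so that the dependence of the integrand on the parameter
does not contribute to the derivative at `r₀`. -/
lemma hasDerivAt_integral_endpoint {Q : ℝ → ℝ → ℝ} {b : ℝ → ℝ} {r₀ b' : ℝ}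
    (hQ : Continuous (Function.uncurry Q)) (hb : HasDerivAt b b' r₀) :
    HasDerivAt (fun r => ∫ u in (b r₀)..(b r), Q r u) (b' * Q r₀ (b r₀)) r₀ := by
  have h1 : HasDerivAt (fun r => (b r - b r₀) * Q r₀ (b r₀)) (b' * Q r₀ (b r₀)) r₀ :=
    (hb.sub_const _).mul_const _
  have h2 : HasDerivAt (fun r => ∫ u in (b r₀)..(b r), (Q r u - Q r₀ (b r₀))) 0 r₀ := by
    rw [hasDerivAt_iff_isLittleO]
    have : (fun r => ∫ u in (b r₀)..(b r), (Q r u - Q r₀ (b r₀))) =o[𝓝 r₀]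
        fun r => b r - b r₀ := by
      rw [Asymptotics.isLittleO_iff]
      intro ε hε
      have hc : ContinuousAt (Function.uncurry Q) (r₀, b r₀) := hQ.continuousAt
      obtain ⟨δ, hδ, hQδ⟩ := Metric.continuousAt_iff.1 hc ε hε
      filter_upwards [Metric.ball_mem_nhds r₀ hδ,
        hb.continuousAt (Metric.ball_mem_nhds (b r₀) hδ)] with r hr hbr
      refine intervalIntegral.norm_integral_le_of_norm_le_const fun u hu => ?_
      have hu' : dist u (b r₀) < δ := by
        have hbr' : dist (b r) (b r₀) < δ := hbr
        refine lt_of_le_of_lt ?_ hbr'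
        rw [Real.dist_eq, Real.dist_eq]
        rcases le_total (b r₀) (b r) with h | h
        · rw [uIoc_of_le h] at hu
          rw [abs_of_nonneg (by linarith [hu.1]), abs_of_nonneg (by linarith)]
          linarith [hu.2]
        · rw [uIoc_of_ge h] at hu
          rw [abs_of_nonpos (by linarith [hu.2]), abs_of_nonpos (by linarith)]
          linarith [hu.1]
      have := hQδ (x := (r, u)) (by rw [Prod.dist_eq]; exact max_lt hr hu')
      exact this.le
    have h3 : (fun r => b r - b r₀) =O[𝓝 r₀] fun r => r - r₀ := hb.isBigO_sub
    simpa using this.trans_isBigO h3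
  have h3 := h1.add h2
  rw [add_zero] at h3
  refine h3.congr_of_eventuallyEq (Eventually.of_forall fun r => ?_)
  have hi : IntervalIntegrable (Q r) volume (b r₀) (b r) :=
    (hQ.comp (Continuous.prodMk_right r)).intervalIntegrable _ _
  simp only [Pi.add_apply]
  rw [intervalIntegral.integral_sub hi intervalIntegrable_const]
  simp

/-- Leibniz rule for an integrand `P * X`, where `P` is only Lipschitz in the parameter and its
derivative may fail to exist on a null set of integration variables. -/
lemma hasDerivAt_integral_moving {P X X' : ℝ → ℝ → ℝ} {F a b : ℝ → ℝ} {r₀ C a' b' : ℝ}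
    (hP : Continuous (Function.uncurry P)) (hX : Continuous (Function.uncurry X))
    (hX' : Continuous (Function.uncurry X')) (hXd : ∀ r u, HasDerivAt (fun r => X r u) (X' r u) r)
    (hPlip : ∀ u r r', |P r u - P r' u| ≤ C * |r - r'|) (hF : Measurable F)
    (hPd : ∀ᵐ u, HasDerivAt (fun r => P r u) (F u) r₀)
    (ha : HasDerivAt a a' r₀) (hb : HasDerivAt b b' r₀) :
    HasDerivAt (fun r => ∫ u in (a r)..(b r), P r u * X r u)
      (b' * (P r₀ (b r₀) * X r₀ (b r₀)) - a' * (P r₀ (a r₀) * X r₀ (a r₀)) +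
        ∫ u in (a r₀)..(b r₀), (F u * X r₀ u + P r₀ u * X' r₀ u)) r₀ := by
  have hC : 0 ≤ C := by
    have := hPlip 0 1 0
    have h2 := abs_nonneg (P 1 0 - P 0 0)
    norm_num at this
    linarith
  have hQ : Continuous (Function.uncurry fun r u => P r u * X r u) := by
    exact hP.mul hX
  have hQr : ∀ r, Continuous fun u => P r u * X r u := fun r =>
    hQ.comp (Continuous.prodMk_right r)
  -- uniform bounds on a compact neighbourhood
  have hK : IsCompact (Icc (r₀ - 1) (r₀ + 1) ×ˢ uIcc (a r₀) (b r₀)) :=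
    isCompact_Icc.prod isCompact_uIcc
  obtain ⟨MP, hMP⟩ := hK.exists_bound_of_continuousOn hP.continuousOn
  obtain ⟨MX, hMX⟩ := hK.exists_bound_of_continuousOn hX.continuousOn
  obtain ⟨MX', hMX'⟩ := hK.exists_bound_of_continuousOn hX'.continuousOn
  have hmain : HasDerivAt (fun r => ∫ u in (a r₀)..(b r₀), P r u * X r u)
      (∫ u in (a r₀)..(b r₀), (F u * X r₀ u + P r₀ u * X' r₀ u)) r₀ := by
    refine (intervalIntegral.hasDerivAt_integral_of_dominated_loc_of_lip
      (s := Icc (r₀ - 1) (r₀ + 1)) (bound := fun _ => C * MX + MP * MX')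
      (Icc_mem_nhds (by linarith) (by linarith))
      (Eventually.of_forall fun r => (hQr r).aestronglyMeasurable)
      ((hQr r₀).intervalIntegrable _ _) ?_ ?_ intervalIntegrable_const ?_).2
    · refine Measurable.aestronglyMeasurable ?_
      exact (hF.mul (hX.comp (Continuous.prodMk_right r₀)).measurable).add
        ((hP.comp (Continuous.prodMk_right r₀)).mul
          (hX'.comp (Continuous.prodMk_right r₀))).measurable
    · refine Eventually.of_forall fun u hu => ?_
      have hu' := uIoc_subset_uIcc hu
      refine LipschitzOnWith.of_dist_le_mul fun r hr r' hr' => ?_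
      have e1 := hMP (r', u) ⟨hr', hu'⟩
      have e2 := hMX (r, u) ⟨hr, hu'⟩
      have e3 : |X r u - X r' u| ≤ MX' * |r - r'| := by
        have := Convex.norm_image_sub_le_of_norm_hasDerivWithin_le (f := fun r => X r u)
          (f' := fun r => X' r u) (C := MX') (s := Icc (r₀ - 1) (r₀ + 1)) (x := r') (y := r)
          (fun x _ => (hXd x u).hasDerivWithinAt) (fun x hx => hMX' (x, u) ⟨hx, hu'⟩)
          (convex_Icc _ _) hr' hr
        simpa [Real.norm_eq_abs] using this
      simp only [Function.uncurry_apply_pair, Real.norm_eq_abs] at e1 e2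
      have hMX0 : 0 ≤ MX := (abs_nonneg _).trans e2
      have hMP0 : 0 ≤ MP := (abs_nonneg _).trans e1
      have hMX'0 : 0 ≤ MX' := (norm_nonneg _).trans (hMX' (r', u) ⟨hr', hu'⟩)
      have hCM : 0 ≤ C * MX + MP * MX' := by positivity
      rw [Real.dist_eq, Real.dist_eq, Real.coe_nnabs, abs_of_nonneg hCM]
      have : P r u * X r u - P r' u * X r' u
          = (P r u - P r' u) * X r u + P r' u * (X r u - X r' u) := by ring
      rw [this]
      calc _ ≤ |P r u - P r' u| * |X r u| + |P r' u| * |X r u - X r' u| := by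
            rw [← abs_mul, ← abs_mul]; exact abs_add_le _ _
        _ ≤ (C * |r - r'|) * MX + MP * (MX' * |r - r'|) := by
            gcongr
            exact hPlip u r r'
        _ = _ := by ring
    · filter_upwards [hPd] with u hu _
      exact hu.mul (hXd r₀ u)
  have hb2 := hasDerivAt_integral_endpoint hQ hb
  have ha2 := hasDerivAt_integral_endpoint hQ ha
  refine ((hmain.add hb2).sub ha2).congr_of_eventuallyEq (Eventually.of_forall fun r => ?_)
    |>.congr_deriv (by ring)
  have hi : ∀ c d, IntervalIntegrable (fun u => P r u * X r u) volume c d := fun c d =>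
    (hQr r).intervalIntegrable _ _
  simp only [Pi.add_apply, Pi.sub_apply]
  rw [intervalIntegral.integral_add_adjacent_intervals (hi _ _) (hi _ _),
    ← intervalIntegral.integral_add_adjacent_intervals (hi (a r₀) (a r)) (hi (a r) (b r))]
  ring

/-! ### Inverses of increasing functions -/

/-- A continuous function that increases at least at rate `c > 0` has a continuous monotone
inverse. -/
lemma exists_continuous_inverse {f : ℝ → ℝ} (hf : Continuous f) {c : ℝ} (hc : 0 < c)
    (h : ∀ a b, a ≤ b → c * (b - a) ≤ f b - f a) :
    ∃ g : ℝ → ℝ, Continuous g ∧ (∀ x, g (f x) = x) ∧ (∀ y, f (g y) = y) ∧ Monotone g := by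
  have hs : StrictMono f := fun a b hab => by
    have := h a b hab.le
    have : 0 < c * (b - a) := mul_pos hc (by linarith)
    linarith
  have hsurj : Function.Surjective f := by
    refine hf.surjective ?_ ?_
    · refine tendsto_atTop_mono' atTop (f₁ := fun x => c * x + f 0) ?_ ?_
      · filter_upwards [eventually_ge_atTop 0] with x hx
        have := h 0 x hx
        linarith
      · exact tendsto_atTop_add_const_right _ _ (tendsto_id.const_mul_atTop hc)
    · have h0 : Tendsto (fun x => c * x + f 0) atBot atBot :=
        tendsto_atBot_add_const_right _ _ (tendsto_id.const_mul_atBot hc)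
      refine tendsto_atBot_mono' atBot ?_ h0
      filter_upwards [eventually_le_atBot 0] with x hx
      have := h x 0 hx
      linarith
  let e := hs.orderIsoOfSurjective f hsurj
  refine ⟨e.symm, e.symm.continuous, fun x => ?_, fun y => ?_, e.symm.monotone⟩
  · exact e.symm_apply_apply x
  · exact e.apply_symm_apply y

/-! ### A fixed point theorem for operators of Volterra type -/

/-- An operator on continuous functions on a compact set whose Lipschitz constant for the weighted
norm `sup |f| exp (-γ m)` decays like `C / γ` has exactly one fixed point. -/
lemma exists_fixedPoint_of_volterra {X ι : Type*} [TopologicalSpace X] [Fintype ι] {T : Set X}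
    (hT : IsCompact T) {m : X → ℝ} (hm : ContinuousOn m T) (S : (X → ι → ℝ) → X → ι → ℝ)
    (hS : ∀ f : X → ι → ℝ, ContinuousOn f T → ContinuousOn (S f) T) {C : ℝ}
    (hlip : ∀ γ > 0, ∀ D ≥ 0, ∀ f g : X → ι → ℝ, ContinuousOn f T → ContinuousOn g T →
      (∀ x ∈ T, ∀ j, |f x j - g x j| ≤ D * Real.exp (γ * m x)) →
      ∀ x ∈ T, ∀ j, |S f x j - S g x j| ≤ C / γ * D * Real.exp (γ * m x)) :
    ∃ f : X → ι → ℝ, ContinuousOn f T ∧ (∀ x ∈ T, S f x = f x) ∧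
      ∀ g : X → ι → ℝ, ContinuousOn g T → (∀ x ∈ T, S g x = g x) → EqOn g f T := by
  classical
  have : CompactSpace T := isCompact_iff_compactSpace.1 hT
  set γ : ℝ := 2 * (|C| + 1) with hγ
  have hγ0 : 0 < γ := by positivity
  have hCγ : C / γ ≤ 1 / 2 := by
    rw [div_le_iff₀ hγ0, hγ]
    linarith [le_abs_self C]
  let ext : C(T, ι → ℝ) → X → ι → ℝ := fun k x =>
    if hx : x ∈ T then fun j => Real.exp (γ * m x) * k ⟨x, hx⟩ j else 0
  have hext_res : ∀ k, T.domRestrict (ext k) = fun (x : T) j => Real.exp (γ * m x) * k x j := by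
    intro k
    funext x j
    simp [ext]
  have hmr : Continuous fun x : T => m x := continuousOn_iff_continuous_domRestrict.1 hm
  have hext : ∀ k, ContinuousOn (ext k) T := by
    intro k
    rw [continuousOn_iff_continuous_domRestrict, hext_res]
    exact continuous_pi fun j => (Real.continuous_exp.comp (hmr.const_mul γ)).mul
      ((continuous_apply j).comp k.continuous)
  have hSc : ∀ k, Continuous fun x : T => S (ext k) x := fun k =>
    continuousOn_iff_continuous_domRestrict.1 (hS _ (hext k))
  let Φ : C(T, ι → ℝ) → C(T, ι → ℝ) := fun k =>
    ⟨fun x j => Real.exp (-(γ * m x)) * S (ext k) x j, by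
      have hk := hSc k
      refine continuous_pi fun j => ?_
      have hkj : Continuous fun x : T => S (ext k) x j := (continuous_apply j).comp hk
      exact (Real.continuous_exp.comp (hmr.const_mul γ).neg).mul hkj⟩
  have hΦ : ContractingWith (1 / 2) Φ := by
    refine ⟨by rw [← NNReal.coe_lt_coe]; norm_num, LipschitzWith.of_dist_le_mul fun k l => ?_⟩
    rw [ContinuousMap.dist_le (by positivity)]
    intro x
    rw [dist_pi_le_iff (by positivity)]
    intro j
    have h1 := hlip γ hγ0 (dist k l) dist_nonneg (ext k) (ext l) (hext k) (hext l) (by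
      intro y hy i
      have : dist (k ⟨y, hy⟩ i) (l ⟨y, hy⟩ i) ≤ dist k l :=
        (dist_le_pi_dist _ _ i).trans (ContinuousMap.dist_apply_le_dist _)
      rw [Real.dist_eq] at this
      simp only [ext, hy, dif_pos]
      rw [← mul_sub, abs_mul, abs_of_pos (Real.exp_pos _), mul_comm]
      gcongr) x x.2 j
    change dist (Real.exp (-(γ * m x)) * S (ext k) x j) (Real.exp (-(γ * m x)) * S (ext l) x j) ≤ _
    rw [Real.dist_eq, ← mul_sub, abs_mul, abs_of_pos (Real.exp_pos _)]
    calc _ ≤ Real.exp (-(γ * m x)) * (C / γ * dist k l * Real.exp (γ * m x)) := by gcongr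
      _ = C / γ * dist k l := by
        rw [mul_comm, mul_assoc, ← Real.exp_add]; simp
      _ ≤ 1 / 2 * dist k l := by gcongr
      _ = _ := by simp
  have hfix : Φ (ContractingWith.fixedPoint Φ hΦ) = ContractingWith.fixedPoint Φ hΦ := hΦ.fixedPoint_isFixedPt
  refine ⟨ext (ContractingWith.fixedPoint Φ hΦ), hext _, fun x hx => ?_, fun g hg hgS => ?_⟩
  · funext j
    have h2 : Real.exp (-(γ * m x)) * S (ext (ContractingWith.fixedPoint Φ hΦ)) x j =
        (ContractingWith.fixedPoint Φ hΦ) ⟨x, hx⟩ j :=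
      congrArg (fun k : C(T, ι → ℝ) => k ⟨x, hx⟩ j) hfix
    simp only [ext, hx, dif_pos]
    change _ = Real.exp (γ * m x) * (ContractingWith.fixedPoint Φ hΦ) ⟨x, hx⟩ j
    rw [← h2, ← mul_assoc, ← Real.exp_add]
    simp [ext]
  · have hgr : Continuous fun x : T => g x := continuousOn_iff_continuous_domRestrict.1 hg
    let k : C(T, ι → ℝ) := ⟨fun x j => Real.exp (-(γ * m x)) * g x j, by
      refine continuous_pi fun j => ?_
      have hgj : Continuous fun x : T => g x j := (continuous_apply j).comp hgr
      exact (Real.continuous_exp.comp (hmr.const_mul γ).neg).mul hgj⟩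
    have hk : ∀ x ∈ T, ∀ j, ext k x j = g x j := by
      intro x hx j
      simp only [ext, hx, dif_pos]
      change Real.exp (γ * m x) * (Real.exp (-(γ * m x)) * g x j) = _
      rw [← mul_assoc, ← Real.exp_add]; simp
    have hSk : ∀ x ∈ T, S (ext k) x = S g x := by
      intro x hx
      funext j
      have := hlip γ hγ0 0 le_rfl (ext k) g (hext k) hg
        (fun y hy i => by rw [hk y hy i]; simp) x hx j
      simp only [mul_zero, zero_mul, abs_nonpos_iff] at this
      linarith
    have : Φ k = k := by
      ext x j
      change Real.exp (-(γ * m x)) * S (ext k) x j = Real.exp (-(γ * m x)) * g x j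
      rw [hSk x x.2, hgS x x.2]
    have h2 := hΦ.fixedPoint_unique this
    intro x hx
    funext j
    rw [← hk x hx j, h2]

/-! ### Fubini's theorem on a triangle -/

/-- Joint measurability and boundedness suffice, so that the lemma applies to discontinuous kernels. -/
lemma integral_triangle_swap {f : ℝ → ℝ → ℝ} (hf : Measurable (Function.uncurry f)) {D z : ℝ}
    (hz : 0 ≤ z) (hD : ∀ σ ζ, |f σ ζ| ≤ D) :
    ∫ σ in (0 : ℝ)..z, ∫ ζ in (0 : ℝ)..σ, f σ ζ = ∫ ζ in (0 : ℝ)..z, ∫ σ in ζ..z, f σ ζ := by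
  have h1 : ∀ σ ∈ Ioc 0 z, ∫ ζ in (0 : ℝ)..σ, f σ ζ
      = ∫ ζ in Ioc 0 z, {p : ℝ × ℝ | p.2 ≤ p.1}.indicator (Function.uncurry f) (σ, ζ) := by
    intro σ hσ
    rw [intervalIntegral.integral_of_le hσ.1.le]
    have : (fun ζ => {p : ℝ × ℝ | p.2 ≤ p.1}.indicator (Function.uncurry f) (σ, ζ))
        = (Iic σ).indicator fun ζ => f σ ζ := by
      funext ζ
      simp [indicator]
    rw [this, setIntegral_indicator measurableSet_Iic]
    congr 2
    ext ζ
    simp only [mem_Ioc, mem_inter_iff, mem_Iic]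
    exact ⟨fun h => ⟨⟨h.1, h.2.trans hσ.2⟩, h.2⟩, fun h => ⟨h.1.1, h.2⟩⟩
  have h2 : ∀ ζ ∈ Ioc 0 z, ∫ σ in ζ..z, f σ ζ
      = ∫ σ in Ioc 0 z, {p : ℝ × ℝ | p.2 ≤ p.1}.indicator (Function.uncurry f) (σ, ζ) := by
    intro ζ hζ
    rw [intervalIntegral.integral_of_le hζ.2]
    have : (fun σ => {p : ℝ × ℝ | p.2 ≤ p.1}.indicator (Function.uncurry f) (σ, ζ))
        = (Ici ζ).indicator fun σ => f σ ζ := by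
      funext σ
      simp [indicator]
    rw [this, setIntegral_indicator measurableSet_Ici, ← integral_Icc_eq_integral_Ioc]
    congr 2
    ext σ
    simp only [mem_Icc, mem_Ioc, mem_inter_iff, mem_Ici]
    exact ⟨fun h => ⟨⟨lt_of_lt_of_le hζ.1 h.1, h.2⟩, h.1⟩, fun h => ⟨h.2, h.1.2⟩⟩
  rw [intervalIntegral.integral_of_le hz, intervalIntegral.integral_of_le hz,
    setIntegral_congr_fun measurableSet_Ioc h1, setIntegral_congr_fun measurableSet_Ioc h2]
  refine integral_integral_swap (μ := volume.restrict (Ioc 0 z)) (ν := volume.restrict (Ioc 0 z))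
    (f := fun σ ζ => {p : ℝ × ℝ | p.2 ≤ p.1}.indicator (Function.uncurry f) (σ, ζ)) ?_
  have hD0 : 0 ≤ D := (abs_nonneg _).trans (hD 0 0)
  refine Integrable.of_bound (C := D) ?_ (Eventually.of_forall fun p => ?_)
  · exact (hf.indicator (measurableSet_le measurable_snd measurable_fst)).aestronglyMeasurable
  · simp only [Function.uncurry_def, indicator]
    split_ifs
    · exact hD _ _
    · simpa using hD0

/-! ### Continuous partial derivatives on a product of intervals -/

/-- Continuous one-sided partial derivatives on a product of convex sets, boundary points included,
give a total derivative within the product. -/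
lemma hasFDerivWithinAt_of_partial {f fx fy : ℝ → ℝ → ℝ} {s t : Set ℝ} (hs : Convex ℝ s)
    (ht : Convex ℝ t)
    (hfx : ∀ x ∈ s, ∀ y ∈ t, HasDerivWithinAt (fun x => f x y) (fx x y) s x)
    (hfy : ∀ x ∈ s, ∀ y ∈ t, HasDerivWithinAt (fun y => f x y) (fy x y) t y)
    (cfx : ContinuousOn (Function.uncurry fx) (s ×ˢ t))
    (cfy : ContinuousOn (Function.uncurry fy) (s ×ˢ t)) {p : ℝ × ℝ} (hp : p ∈ s ×ˢ t) :
    HasFDerivWithinAt (fun p : ℝ × ℝ => f p.1 p.2)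
      (fx p.1 p.2 • ContinuousLinearMap.fst ℝ ℝ ℝ + fy p.1 p.2 • ContinuousLinearMap.snd ℝ ℝ ℝ)
      (s ×ˢ t) p := by
  obtain ⟨x₀, y₀⟩ := p
  refine HasFDerivWithinAt.of_isLittleO ?_
  rw [Asymptotics.isLittleO_iff]
  intro ε hε
  obtain ⟨δ₁, hδ₁, h₁⟩ := Metric.continuousWithinAt_iff.1 (cfx _ hp) (ε / 2) (by positivity)
  obtain ⟨δ₂, hδ₂, h₂⟩ := Metric.continuousWithinAt_iff.1 (cfy _ hp) (ε / 2) (by positivity)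
  have hx₀ : x₀ ∈ s := hp.1
  have hy₀ : y₀ ∈ t := hp.2
  filter_upwards [inter_mem_nhdsWithin (s ×ˢ t) (Metric.ball_mem_nhds (x₀, y₀) (lt_min hδ₁ hδ₂))]
  rintro ⟨x, y⟩ ⟨⟨hx, hy⟩, hb⟩
  simp only [Metric.mem_ball, Prod.dist_eq, lt_min_iff, max_lt_iff] at hb
  obtain ⟨⟨hx1, hy1⟩, hx2, hy2⟩ := hb
  have hx : x ∈ s := hx
  have hy : y ∈ t := hy
  have e1 : |f x y - f x₀ y - fx x₀ y₀ * (x - x₀)| ≤ ε / 2 * |x - x₀| := by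
    have := Convex.norm_image_sub_le_of_norm_hasDerivWithin_le
      (f := fun x => f x y - fx x₀ y₀ * x) (f' := fun x => fx x y - fx x₀ y₀) (C := ε / 2)
      (s := s ∩ Metric.ball x₀ δ₁) (x := x₀) (y := x)
      (fun z hz => by
        have := ((hfx z hz.1 y hy).mono (inter_subset_left (t := Metric.ball x₀ δ₁))).sub
          (((hasDerivAt_id z).const_mul (fx x₀ y₀)).hasDerivWithinAt)
        simpa using! this)
      (fun z hz => by
        have := h₁ (x := (z, y)) ⟨hz.1, hy⟩ (by
          rw [Prod.dist_eq]; exact max_lt hz.2 hy1)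
        exact this.le)
      (hs.inter (convex_ball _ _)) ⟨hx₀, Metric.mem_ball_self hδ₁⟩ ⟨hx, hx1⟩
    simp only [Real.norm_eq_abs] at this
    convert this using 2
    ring
  have e2 : |f x₀ y - f x₀ y₀ - fy x₀ y₀ * (y - y₀)| ≤ ε / 2 * |y - y₀| := by
    have := Convex.norm_image_sub_le_of_norm_hasDerivWithin_le
      (f := fun y => f x₀ y - fy x₀ y₀ * y) (f' := fun y => fy x₀ y - fy x₀ y₀) (C := ε / 2)
      (s := t ∩ Metric.ball y₀ δ₂) (x := y₀) (y := y)
      (fun z hz => by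
        have := ((hfy x₀ hx₀ z hz.1).mono (inter_subset_left (t := Metric.ball y₀ δ₂))).sub
          (((hasDerivAt_id z).const_mul (fy x₀ y₀)).hasDerivWithinAt)
        simpa using! this)
      (fun z hz => by
        have := h₂ (x := (x₀, z)) ⟨hx₀, hz.1⟩ (by
          rw [Prod.dist_eq, dist_self]; exact max_lt hδ₂ hz.2)
        exact this.le)
      (ht.inter (convex_ball _ _)) ⟨hy₀, Metric.mem_ball_self hδ₂⟩ ⟨hy, hy2⟩
    simp only [Real.norm_eq_abs] at this
    convert this using 2
    ring
  have n1 : |x - x₀| ≤ ‖(x, y) - (x₀, y₀)‖ := by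
    simp [Prod.norm_def]
  have n2 : |y - y₀| ≤ ‖(x, y) - (x₀, y₀)‖ := by
    simp [Prod.norm_def]
  rw [Real.norm_eq_abs]
  simp only [_root_.add_apply, _root_.smul_apply,
    ContinuousLinearMap.coe_fst', ContinuousLinearMap.coe_snd', Prod.fst_sub, Prod.snd_sub,
    smul_eq_mul]
  calc _ = |(f x y - f x₀ y - fx x₀ y₀ * (x - x₀)) + (f x₀ y - f x₀ y₀ - fy x₀ y₀ * (y - y₀))| := by
        congr 1; ring
    _ ≤ ε / 2 * |x - x₀| + ε / 2 * |y - y₀| := (abs_add_le _ _).trans (add_le_add e1 e2)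
    _ ≤ ε / 2 * ‖(x, y) - (x₀, y₀)‖ + ε / 2 * ‖(x, y) - (x₀, y₀)‖ := by gcongr
    _ = _ := by ring

lemma contDiffOn_one_of_partial {f fx fy : ℝ → ℝ → ℝ} {s t : Set ℝ} (hs : Convex ℝ s)
    (ht : Convex ℝ t) (us : UniqueDiffOn ℝ s) (ut : UniqueDiffOn ℝ t)
    (hfx : ∀ x ∈ s, ∀ y ∈ t, HasDerivWithinAt (fun x => f x y) (fx x y) s x)
    (hfy : ∀ x ∈ s, ∀ y ∈ t, HasDerivWithinAt (fun y => f x y) (fy x y) t y)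
    (cfx : ContinuousOn (Function.uncurry fx) (s ×ˢ t))
    (cfy : ContinuousOn (Function.uncurry fy) (s ×ˢ t)) :
    ContDiffOn ℝ 1 (fun p : ℝ × ℝ => f p.1 p.2) (s ×ˢ t) := by
  have : (1 : WithTop ℕ∞) = 0 + 1 := by norm_num
  rw [this, contDiffOn_succ_iff_hasFDerivWithinAt_of_uniqueDiffOn (us.prod ut)]
  refine ⟨by simp, _, ?_, fun p hp => hasFDerivWithinAt_of_partial hs ht hfx hfy cfx cfy hp⟩
  rw [contDiffOn_zero]
  exact (cfx.smul continuousOn_const).add (cfy.smul continuousOn_const)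

/-! ### Transport speeds and travel times on the real line -/

/-- Two continuous transport speeds on the whole real line, bounded above and below by positive
constants; the speed with index `0` is faster by at least the factor `1 + δ`. -/
structure Speeds where
  L : Fin 2 → ℝ → ℝ
  lo : ℝ
  hi : ℝ
  δ : ℝ
  cont : ∀ k, Continuous (L k)
  lo_pos : 0 < lo
  lo_le : ∀ k z, lo ≤ L k z
  le_hi : ∀ k z, L k z ≤ hi
  δ_pos : 0 < δ
  gap : ∀ z, (1 + δ) * L 1 z ≤ L 0 z

namespace Speeds

variable (s : Speeds)

lemma L_pos (k : Fin 2) (z : ℝ) : 0 < s.L k z := s.lo_pos.trans_le (s.lo_le k z)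

lemma L_ne (k : Fin 2) (z : ℝ) : s.L k z ≠ 0 := (s.L_pos k z).ne'

lemma hi_pos : 0 < s.hi := (s.L_pos 0 0).trans_le (s.le_hi 0 0)

lemma cont_inv (k : Fin 2) : Continuous fun z => 1 / s.L k z :=
  continuous_const.div (s.cont k) (s.L_ne k)

/-- The travel time from `0` to `z`. -/
def Phi (k : Fin 2) (z : ℝ) : ℝ := ∫ ζ in (0 : ℝ)..z, 1 / s.L k ζ

@[simp] lemma Phi_zero (k : Fin 2) : s.Phi k 0 = 0 := by simp [Phi]

lemma hasDerivAt_Phi (k : Fin 2) (z : ℝ) : HasDerivAt (s.Phi k) (1 / s.L k z) z :=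
  (s.cont_inv k).integral_hasStrictDerivAt 0 z |>.hasDerivAt

lemma continuous_Phi (k : Fin 2) : Continuous (s.Phi k) :=
  continuous_iff_continuousAt.2 fun z => (s.hasDerivAt_Phi k z).continuousAt

lemma Phi_sub (k : Fin 2) (a b : ℝ) : s.Phi k b - s.Phi k a = ∫ ζ in a..b, 1 / s.L k ζ :=
  intervalIntegral.integral_interval_sub_left ((s.cont_inv k).intervalIntegrable _ _)
    ((s.cont_inv k).intervalIntegrable _ _)

lemma Phi_rate (k : Fin 2) {a b : ℝ} (h : a ≤ b) : 1 / s.hi * (b - a) ≤ s.Phi k b - s.Phi k a := by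
  rw [Phi_sub]
  have := intervalIntegral.integral_mono_on (f := fun _ => 1 / s.hi) h
    (intervalIntegrable_const (μ := volume)) ((s.cont_inv k).intervalIntegrable a b)
    (fun x _ => one_div_le_one_div_of_le (s.L_pos k x) (s.le_hi k x))
  simpa [mul_comm] using this

lemma Phi_strictMono (k : Fin 2) : StrictMono (s.Phi k) := fun a b h => by
  have := s.Phi_rate k h.le
  have h2 : 0 < 1 / s.hi * (b - a) := mul_pos (one_div_pos.2 s.hi_pos) (by linarith)
  linarith

lemma Phi_nonneg (k : Fin 2) {z : ℝ} (h : 0 ≤ z) : 0 ≤ s.Phi k z := by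
  simpa using (s.Phi_strictMono k).monotone h

/-- On every interval the slow process needs more time than the fast one, by at least the factor
`1 + δ`. -/
lemma Phi_gap {a b : ℝ} (h : a ≤ b) :
    (1 + s.δ) * (s.Phi 0 b - s.Phi 0 a) ≤ s.Phi 1 b - s.Phi 1 a := by
  rw [Phi_sub, Phi_sub, ← intervalIntegral.integral_const_mul]
  refine intervalIntegral.integral_mono_on h
    (((s.cont_inv 0).const_mul _).intervalIntegrable a b)
    ((s.cont_inv 1).intervalIntegrable a b) (fun x _ => ?_)
  have := s.gap x
  have h0 := s.L_pos 0 x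
  have h1 := s.L_pos 1 x
  rw [mul_one_div, div_le_div_iff₀ h0 h1]
  linarith

lemma Phi_le_Phi {a b : ℝ} (h : a ≤ b) : s.Phi 0 b - s.Phi 0 a ≤ s.Phi 1 b - s.Phi 1 a := by
  have h1 := s.Phi_gap h
  have h2 := (s.Phi_strictMono 0).monotone h
  nlinarith [s.δ_pos]

lemma exists_Psi (k : Fin 2) : ∃ g : ℝ → ℝ, Continuous g ∧ (∀ x, g (s.Phi k x) = x) ∧
    (∀ y, s.Phi k (g y) = y) ∧ Monotone g :=
  exists_continuous_inverse (s.continuous_Phi k) (one_div_pos.2 s.hi_pos)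
    fun _ _ h => s.Phi_rate k h

/-- The position reached from `0` after a given travel time: the inverse of `Phi`. -/
def Psi (k : Fin 2) : ℝ → ℝ := (s.exists_Psi k).choose

lemma continuous_Psi (k : Fin 2) : Continuous (s.Psi k) := (s.exists_Psi k).choose_spec.1
@[simp] lemma Psi_Phi (k : Fin 2) (z : ℝ) : s.Psi k (s.Phi k z) = z :=
  (s.exists_Psi k).choose_spec.2.1 z
@[simp] lemma Phi_Psi (k : Fin 2) (r : ℝ) : s.Phi k (s.Psi k r) = r :=
  (s.exists_Psi k).choose_spec.2.2.1 r
@[simp] lemma Psi_zero (k : Fin 2) : s.Psi k 0 = 0 := by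
  simpa using s.Psi_Phi k 0

lemma Phi_le_iff (k : Fin 2) {a b : ℝ} : s.Phi k a ≤ s.Phi k b ↔ a ≤ b :=
  (s.Phi_strictMono k).le_iff_le

lemma Psi_mono (k : Fin 2) : Monotone (s.Psi k) := (s.exists_Psi k).choose_spec.2.2.2

lemma hasDerivAt_Psi (k : Fin 2) (r : ℝ) : HasDerivAt (s.Psi k) (s.L k (s.Psi k r)) r := by
  have := HasDerivAt.of_local_left_inverse (f := s.Phi k) (g := s.Psi k) (a := r)
    (s.continuous_Psi k).continuousAt (s.hasDerivAt_Phi k (s.Psi k r))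
    (one_div_ne_zero (s.L_ne k _)) (Eventually.of_forall fun y => s.Phi_Psi k y)
  simpa using this

lemma exists_sumInv (k l : Fin 2) : ∃ g : ℝ → ℝ, Continuous g ∧
    (∀ x, g (s.Phi k x + s.Phi l x) = x) ∧ (∀ y, s.Phi k (g y) + s.Phi l (g y) = y) ∧
    Monotone g :=
  exists_continuous_inverse (f := fun x => s.Phi k x + s.Phi l x)
    ((s.continuous_Phi k).add (s.continuous_Phi l)) (one_div_pos.2 s.hi_pos) fun a b h => by
      have h1 := s.Phi_rate k h
      have h2 := (s.Phi_strictMono l).monotone h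
      linarith

/-- The inverse of `Phi k + Phi l`. -/
def sumInv (k l : Fin 2) : ℝ → ℝ := (s.exists_sumInv k l).choose

lemma continuous_sumInv (k l : Fin 2) : Continuous (s.sumInv k l) :=
  (s.exists_sumInv k l).choose_spec.1
lemma sumInv_apply (k l : Fin 2) (x : ℝ) : s.sumInv k l (s.Phi k x + s.Phi l x) = x :=
  (s.exists_sumInv k l).choose_spec.2.1 x
lemma apply_sumInv (k l : Fin 2) (y : ℝ) :
    s.Phi k (s.sumInv k l y) + s.Phi l (s.sumInv k l y) = y :=
  (s.exists_sumInv k l).choose_spec.2.2.1 y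

lemma exists_diffInv : ∃ g : ℝ → ℝ, Continuous g ∧
    (∀ x, g (s.Phi 1 x - s.Phi 0 x) = x) ∧ (∀ y, s.Phi 1 (g y) - s.Phi 0 (g y) = y) ∧
    Monotone g :=
  exists_continuous_inverse (f := fun x => s.Phi 1 x - s.Phi 0 x)
    ((s.continuous_Phi 1).sub (s.continuous_Phi 0))
    (mul_pos s.δ_pos (one_div_pos.2 s.hi_pos)) fun a b h => by
      have h1 := s.Phi_rate 0 h
      have h2 := s.Phi_gap h
      have h3 := mul_le_mul_of_nonneg_left h1 s.δ_pos.le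
      linarith

/-- The inverse of the increasing function `Phi 1 - Phi 0`. -/
def diffInv : ℝ → ℝ := s.exists_diffInv.choose

lemma continuous_diffInv : Continuous s.diffInv := s.exists_diffInv.choose_spec.1
lemma diffInv_apply (x : ℝ) : s.diffInv (s.Phi 1 x - s.Phi 0 x) = x :=
  s.exists_diffInv.choose_spec.2.1 x
lemma apply_diffInv (y : ℝ) : s.Phi 1 (s.diffInv y) - s.Phi 0 (s.diffInv y) = y :=
  s.exists_diffInv.choose_spec.2.2.1 y
lemma diffInv_mono : Monotone s.diffInv := s.exists_diffInv.choose_spec.2.2.2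
@[simp] lemma diffInv_zero : s.diffInv 0 = 0 := by
  simpa using s.diffInv_apply 0

/-! ### Characteristics of the kernel equations -/

/-- The rate at which the weight `weight k` decreases along characteristics: the solution of
`1 + rate = (1 - rate) * (1 + δ)`. -/
def rate : ℝ := s.δ / (2 + s.δ)

lemma rate_pos : 0 < s.rate := div_pos s.δ_pos (by linarith [s.δ_pos])

lemma rate_lt_one : s.rate < 1 := by
  have := s.δ_pos
  rw [rate, div_lt_one (by linarith)]
  linarith

lemma rate_gap : 1 + s.rate ≤ (1 - s.rate) * (1 + s.δ) := by
  have := s.δ_pos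
  have h : s.rate * (2 + s.δ) = s.δ := div_mul_cancel₀ _ (by linarith)
  nlinarith

/-- A function on the triangle that decreases along every characteristic, in the direction
towards the point where the data are given. -/
def weight (k : Fin 2) (p : ℝ × ℝ) : ℝ := s.Phi k p.1 - (1 - s.rate) * s.Phi k p.2

lemma continuous_weight (k : Fin 2) : Continuous (s.weight k) :=
  ((s.continuous_Phi k).comp continuous_fst).sub
    (continuous_const.mul ((s.continuous_Phi k).comp continuous_snd))

end Speeds

/-- Clamping to `[0,1]`. -/
def clamp (z : ℝ) : ℝ := max 0 (min 1 z)

lemma continuous_clamp : Continuous clamp := by unfold clamp; fun_prop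

lemma clamp_mem (z : ℝ) : clamp z ∈ Icc (0 : ℝ) 1 :=
  ⟨le_max_left _ _, max_le zero_le_one (min_le_left _ _)⟩

lemma clamp_of_mem {z : ℝ} (h : z ∈ Icc (0 : ℝ) 1) : clamp z = z := by
  rw [clamp, min_eq_right h.2, max_eq_right h.1]

@[simp] lemma clamp_zero : clamp 0 = 0 := clamp_of_mem (by simp)

/-- A retraction of the plane onto the triangle. Functions on the triangle are composed with it, so
that all functions are defined and continuous on the whole plane. -/
def retract (p : ℝ × ℝ) : ℝ × ℝ := (clamp p.1, min (clamp p.1) (max 0 p.2))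

lemma continuous_retract : Continuous retract := by
  have := continuous_clamp
  unfold retract
  fun_prop

lemma retract_mem (p : ℝ × ℝ) : retract p ∈ triangle :=
  ⟨le_min (clamp_mem _).1 (le_max_left _ _), min_le_left _ _, (clamp_mem _).2⟩

lemma retract_of_mem {p : ℝ × ℝ} (h : p ∈ triangle) : retract p = p := by
  obtain ⟨h0, h1, h2⟩ := h
  ext
  · exact clamp_of_mem ⟨h0.trans h1, h2⟩
  · simp only [retract]
    rw [clamp_of_mem ⟨h0.trans h1, h2⟩, max_eq_right h0, min_eq_right h1]

lemma isCompact_triangle : IsCompact triangle := by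
  have : triangle = retract '' (Icc 0 1 ×ˢ Icc 0 1) := by
    ext p
    constructor
    · intro h
      exact ⟨p, ⟨⟨h.1.trans h.2.1, h.2.2⟩, h.1, h.2.1.trans h.2.2⟩, retract_of_mem h⟩
    · rintro ⟨q, -, rfl⟩
      exact retract_mem q
  rw [this]
  exact (isCompact_Icc.prod isCompact_Icc).image continuous_retract

/-- The sign of the speed of a component of `diag(Λ, -Λ)`. -/
def sgn : Idx → ℝ := Sum.elim (fun _ => 1) (fun _ => -1)

/-- The transport process (fast or slow) to which a component belongs. -/
def proc : Idx → Fin 2 := Sum.elim id id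

@[simp] lemma sgn_inl (k : Fin 2) : sgn (Sum.inl k) = 1 := rfl
@[simp] lemma sgn_inr (k : Fin 2) : sgn (Sum.inr k) = -1 := rfl
@[simp] lemma proc_inl (k : Fin 2) : proc (Sum.inl k) = k := rfl
@[simp] lemma proc_inr (k : Fin 2) : proc (Sum.inr k) = k := rfl

@[simp] lemma sgn_mul_self (i : Idx) : sgn i * sgn i = 1 := by
  rcases i with i | i <;> simp

namespace Speeds

variable (s : Speeds)

/-- The label of the characteristic through `(z,ζ)` in the equation for the entry of the kernel
that couples the processes `k` and `l`, with `ε = 1` if their signs agree and `ε = -1` if not. -/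
def label (k l : Fin 2) (ε : ℝ) (p : ℝ × ℝ) : ℝ := s.Phi l p.2 - ε * s.Phi k p.1

/-- The characteristic with label `u`, parametrized by the travel time `θ = Phi k z`. -/
def char (k l : Fin 2) (ε u θ : ℝ) : ℝ × ℝ := (s.Psi k θ, s.Psi l (u + ε * θ))

lemma continuous_label (k l : Fin 2) (ε : ℝ) : Continuous (s.label k l ε) :=
  ((s.continuous_Phi l).comp continuous_snd).sub
    (continuous_const.mul ((s.continuous_Phi k).comp continuous_fst))

lemma continuous_char (k l : Fin 2) (ε : ℝ) :
    Continuous fun q : ℝ × ℝ => s.char k l ε q.1 q.2 :=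
  ((s.continuous_Psi k).comp continuous_snd).prodMk
    ((s.continuous_Psi l).comp (by fun_prop))

/-- The parameter of the point on the characteristic with label `u` at which the value of the
kernel is prescribed: on the diagonal, on `ζ = 0`, or, for characteristics with `k = 1`, `l = 0`
that leave the triangle through `z = 1`, on that edge. -/
def start (k l : Fin 2) (same : Bool) (u : ℝ) : ℝ :=
  if same then
    if k = l then -u
    else if k = 1 then s.Phi 1 (min (s.diffInv (-u)) 1)
    else s.Phi 0 (max (s.diffInv u) 0) + max (-u) 0
  else s.Phi k (s.sumInv k l u)

lemma continuous_start (k l : Fin 2) (same : Bool) : Continuous (s.start k l same) := by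
  have h0 := s.continuous_Phi 0
  have h1 := s.continuous_Phi 1
  have hk := s.continuous_Phi k
  have hd := s.continuous_diffInv
  have hs := s.continuous_sumInv k l
  unfold start
  split_ifs <;> fun_prop

/-- The sign `ε` of a pair of components, given whether their directions agree. -/
def eps (same : Bool) : ℝ := if same then 1 else -1

/-- Between the point `p` and the point with the prescribed value, a characteristic stays in the
triangle, and the weight drops at least at the rate `rate` in terms of travel time. This makes the
solution formula along characteristics an operator of Volterra type. For characteristics with
`k = 1`, `l = 0` the direction is that of increasing `z` and `ζ`, and the weight drops because the
travel times of the two processes differ by the factor `1 + δ` (`rate_gap`). -/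
lemma char_mem (k l : Fin 2) (same : Bool) {p : ℝ × ℝ} (hp : p ∈ triangle) {θ : ℝ}
    (hθ : θ ∈ uIcc (s.start k l same (s.label k l (eps same) p)) (s.Phi k p.1)) :
    s.char k l (eps same) (s.label k l (eps same) p) θ ∈ triangle ∧
      s.weight k (s.char k l (eps same) (s.label k l (eps same) p) θ) ≤
        s.weight k p - s.rate * |s.Phi k p.1 - θ| := by
  obtain ⟨z, ζ⟩ := p
  obtain ⟨h0, hζz, hz1⟩ := hp
  dsimp only at h0 hζz hz1
  set ε := eps same with hε
  set u := s.label k l ε (z, ζ) with hu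
  have hu' : u = s.Phi l ζ - ε * s.Phi k z := rfl
  set Z := s.Psi k θ with hZ
  set W := s.Psi l (u + ε * θ) with hW
  have hZθ : s.Phi k Z = θ := s.Phi_Psi k θ
  have hWθ : s.Phi l W = u + ε * θ := s.Phi_Psi l _
  have hchar : s.char k l ε u θ = (Z, W) := rfl
  have e0 := s.rate_pos
  have e1 := s.rate_lt_one
  rw [hchar]
  have hmk := fun {a b} => s.Phi_le_iff k (a := a) (b := b)
  have hml := fun {a b} => s.Phi_le_iff l (a := a) (b := b)
  simp only [triangle, mem_ofPred_eq, weight]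
  rw [hZθ]
  rcases same with _ | _
  · -- opposite signs: the data are on the diagonal
    have hε1 : ε = -1 := by simp [hε, eps]
    rw [hε1] at hu' hWθ
    set y := s.sumInv k l u with hy
    have hyu := s.apply_sumInv k l u
    rw [← hy] at hyu
    have hst : s.start k l false u = s.Phi k y := by simp [start, hy]
    rw [hst] at hθ
    have hyz : y ≤ z := by
      by_contra! h
      have a1 := (s.Phi_strictMono k) h
      have a2 := (s.Phi_strictMono l) (lt_of_le_of_lt hζz h)
      linarith
    rw [uIcc_of_le (hmk.2 hyz)] at hθ
    have hZz : Z ≤ z := hmk.1 (by linarith [hθ.2])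
    have hyZ : y ≤ Z := hmk.1 (by linarith [hθ.1])
    have hWζ : ζ ≤ W := hml.1 (by linarith [hθ.2])
    have hWy : W ≤ y := hml.1 (by linarith [hθ.1])
    refine ⟨⟨by linarith, by linarith, by linarith⟩, ?_⟩
    rw [abs_of_nonneg (by linarith [hθ.2])]
    have a1 := hmk.2 hWζ
    have a2 : 0 ≤ (1 - s.rate) * (s.Phi k W - s.Phi k ζ) := mul_nonneg (by linarith) (by linarith)
    have a3 : 0 ≤ (1 - s.rate) * (s.Phi k z - θ) := mul_nonneg (by linarith) (by linarith [hθ.2])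
    linarith
  · have hε1 : ε = 1 := by simp [hε, eps]
    rw [hε1] at hu' hWθ
    by_cases hkl : k = l
    · subst hkl
      have hst : s.start k k true u = -u := by simp [start]
      rw [hst, uIcc_of_le (by linarith [s.Phi_nonneg k h0])] at hθ
      have hζz' := hmk.2 hζz
      refine ⟨⟨hmk.1 ?_, hmk.1 ?_, le_trans (hmk.1 ?_) hz1⟩, ?_⟩
      · rw [s.Phi_zero]; linarith [hθ.1]
      · linarith
      · linarith [hθ.2]
      · rw [abs_of_nonneg (by linarith [hθ.2])]
        have : s.Phi k W = s.Phi k ζ - s.Phi k z + θ := by linarith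
        rw [this]
        linarith
    · by_cases hk1 : k = 1
      · -- slow row, fast column: the characteristic is followed forwards
        have hl0 : l = 0 := by omega
        subst hk1 hl0
        set y := s.diffInv (-u) with hy
        have hyu := s.apply_diffInv (-u)
        rw [← hy] at hyu
        have hst : s.start 1 0 true u = s.Phi 1 (min y 1) := by simp [start, hy]
        rw [hst] at hθ
        have hzy : z ≤ y := by
          rw [← s.diffInv_apply z]
          exact s.diffInv_mono (by linarith [hml.2 hζz])
        have hzy' : z ≤ min y 1 := le_min hzy hz1
        rw [uIcc_of_ge (hmk.2 hzy')] at hθ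
        have hzZ : z ≤ Z := hmk.1 (by linarith [hθ.1])
        have hZy' : Z ≤ min y 1 := hmk.1 (by linarith [hθ.2])
        have hζW : ζ ≤ W := hml.1 (by linarith [hθ.1])
        have hEZ : s.Phi 1 Z - s.Phi 0 Z ≤ -u := by
          rw [← hyu]
          have := s.Phi_le_Phi (hZy'.trans (min_le_left _ _))
          linarith
        refine ⟨⟨by linarith, hml.1 (by linarith), hZy'.trans (min_le_right _ _)⟩, ?_⟩
        rw [abs_of_nonpos (by linarith [hθ.1])]
        have a1 := s.Phi_gap hζW
        have a2 := s.rate_gap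
        have a3 : 0 ≤ θ - s.Phi 1 z := by linarith [hθ.1]
        have a4 : s.Phi 0 W - s.Phi 0 ζ = θ - s.Phi 1 z := by linarith
        rw [a4] at a1
        have a5 := mul_le_mul_of_nonneg_left a1 (show 0 ≤ 1 - s.rate by linarith)
        have a6 := mul_le_mul_of_nonneg_right a2 a3
        nlinarith
      · -- fast row, slow column
        have hk0 : k = 0 := by omega
        have hl1 : l = 1 := by omega
        subst hk0 hl1
        set y := s.diffInv u with hy
        have hyu := s.apply_diffInv u
        rw [← hy] at hyu
        have hst : s.start 0 1 true u = s.Phi 0 (max y 0) + max (-u) 0 := by simp [start, hy]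
        rw [hst] at hθ
        have hyz : y ≤ z := by
          rw [← s.diffInv_apply z]
          exact s.diffInv_mono (by linarith [hml.2 hζz])
        have hζ0 := s.Phi_nonneg 1 h0
        have key : θ ≤ s.Phi 0 z ∧ -u ≤ θ ∧ s.Phi 0 y ≤ θ := by
          rcases le_total 0 u with hu0 | hu0
          · have hy0 : 0 ≤ y := by simpa using s.diffInv_mono hu0
            rw [max_eq_left hy0, max_eq_right (by linarith), add_zero,
              uIcc_of_le (hmk.2 hyz)] at hθ
            have := s.Phi_nonneg 0 hy0
            exact ⟨hθ.2, by linarith [hθ.1], hθ.1⟩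
          · have hy0 : y ≤ 0 := by simpa using s.diffInv_mono hu0
            rw [max_eq_right hy0, max_eq_left (by linarith), s.Phi_zero, zero_add,
              uIcc_of_le (by linarith)] at hθ
            have := hmk.2 hy0
            rw [s.Phi_zero] at this
            exact ⟨hθ.2, by linarith [hθ.1], by linarith [hθ.1]⟩
        obtain ⟨k1, k2, k3⟩ := key
        have hyZ : y ≤ Z := hmk.1 (by linarith)
        have hEZ := s.Phi_le_Phi hyZ
        have hWζ : W ≤ ζ := hml.1 (by linarith)
        refine ⟨⟨hml.1 ?_, hml.1 (by linarith), (hmk.1 (by linarith : s.Phi 0 Z ≤ _)).trans hz1⟩,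
          ?_⟩
        · rw [s.Phi_zero]; linarith
        rw [abs_of_nonneg (by linarith)]
        have a1 := s.Phi_le_Phi hWζ
        have a2 := mul_le_mul_of_nonneg_left
          (show s.Phi 0 ζ - s.Phi 0 W ≤ s.Phi 0 z - θ by linarith)
          (show 0 ≤ 1 - s.rate by linarith)
        linarith

/-- Whether the data for an entry of the kernel involve a reflection at `ζ = 0`. -/
def refl (k l : Fin 2) (same : Bool) : ℝ := if same = true ∧ (k = l ∨ k = 0) then 1 else 0

/-- The position `z` at which a characteristic with label `u ≤ 0` starts on `ζ = 0`. -/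
def footpoint (k : Fin 2) (u : ℝ) : ℝ := s.Psi k (max (-u) 0)

lemma continuous_footpoint (k : Fin 2) : Continuous (s.footpoint k) :=
  (s.continuous_Psi k).comp (by fun_prop)

/-- The reflection at `ζ = 0` stays in the triangle and does not increase the weight. -/
lemma footpoint_mem {k l : Fin 2} (h : k = l ∨ k = 0) {p : ℝ × ℝ}
    (hp : p ∈ triangle) :
    (s.footpoint k (s.label k l 1 p), (0 : ℝ)) ∈ triangle ∧
      s.weight k (s.footpoint k (s.label k l 1 p), (0 : ℝ)) ≤ s.weight k p := by
  obtain ⟨z, ζ⟩ := p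
  obtain ⟨h0, hζz, hz1⟩ := hp
  dsimp only at h0 hζz hz1
  have hkl : s.Phi k ζ ≤ s.Phi l ζ := by
    rcases h with rfl | rfl
    · exact le_rfl
    · have := s.Phi_le_Phi h0
      simp only [s.Phi_zero, sub_zero] at this
      obtain rfl | rfl : l = 0 ∨ l = 1 := by omega
      · exact le_rfl
      · exact this
  have hζ0 := s.Phi_nonneg l h0
  have hζ0k := s.Phi_nonneg k h0
  have hzk := (s.Phi_strictMono k).monotone hζz
  have e0 := s.rate_pos
  have e1 := s.rate_lt_one
  have hf : s.Phi k (s.footpoint k (s.label k l 1 (z, ζ)))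
      = max (s.Phi k z - s.Phi l ζ) 0 := by
    simp [footpoint, label]
  have a1 : max (s.Phi k z - s.Phi l ζ) 0 ≤ s.Phi k z :=
    max_le (by linarith) (by linarith)
  refine ⟨⟨le_rfl, ?_, ?_⟩, ?_⟩
  · refine (s.Phi_le_iff k).1 ?_
    rw [s.Phi_zero, hf]
    exact le_max_right _ _
  · refine le_trans ((s.Phi_le_iff k).1 ?_) hz1
    rw [hf]
    exact a1
  · simp only [weight, s.Phi_zero, mul_zero, sub_zero]
    rw [hf]
    have := mul_nonneg e0.le hζ0k
    exact max_le (by linarith) (by linarith)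

end Speeds

/-! ### One row of the kernel as a fixed point -/

/-- Whether two components are transported in the same direction. -/
def sameSign (i j : Idx) : Bool := i.isLeft == j.isLeft

lemma sgn_mul_sgn (i j : Idx) : sgn i * sgn j = Speeds.eps (sameSign i j) := by
  rcases i with i | i <;> rcases j with j | j <;> simp [sgn, Speeds.eps, sameSign]

/-- The coefficients `M` and the values `d` on the diagonal that determine the row `i` of the
kernel. The unknowns are `g_j = K_ij λ_j(ζ)`, which have the derivatives `sgn i * ∑ g_l M_lj`
along their characteristics. -/
structure RowData where
  i : Idx
  M : Idx → Idx → ℝ → ℝ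
  bound : ℝ
  d : Idx → ℝ → ℝ
  contM : ∀ l j, Continuous (M l j)
  boundM : ∀ l j ζ, |M l j ζ| ≤ bound
  diagM : ∀ j ζ, M j j ζ = 0
  contd : ∀ j, Continuous (d j)

/-- The indicator function of the part of the triangle below the curve `φ₁(z) = φ₂(ζ)`. -/
def Speeds.below (s : Speeds) (p : ℝ × ℝ) : ℝ := if s.Phi 1 p.2 < s.Phi 0 p.1 then 1 else 0

lemma Speeds.measurable_below (s : Speeds) : Measurable s.below :=
  Measurable.ite (measurableSet_lt ((s.continuous_Phi 1).comp continuous_snd).measurable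
    ((s.continuous_Phi 0).comp continuous_fst).measurable) measurable_const measurable_const

lemma Speeds.abs_below_le (s : Speeds) (p : ℝ × ℝ) : |s.below p| ≤ 1 := by
  unfold Speeds.below
  split_ifs <;> simp

lemma Speeds.continuousAt_below (s : Speeds) {p : ℝ × ℝ} (h : s.Phi 1 p.2 ≠ s.Phi 0 p.1) :
    ContinuousAt s.below p := by
  have h1 : Continuous fun p : ℝ × ℝ => s.Phi 1 p.2 := (s.continuous_Phi 1).comp continuous_snd
  have h0 : Continuous fun p : ℝ × ℝ => s.Phi 0 p.1 := (s.continuous_Phi 0).comp continuous_fst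
  rcases h.lt_or_gt with h | h
  · refine (continuousAt_const (y := (1 : ℝ))).congr ?_
    filter_upwards [(isOpen_lt h1 h0).mem_nhds h] with q hq
    exact (if_pos hq).symm
  · refine (continuousAt_const (y := (0 : ℝ))).congr ?_
    filter_upwards [(isOpen_lt h0 h1).mem_nhds h] with q hq
    exact (if_neg (not_lt.2 (le_of_lt hq))).symm

/-- The source of the factor `1 / γ` in weighted estimates of Volterra operators. -/
lemma abs_integral_exp_le {h : ℝ → ℝ} {a b c D : ℝ} (hc : 0 < c) (hD : 0 ≤ D)
    (hh : ∀ θ ∈ uIcc a b, |h θ| ≤ D * Real.exp (-(c * |b - θ|))) :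
    |∫ θ in a..b, h θ| ≤ D / c := by
  rcases le_total a b with hab | hab
  · have hd : ∀ θ, HasDerivAt (fun θ => D / c * Real.exp (c * (θ - b)))
        (D * Real.exp (c * (θ - b))) θ := by
      intro θ
      have := ((((hasDerivAt_id θ).sub_const b).const_mul c).exp).const_mul (D / c)
      refine this.congr_deriv ?_
      simp only [id]
      field_simp
    have hi : IntervalIntegrable (fun θ => D * Real.exp (c * (θ - b))) volume a b :=
      Continuous.intervalIntegrable (by fun_prop) _ _
    have := intervalIntegral.norm_integral_le_of_norm_le hab (f := h)
      (g := fun θ => D * Real.exp (c * (θ - b)))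
      (Eventually.of_forall fun θ hθ => by
        have := hh θ (by rw [uIcc_of_le hab]; exact ⟨hθ.1.le, hθ.2⟩)
        rw [abs_of_nonneg (show 0 ≤ b - θ by linarith [hθ.2])] at this
        rw [Real.norm_eq_abs]
        convert this using 3
        ring) hi
    rw [intervalIntegral.integral_eq_sub_of_hasDerivAt (fun θ _ => hd θ) hi] at this
    rw [Real.norm_eq_abs] at this
    simp only [sub_self, mul_zero, Real.exp_zero, mul_one] at this
    have h2 : 0 ≤ D / c * Real.exp (c * (a - b)) := by positivity
    linarith
  · rw [intervalIntegral.integral_symm, abs_neg]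
    have hd : ∀ θ, HasDerivAt (fun θ => -(D / c * Real.exp (c * (b - θ))))
        (D * Real.exp (c * (b - θ))) θ := by
      intro θ
      have := (((((hasDerivAt_id θ).const_sub b).const_mul c).exp).const_mul (D / c)).neg
      refine this.congr_deriv ?_
      simp only [id]
      field_simp
    have hi : IntervalIntegrable (fun θ => D * Real.exp (c * (b - θ))) volume b a :=
      Continuous.intervalIntegrable (by fun_prop) _ _
    have := intervalIntegral.norm_integral_le_of_norm_le hab (f := h)
      (g := fun θ => D * Real.exp (c * (b - θ)))
      (Eventually.of_forall fun θ hθ => by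
        have := hh θ (by rw [uIcc_of_ge hab]; exact ⟨hθ.1.le, hθ.2⟩)
        rw [abs_of_nonpos (show b - θ ≤ 0 by linarith [hθ.1])] at this
        rw [Real.norm_eq_abs]
        convert this using 3
        ring) hi
    rw [intervalIntegral.integral_eq_sub_of_hasDerivAt (fun θ _ => hd θ) hi] at this
    rw [Real.norm_eq_abs] at this
    simp only [sub_self, mul_zero, Real.exp_zero, mul_one] at this
    have h2 : 0 ≤ D / c * Real.exp (c * (b - a)) := by positivity
    linarith

namespace RowData

variable (s : Speeds) (R : RowData)

/-- The sign `ε` of the column `j` relative to the row. -/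
abbrev sign (j : Idx) : ℝ := Speeds.eps (sameSign R.i j)

/-- The characteristic of the entry in the column `j` through the point `p`. -/
abbrev curve (j : Idx) (p : ℝ × ℝ) (θ : ℝ) : ℝ × ℝ :=
  s.char (proc R.i) (proc j) (R.sign j) (s.label (proc R.i) (proc j) (R.sign j) p) θ

/-- The part of the initial value on the characteristic with label `u` that does not depend on
the solution. On characteristics that start on the diagonal this is the value `R.d` there. For the
slow column in a fast row, the reflection term in `op` is subtracted for all labels; for
characteristics that start on the diagonal it has the constant value `R.d j.swap 0`, which is
therefore added here. Characteristics for `k = 1`, `l = 0` that leave through `z = 1` get an arbitrary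
continuous value. -/
def init (j : Idx) (u : ℝ) : ℝ :=
  if sameSign R.i j then
    if proc R.i = proc j then 0
    else if proc R.i = 1 then R.d j (clamp (s.diffInv (-u)))
    else R.d j (clamp (s.diffInv u)) + R.d j.swap 0
  else R.d j (clamp (s.sumInv (proc R.i) (proc j) u))

/-- The jump of `g_j` across the curve `φ₁(z) = φ₂(ζ)`. It only occurs in the fast rows, in the
column of the slow process with the same sign. There the curve is a characteristic, and the jump
is constant along it because the matrix `A` has zero diagonal. -/
def jump (j : Idx) : ℝ :=
  if sameSign R.i j = true ∧ proc R.i = 0 ∧ proc j = 1 then -R.d j 0 - R.d j.swap 0 else 0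

/-- The contribution of the jump to the derivative along characteristics. -/
def source (j : Idx) (ζ : ℝ) : ℝ := ∑ l, R.jump l * R.M l j ζ

/-- The derivative of `g_j` along its characteristics. -/
def rhs (g : ℝ × ℝ → Idx → ℝ) (j : Idx) (q : ℝ × ℝ) : ℝ :=
  sgn R.i * (∑ l, g (retract q) l * R.M l j q.2 + s.below q * R.source j q.2)

/-- The solution formula for `g_j` without reflection at `ζ = 0`. -/
def base (g : ℝ × ℝ → Idx → ℝ) (p : ℝ × ℝ) (j : Idx) : ℝ :=
  R.init s j (s.label (proc R.i) (proc j) (R.sign j) p) +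
    ∫ θ in (s.start (proc R.i) (proc j) (sameSign R.i j)
        (s.label (proc R.i) (proc j) (R.sign j) p))..(s.Phi (proc R.i) p.1),
      R.rhs s g j (R.curve s j p θ)

/-- The operator whose fixed points are the rows of the kernel. The second term is the reflection
at `ζ = 0`; `j.swap` is the component of the same process with the opposite sign. -/
def op (g : ℝ × ℝ → Idx → ℝ) (p : ℝ × ℝ) (j : Idx) : ℝ :=
  R.base s g p j - Speeds.refl (proc R.i) (proc j) (sameSign R.i j) *
    R.base s g (s.footpoint (proc R.i) (s.label (proc R.i) (proc j) (R.sign j) p), 0) j.swap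

lemma bound_nonneg : 0 ≤ R.bound := (abs_nonneg _).trans (R.boundM R.i R.i 0)

lemma continuous_source (j : Idx) : Continuous (R.source j) := by
  have := R.contM
  unfold source
  fun_prop

/-- The jump has no effect on the equation of its own column, because `A` has zero diagonal. -/
lemma jump_mul_M (l j : Idx) (hl : sameSign R.i j = true ∧ proc R.i = 0 ∧ proc j = 1) (ζ : ℝ) :
    R.jump l * R.M l j ζ = 0 := by
  by_cases h : sameSign R.i l = true ∧ proc R.i = 0 ∧ proc l = 1
  · have : l = j := by
      obtain ⟨h1, -, h2⟩ := h
      obtain ⟨h3, -, h4⟩ := hl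
      generalize R.i = i at *
      rcases i with i | i <;> rcases j with j | j <;> rcases l with l | l <;>
        simp_all [sameSign]
    rw [this, R.diagM, mul_zero]
  · rw [jump, if_neg h, zero_mul]

/-- On each characteristic the right-hand side has at most one discontinuity: the characteristic
either crosses the curve `φ₁(z) = φ₂(ζ)` at most once, or it belongs to a column to which the jump
does not contribute. -/
lemma source_eq_zero_or (j : Idx) :
    (∀ ζ, R.source j ζ = 0) ∨ ∀ u, {θ | s.Phi 1 (s.char (proc R.i) (proc j) (R.sign j) u θ).2 =
      s.Phi 0 (s.char (proc R.i) (proc j) (R.sign j) u θ).1}.Subsingleton := by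
  by_cases h0 : proc R.i = 0
  · by_cases hj : sameSign R.i j = true ∧ proc j = 1
    · left
      intro ζ
      exact Finset.sum_eq_zero fun l _ => R.jump_mul_M l j ⟨hj.1, h0, hj.2⟩ ζ
    · right
      intro u
      have key : ∀ θ₁ θ₂, θ₁ < θ₂ →
          s.Phi 1 (s.char (proc R.i) (proc j) (R.sign j) u θ₁).2 =
            s.Phi 0 (s.char (proc R.i) (proc j) (R.sign j) u θ₁).1 →
          s.Phi 1 (s.char (proc R.i) (proc j) (R.sign j) u θ₂).2 =
            s.Phi 0 (s.char (proc R.i) (proc j) (R.sign j) u θ₂).1 → False := by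
        intro θ₁ θ₂ h12 e1 e2
        rw [h0] at e1 e2
        simp only [Speeds.char, s.Phi_Psi] at e1 e2
        rcases hs : sameSign R.i j with _ | _
        · have : u + R.sign j * θ₂ ≤ u + R.sign j * θ₁ := by
            simp only [sign, hs, Speeds.eps]
            simp only [Bool.false_eq_true, ↓reduceIte]
            linarith
          have := (s.Phi_strictMono 1).monotone (s.Psi_mono (proc j) this)
          linarith
        · have hj0 : proc j = 0 := by
            have : proc j ≠ 1 := fun h => hj ⟨hs, h⟩
            omega
          rw [hj0] at e1 e2
          have hsg : R.sign j = 1 := by simp [sign, hs, Speeds.eps]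
          rw [hsg, one_mul] at e1 e2
          have hm : s.Psi 0 (u + θ₁) ≤ s.Psi 0 (u + θ₂) := s.Psi_mono 0 (by linarith)
          have := s.Phi_gap hm
          rw [e1, e2, s.Phi_Psi, s.Phi_Psi] at this
          nlinarith [mul_pos s.δ_pos (sub_pos.2 h12)]
      intro θ₁ h1 θ₂ h2
      rcases lt_trichotomy θ₁ θ₂ with h | h | h
      · exact (key _ _ h h1 h2).elim
      · exact h
      · exact (key _ _ h h2 h1).elim
  · left
    intro ζ
    refine Finset.sum_eq_zero fun l _ => ?_
    rw [jump, if_neg (fun h => h0 h.2.1), zero_mul]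

lemma continuousAt_rhs {g : ℝ × ℝ → Idx → ℝ} (hg : Continuous fun p => g (retract p)) (j : Idx)
    {q : ℝ × ℝ} (h : (∀ ζ, R.source j ζ = 0) ∨ s.Phi 1 q.2 ≠ s.Phi 0 q.1) :
    ContinuousAt (R.rhs s g j) q := by
  have hM := R.contM
  have hsum : Continuous fun q : ℝ × ℝ => ∑ l, g (retract q) l * R.M l j q.2 :=
    continuous_finsetSum _ fun l _ => ((continuous_apply l).comp hg).mul ((hM l j).comp continuous_snd)
  have hsrc : ContinuousAt (fun q : ℝ × ℝ => s.below q * R.source j q.2) q := by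
    rcases h with h | h
    · simp only [h, mul_zero]
      exact continuousAt_const
    · exact (s.continuousAt_below h).mul
        ((R.continuous_source j).comp continuous_snd).continuousAt
  exact continuousAt_const.mul (hsum.continuousAt.add hsrc)

lemma measurable_rhs {g : ℝ × ℝ → Idx → ℝ} (hg : Continuous fun p => g (retract p)) (j : Idx) :
    Measurable (R.rhs s g j) := by
  have hM := R.contM
  have hsum : Continuous fun q : ℝ × ℝ => ∑ l, g (retract q) l * R.M l j q.2 :=
    continuous_finsetSum _ fun l _ => ((continuous_apply l).comp hg).mul ((hM l j).comp continuous_snd)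
  exact (hsum.measurable.add (s.measurable_below.mul
    ((R.continuous_source j).comp continuous_snd).measurable)).const_mul _

lemma abs_sgn (i : Idx) : |sgn i| = 1 := by
  rcases i with i | i <;> simp

lemma exists_bound_rhs {g : ℝ × ℝ → Idx → ℝ} (hg : Continuous fun p => g (retract p)) (j : Idx) :
    ∃ D, ∀ q, |R.rhs s g j q| ≤ D := by
  obtain ⟨G, hG⟩ := isCompact_triangle.exists_bound_of_continuousOn hg.continuousOn
  refine ⟨∑ _l : Idx, G * R.bound + ∑ l, |R.jump l| * R.bound, fun q => ?_⟩
  rw [rhs, abs_mul, abs_sgn, one_mul]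
  refine (abs_add_le _ _).trans (add_le_add ?_ ?_)
  · refine (Finset.abs_sum_le_sum_abs _ _).trans (Finset.sum_le_sum fun l _ => ?_)
    rw [abs_mul]
    have h1 := hG (retract q) (retract_mem q)
    rw [retract_of_mem (retract_mem q)] at h1
    exact mul_le_mul ((norm_le_pi_norm _ l).trans h1) (R.boundM _ _ _) (abs_nonneg _)
      ((norm_nonneg _).trans h1)
  · rw [abs_mul]
    calc _ ≤ 1 * |R.source j q.2| := by
          gcongr
          exact s.abs_below_le q
      _ ≤ _ := by
        rw [one_mul]
        refine (Finset.abs_sum_le_sum_abs _ _).trans (Finset.sum_le_sum fun l _ => ?_)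
        rw [abs_mul]
        gcongr
        exact R.boundM _ _ _

lemma continuous_init (j : Idx) : Continuous (R.init s j) := by
  have hd := R.contd
  have h1 := s.continuous_diffInv
  have h2 := s.continuous_sumInv
  have h3 := continuous_clamp
  unfold init
  split_ifs <;> fun_prop

lemma intervalIntegrable_rhs {g : ℝ × ℝ → Idx → ℝ} (hg : Continuous fun p => g (retract p))
    (j : Idx) {γ : ℝ → ℝ × ℝ} (hγ : Continuous γ) (a b : ℝ) :
    IntervalIntegrable (fun θ => R.rhs s g j (γ θ)) volume a b := by
  obtain ⟨D, hD⟩ := R.exists_bound_rhs s hg j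
  exact (intervalIntegrable_const (c := D)).mono_fun'
    ((R.measurable_rhs s hg j).comp hγ.measurable).aestronglyMeasurable
    (Eventually.of_forall fun θ => hD _)

lemma continuous_curve (j : Idx) (p : ℝ × ℝ) : Continuous (R.curve s j p) :=
  (s.continuous_char _ _ _).comp (Continuous.prodMk_right _)

/-- The jump of the right-hand side does not destroy continuity: along every characteristic it
sits at a single point, which is a null set. -/
lemma continuous_base {g : ℝ × ℝ → Idx → ℝ} (hg : Continuous fun p => g (retract p)) (j : Idx) :
    Continuous fun p => R.base s g p j := by
  obtain ⟨D, hD⟩ := R.exists_bound_rhs s hg j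
  have hl := s.continuous_label (proc R.i) (proc j) (R.sign j)
  refine ((R.continuous_init s j).comp hl).add (continuous_iff_continuousAt.2 fun p => ?_)
  refine continuousAt_integral_moving (bound := fun _ => D)
    (fun x => ((R.measurable_rhs s hg j).comp
      (R.continuous_curve s j x).measurable).aestronglyMeasurable)
    (Eventually.of_forall fun x θ => hD _) (fun _ _ => intervalIntegrable_const) ?_
    ((s.continuous_start _ _ _).comp hl).continuousAt
    ((s.continuous_Phi _).comp continuous_fst).continuousAt
  have hc : ∀ θ, Continuous fun x => R.curve s j x θ := fun θ =>
    (s.continuous_char _ _ _).comp (hl.prodMk continuous_const)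
  have hae : ∀ᵐ θ, (∀ ζ, R.source j ζ = 0) ∨
      s.Phi 1 (R.curve s j p θ).2 ≠ s.Phi 0 (R.curve s j p θ).1 := by
    rcases R.source_eq_zero_or s j with h | h
    · exact Eventually.of_forall fun _ => Or.inl h
    · have := (h (s.label (proc R.i) (proc j) (R.sign j) p)).measure_zero volume
      filter_upwards [compl_mem_ae_iff.2 this] with θ hθ
      exact Or.inr hθ
  filter_upwards [hae] with θ hθ
  exact ContinuousAt.comp (f := fun x => R.curve s j x θ) (R.continuousAt_rhs s hg j hθ)
    (hc θ).continuousAt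

lemma continuous_op {g : ℝ × ℝ → Idx → ℝ} (hg : Continuous fun p => g (retract p)) :
    Continuous (R.op s g) := by
  refine continuous_pi fun j => (R.continuous_base s hg j).sub (continuous_const.mul ?_)
  exact (R.continuous_base s hg j.swap).comp
    (((s.continuous_footpoint _).comp (s.continuous_label _ _ _)).prodMk continuous_const)

lemma continuous_comp_retract {g : ℝ × ℝ → Idx → ℝ} (hg : ContinuousOn g triangle) :
    Continuous fun p => g (retract p) :=
  hg.comp_continuous continuous_retract retract_mem

/-- In the norm with weight `exp (-γ * weight)` the Lipschitz constant is of order `1 / γ`, since by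
`Speeds.char_mem` the weight drops linearly along characteristics. -/
lemma base_lipschitz {γ D : ℝ} (hγ : 0 < γ) (hD : 0 ≤ D) {f g : ℝ × ℝ → Idx → ℝ}
    (hf : ContinuousOn f triangle) (hg : ContinuousOn g triangle)
    (h : ∀ x ∈ triangle, ∀ j, |f x j - g x j| ≤ D * Real.exp (γ * s.weight (proc R.i) x))
    {p : ℝ × ℝ} (hp : p ∈ triangle) (j : Idx) :
    |R.base s f p j - R.base s g p j| ≤
      4 * R.bound / s.rate / γ * D * Real.exp (γ * s.weight (proc R.i) p) := by
  have hf' := continuous_comp_retract hf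
  have hg' := continuous_comp_retract hg
  have hbd := R.bound_nonneg
  have hr := s.rate_pos
  rw [base, base, add_sub_add_left_eq_sub, ← intervalIntegral.integral_sub
    (R.intervalIntegrable_rhs s hf' j (R.continuous_curve s j p) _ _)
    (R.intervalIntegrable_rhs s hg' j (R.continuous_curve s j p) _ _)]
  have := abs_integral_exp_le (c := γ * s.rate)
    (D := 4 * R.bound * D * Real.exp (γ * s.weight (proc R.i) p)) (mul_pos hγ hr) (by positivity)
    (a := s.start (proc R.i) (proc j) (sameSign R.i j)
        (s.label (proc R.i) (proc j) (R.sign j) p)) (b := s.Phi (proc R.i) p.1)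
    (h := fun θ => R.rhs s f j (R.curve s j p θ) - R.rhs s g j (R.curve s j p θ)) ?_
  · refine this.trans (le_of_eq ?_)
    field_simp
  · intro θ hθ
    obtain ⟨hm, hw⟩ := s.char_mem (proc R.i) (proc j) (sameSign R.i j) hp hθ
    set q := R.curve s j p θ with hq
    have hm : q ∈ triangle := hm
    have hw : s.weight (proc R.i) q ≤ _ := hw
    have e1 : R.rhs s f j q - R.rhs s g j q
        = sgn R.i * ∑ l, (f q l - g q l) * R.M l j q.2 := by
      rw [rhs, rhs, retract_of_mem hm, ← mul_sub, add_sub_add_right_eq_sub,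
        ← Finset.sum_sub_distrib]
      simp only [sub_mul]
    rw [e1, abs_mul, abs_sgn, one_mul]
    refine (Finset.abs_sum_le_sum_abs _ _).trans ?_
    have e2 : ∀ l, |(f q l - g q l) * R.M l j q.2| ≤
        D * Real.exp (γ * s.weight (proc R.i) q) * R.bound := by
      intro l
      rw [abs_mul]
      exact mul_le_mul (h q hm l) (R.boundM _ _ _) (abs_nonneg _) (by positivity)
    refine (Finset.sum_le_sum fun l _ => e2 l).trans ?_
    simp only [Finset.sum_const, Finset.card_univ, Fintype.card_sum, Fintype.card_fin,
      nsmul_eq_mul]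
    have e3 : Real.exp (γ * s.weight (proc R.i) q) ≤
        Real.exp (γ * s.weight (proc R.i) p) *
          Real.exp (-(γ * s.rate * |s.Phi (proc R.i) p.1 - θ|)) := by
      rw [← Real.exp_add]
      refine Real.exp_le_exp.2 ?_
      have := mul_le_mul_of_nonneg_left hw hγ.le
      linarith
    calc _ ≤ ((2 + 2 : ℕ) : ℝ) * (D * (Real.exp (γ * s.weight (proc R.i) p) *
          Real.exp (-(γ * s.rate * |s.Phi (proc R.i) p.1 - θ|))) * R.bound) := by gcongr
      _ = _ := by push_cast; ring

/-- The fixed point equation is only solved on the triangle; one more application of the operator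
extends the solution to the whole plane. -/
lemma exists_solution : ∃ g : ℝ × ℝ → Idx → ℝ, Continuous g ∧ ∀ p, g p = R.op s g p := by
  obtain ⟨f, hf, hfix, -⟩ := exists_fixedPoint_of_volterra isCompact_triangle
    (s.continuous_weight (proc R.i)).continuousOn (R.op s)
    (fun f hf => (R.continuous_op s (continuous_comp_retract hf)).continuousOn)
    (C := 8 * R.bound / s.rate) (fun γ hγ D hD f g hf hg h p hp j => by
      have h1 := R.base_lipschitz s hγ hD hf hg h hp j
      have hbd := R.bound_nonneg
      have hr := s.rate_pos
      have e : ∀ x y a b c : ℝ, x - c * a - (y - c * b) = (x - y) - c * (a - b) := by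
        intros; ring
      rw [op, op, e]
      refine (abs_sub _ _).trans ?_
      have h2 : |Speeds.refl (proc R.i) (proc j) (sameSign R.i j) *
          (R.base s f (s.footpoint (proc R.i)
              (s.label (proc R.i) (proc j) (R.sign j) p), 0) j.swap -
            R.base s g (s.footpoint (proc R.i)
              (s.label (proc R.i) (proc j) (R.sign j) p), 0) j.swap)| ≤
          4 * R.bound / s.rate / γ * D * Real.exp (γ * s.weight (proc R.i) p) := by
        by_cases hr : sameSign R.i j = true ∧ (proc R.i = proc j ∨ proc R.i = 0)
        · have hsg : R.sign j = 1 := by simp [sign, hr.1, Speeds.eps]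
          rw [Speeds.refl, if_pos hr, one_mul, hsg]
          obtain ⟨m1, m2⟩ := s.footpoint_mem hr.2 hp
          refine (R.base_lipschitz s hγ hD hf hg h m1 j.swap).trans ?_
          gcongr
        · rw [Speeds.refl, if_neg hr, zero_mul, abs_zero]
          positivity
      refine (add_le_add h1 h2).trans (le_of_eq ?_)
      ring)
  -- `op` only uses the values on the triangle, where `R.op s f = f`
  refine ⟨R.op s f, R.continuous_op s (continuous_comp_retract hf), fun p => ?_⟩
  have hrhs : R.rhs s (R.op s f) = R.rhs s f := by
    funext j q
    simp only [rhs, hfix _ (retract_mem q)]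
  have hbase : R.base s (R.op s f) = R.base s f := by
    funext p j
    simp only [base, hrhs]
  funext j
  change _ = R.base s (R.op s f) p j - _
  unfold op at *
  simp only [hbase]

end RowData

/-- Substitution of the travel time for the position. -/
lemma Speeds.integral_travel (s : Speeds) (k : Fin 2) (h : ℝ → ℝ) (a b : ℝ) :
    ∫ r in (s.Phi k a)..(s.Phi k b), h r = ∫ ζ in a..b, h (s.Phi k ζ) / s.L k ζ := by
  have := intervalIntegral.integral_comp_mul_deriv_of_deriv_nonneg (f := s.Phi k)
    (f' := fun ζ => 1 / s.L k ζ) (g := h) (a := a) (b := b) (s.continuous_Phi k).continuousOn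
    (fun x _ => s.hasDerivAt_Phi k x)
    (fun x _ => (one_div_pos.2 (s.L_pos k x)).le)
  rw [← this]
  simp only [Function.comp, mul_one_div]

/-- A row of the kernel: a solution of the fixed point equation for the data `R`. -/
structure RowSol (s : Speeds) (R : RowData) where
  g : ℝ × ℝ → Idx → ℝ
  cont : Continuous g
  eq : ∀ p, g p = R.op s g p

namespace RowSol

variable {s : Speeds} {R : RowData} (G : RowSol s R)

lemma cont_retract : Continuous fun p => G.g (retract p) := G.cont.comp continuous_retract

/-- The initial value on the characteristic with label `u`, reflection included. -/
def initial (j : Idx) (u : ℝ) : ℝ :=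
  R.init s j u - Speeds.refl (proc R.i) (proc j) (sameSign R.i j) *
    R.base s G.g (s.footpoint (proc R.i) u, 0) j.swap

/-- The solution formula along the characteristic with label `u`. -/
lemma apply_char (j : Idx) (u r : ℝ) :
    G.g (s.char (proc R.i) (proc j) (R.sign j) u r) j = G.initial j u +
      ∫ θ in (s.start (proc R.i) (proc j) (sameSign R.i j) u)..r,
        R.rhs s G.g j (s.char (proc R.i) (proc j) (R.sign j) u θ) := by
  have hl : s.label (proc R.i) (proc j) (R.sign j)
      (s.char (proc R.i) (proc j) (R.sign j) u r) = u := by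
    simp [Speeds.label, Speeds.char]
  have h1 : s.Phi (proc R.i) (s.char (proc R.i) (proc j) (R.sign j) u r).1 = r := by
    simp [Speeds.char]
  rw [G.eq]
  simp only [RowData.op, RowData.base, RowData.curve, initial, hl, h1]
  ring

lemma intervalIntegrable_rhs_char (j : Idx) (u a b : ℝ) :
    IntervalIntegrable (fun θ => R.rhs s G.g j (s.char (proc R.i) (proc j) (R.sign j) u θ))
      volume a b :=
  R.intervalIntegrable_rhs s G.cont_retract j
    ((s.continuous_char _ _ _).comp (Continuous.prodMk_right u)) a b

/-- The integrated equation between two points of the same characteristic. -/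
lemma char_sub (j : Idx) (u a b : ℝ) :
    G.g (s.char (proc R.i) (proc j) (R.sign j) u b) j -
      G.g (s.char (proc R.i) (proc j) (R.sign j) u a) j =
      ∫ θ in a..b, R.rhs s G.g j (s.char (proc R.i) (proc j) (R.sign j) u θ) := by
  rw [G.apply_char, G.apply_char, add_sub_add_left_eq_sub,
    intervalIntegral.integral_interval_sub_left (G.intervalIntegrable_rhs_char _ _ _ _)
      (G.intervalIntegrable_rhs_char _ _ _ _)]

lemma apply_opposite {j : Idx} (h : sameSign R.i j = false) (p : ℝ × ℝ) :
    G.g p j = R.base s G.g p j := by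
  conv_lhs => rw [G.eq]
  simp [RowData.op, Speeds.refl, h]

lemma sameSign_swap (i j : Idx) : sameSign i j.swap = !sameSign i j := by
  rcases i with i | i <;> rcases j with j | j <;> simp [sameSign]

/-- Columns of the opposite sign attain the prescribed values on the diagonal. -/
lemma apply_opposite_diag {j : Idx} (h : sameSign R.i j = false) {z : ℝ} (hz : z ∈ Icc (0 : ℝ) 1) :
    G.g (z, z) j = R.d j z := by
  rw [G.apply_opposite h]
  have hl : s.label (proc R.i) (proc j) (R.sign j) (z, z) = s.Phi (proc R.i) z + s.Phi (proc j) z := by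
    simp only [Speeds.label, RowData.sign, h, Speeds.eps]
    simp
    ring
  rw [RowData.base, hl]
  simp [RowData.init, h, Speeds.start, s.sumInv_apply, clamp_of_mem hz]

/-- Off the column `R.i`, the prescribed values on the diagonal are attained. For the column of the
slow process in a fast row, the reflection at the corner cancels the second summand in `init`. -/
lemma apply_diag {j : Idx} (hj : j ≠ R.i) {z : ℝ} (hz : z ∈ Icc (0 : ℝ) 1) :
    G.g (z, z) j = R.d j z := by
  rcases h : sameSign R.i j with _ | _
  · exact G.apply_opposite_diag h hz
  have hp : proc R.i ≠ proc j := by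
    intro hp
    apply hj
    generalize R.i = i at *
    rcases i with i | i <;> rcases j with j | j <;> simp_all [sameSign]
  have hsg : R.sign j = 1 := by simp [RowData.sign, h, Speeds.eps]
  rw [G.eq]
  by_cases h1 : proc R.i = 1
  · have h0 : proc j = 0 := by omega
    have hl : s.label (proc R.i) (proc j) (R.sign j) (z, z) = -(s.Phi 1 z - s.Phi 0 z) := by
      simp [Speeds.label, hsg, h1, h0]
    rw [RowData.op, RowData.base, hl]
    simp [RowData.init, h, h1, h0, Speeds.start, Speeds.refl,
      s.diffInv_apply, clamp_of_mem hz, min_eq_left hz.2]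
  · have h0 : proc R.i = 0 := by omega
    have h1' : proc j = 1 := by omega
    have hl : s.label (proc R.i) (proc j) (R.sign j) (z, z) = s.Phi 1 z - s.Phi 0 z := by
      simp [Speeds.label, hsg, h0, h1']
    have hu : 0 ≤ s.Phi 1 z - s.Phi 0 z := by simpa using s.Phi_le_Phi hz.1
    have hf : s.footpoint (proc R.i) (s.Phi 1 z - s.Phi 0 z) = 0 := by
      rw [Speeds.footpoint, max_eq_right (by linarith), s.Psi_zero]
    have hsw : sameSign R.i j.swap = false := by rw [sameSign_swap, h]; rfl
    rw [RowData.op, hl, hf, ← G.apply_opposite hsw, G.apply_opposite_diag hsw (by simp),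
      RowData.base, hl]
    have hst : s.start (proc R.i) (proc j) (sameSign R.i j) (s.Phi 1 z - s.Phi 0 z)
        = s.Phi (proc R.i) z := by
      have : max (s.Phi 0 z - s.Phi 1 z) 0 = 0 := max_eq_right (by linarith)
      simp [Speeds.start, h, h0, h1', s.diffInv_apply, max_eq_left hz.1, this]
    rw [hst]
    simp [RowData.init, h, h0, h1', Speeds.refl, s.diffInv_apply, clamp_of_mem hz]

/-- The diagonal entry of the kernel is determined by the reflection at `ζ = 0`. -/
lemma apply_zero_self {z : ℝ} (hz : 0 ≤ z) : G.g (z, 0) R.i = -G.g (z, 0) R.i.swap := by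
  have h : sameSign R.i R.i = true := by simp [sameSign]
  have hsw : sameSign R.i R.i.swap = false := by rw [sameSign_swap, h]; rfl
  have hsg : R.sign R.i = 1 := by simp [RowData.sign, h, Speeds.eps]
  have hl : s.label (proc R.i) (proc R.i) (R.sign R.i) (z, 0) = -s.Phi (proc R.i) z := by
    simp [Speeds.label, hsg]
  have hf : s.footpoint (proc R.i) (-s.Phi (proc R.i) z) = z := by
    rw [Speeds.footpoint, neg_neg, max_eq_left (s.Phi_nonneg _ hz), s.Psi_Phi]
  conv_lhs => rw [G.eq]
  rw [RowData.op, hl, hf, ← G.apply_opposite hsw, RowData.base, hl]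
  simp [RowData.init, h, Speeds.start, Speeds.refl]

/-- In the fast rows the reflection holds for the entries of the slow process below the curve
`φ₁(z) = φ₂(ζ)`, that is, with the jump included. -/
lemma apply_zero_slow {j : Idx} (h : sameSign R.i j = true) (h0 : proc R.i = 0) (h1 : proc j = 1)
    {z : ℝ} (hz : 0 ≤ z) : G.g (z, 0) j + R.jump j + G.g (z, 0) j.swap = 0 := by
  have hsw : sameSign R.i j.swap = false := by rw [sameSign_swap, h]; rfl
  have hsg : R.sign j = 1 := by simp [RowData.sign, h, Speeds.eps]
  have hl : s.label (proc R.i) (proc j) (R.sign j) (z, 0) = -s.Phi 0 z := by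
    simp [Speeds.label, hsg, h0]
  have hu := s.Phi_nonneg 0 hz
  have hf : s.footpoint (proc R.i) (-s.Phi 0 z) = z := by
    rw [Speeds.footpoint, neg_neg, max_eq_left hu, h0, s.Psi_Phi]
  have hy : s.diffInv (-s.Phi 0 z) ≤ 0 := by
    simpa using s.diffInv_mono (show -s.Phi 0 z ≤ 0 by linarith)
  have hc : clamp (s.diffInv (-s.Phi 0 z)) = 0 := by
    rw [clamp, max_eq_left]
    exact (min_le_right _ _).trans hy
  have hst : s.start (proc R.i) (proc j) (sameSign R.i j) (-s.Phi 0 z) = s.Phi (proc R.i) z := by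
    simp [Speeds.start, h, h0, h1, max_eq_right hy, max_eq_left hu]
  have e : G.g (z, 0) j = R.d j 0 + R.d j.swap 0 - G.g (z, 0) j.swap := by
    conv_lhs => rw [G.eq]
    rw [RowData.op, hl, hf, ← G.apply_opposite hsw, RowData.base, hl, hst]
    simp [RowData.init, h, Speeds.refl, h0, h1, hc]
  rw [e, RowData.jump, if_pos ⟨h, h0, h1⟩]
  ring

/-! ### Differentiation of the Volterra integral of a row -/

/-- Differentiation under the integral along characteristics. -/
lemma hasDerivAt_integral (j : Idx) {x x' : ℝ → ℝ} (hx : ∀ z, HasDerivAt x (x' z) z)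
    (hx' : Continuous x') (z : ℝ) :
    HasDerivAt (fun z => ∫ ζ in (0 : ℝ)..z, G.g (z, ζ) j * x ζ / s.L (proc j) ζ)
      (((s.L (proc R.i) z / s.L (proc j) z - R.sign j) * (G.g (z, z) j * x z) +
        R.sign j * (G.g (z, 0) j * x 0) +
        ∫ ζ in (0 : ℝ)..z, (R.rhs s G.g j (z, ζ) * x ζ / s.L (proc j) ζ +
          R.sign j * (G.g (z, ζ) j * x' ζ))) / s.L (proc R.i) z) z := by
  set k := proc R.i with hk
  set l := proc j with hl
  set ε := R.sign j with hε
  have hεε : ε * ε = 1 := by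
    rw [hε]
    simp only [RowData.sign, Speeds.eps]
    split_ifs <;> norm_num
  have hgc : Continuous fun p => G.g p j := (continuous_apply j).comp G.cont
  -- in the coordinates `r = Phi k z` and `u` of the characteristics, the derivative of `g_j` with
  -- respect to `r` is `rhs`, while `x` is differentiated in its argument `u + ε r`
  set ξ : ℝ → ℝ := fun r => x (s.Psi l r) with hξ
  set ξ' : ℝ → ℝ := fun r => x' (s.Psi l r) * s.L l (s.Psi l r) with hξ'
  have hξd : ∀ r, HasDerivAt ξ (ξ' r) r := fun r => (hx _).comp r (s.hasDerivAt_Psi l r)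
  have hxc : Continuous x := continuous_iff_continuousAt.2 fun z => (hx z).continuousAt
  have hξc : Continuous ξ := hxc.comp (s.continuous_Psi l)
  have hξ'c : Continuous ξ' :=
    (hx'.comp (s.continuous_Psi l)).mul ((s.cont l).comp (s.continuous_Psi l))
  obtain ⟨D, hD⟩ := R.exists_bound_rhs s G.cont_retract j
  set r₀ := s.Phi k z with hr₀
  -- the integral in the coordinates `r = Phi k z` and `u`
  have hcoord : ∀ (h : ℝ × ℝ → ℝ → ℝ) (r : ℝ),
      ∫ u in (-(ε * r))..(s.Phi l (s.Psi k r) - ε * r), h (s.char k l ε u r) (u + ε * r) =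
      ∫ ζ in (0 : ℝ)..(s.Psi k r), h (s.Psi k r, ζ) (s.Phi l ζ) / s.L l ζ := by
    intro h r
    have e1 := intervalIntegral.integral_comp_add_right
      (fun t => h (s.Psi k r, s.Psi l t) t) (ε * r)
      (a := -(ε * r)) (b := s.Phi l (s.Psi k r) - ε * r)
    rw [sub_add_cancel, neg_add_cancel] at e1
    have e2 := s.integral_travel l (fun t => h (s.Psi k r, s.Psi l t) t) 0 (s.Psi k r)
    simp only [s.Phi_zero, s.Psi_Phi] at e2
    rw [← e2, ← e1]
    rfl
  have hmain := hasDerivAt_integral_moving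
    (P := fun r u => G.g (s.char k l ε u r) j) (X := fun r u => ξ (u + ε * r))
    (X' := fun r u => ξ' (u + ε * r) * ε) (F := fun u => R.rhs s G.g j (s.char k l ε u r₀))
    (a := fun r => -(ε * r)) (b := fun r => s.Phi l (s.Psi k r) - ε * r) (r₀ := r₀) (C := D)
    (a' := -ε) (b' := 1 / s.L l z * s.L k z - ε)
    (hgc.comp ((s.continuous_char k l ε).comp continuous_swap))
    (hξc.comp (by fun_prop)) ((hξ'c.comp (by fun_prop)).mul continuous_const)
    (fun r u => by
      have h1 : HasDerivAt (fun r => u + ε * r) ε r := by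
        simpa using ((hasDerivAt_id r).const_mul ε).const_add u
      exact (hξd _).comp r h1)
    (fun u r r' => by
      have h1 := G.char_sub j u r' r
      have h2 := intervalIntegral.norm_integral_le_of_norm_le_const
        (f := fun θ => R.rhs s G.g j (s.char k l ε u θ)) (a := r') (b := r) (C := D)
        fun θ _ => hD _
      rw [← h1] at h2
      exact h2)
    ((R.measurable_rhs s G.cont_retract j).comp
      ((s.continuous_char k l ε).comp (by fun_prop : Continuous fun u : ℝ => (u, r₀))).measurable)
    ?_ ?_ ?_
  · have hcomp := HasDerivAt.comp z (h₂ := fun r => ∫ u in (-(ε * r))..(s.Phi l (s.Psi k r) - ε * r),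
        G.g (s.char k l ε u r) j * ξ (u + ε * r)) (h := s.Phi k) hmain (s.hasDerivAt_Phi k z)
    have e1 : ((fun r => ∫ u in (-(ε * r))..(s.Phi l (s.Psi k r) - ε * r),
        G.g (s.char k l ε u r) j * ξ (u + ε * r)) ∘ s.Phi k) =
        fun z => ∫ ζ in (0 : ℝ)..z, G.g (z, ζ) j * x ζ / s.L l ζ := by
      funext z
      have := hcoord (fun p t => G.g p j * ξ t) (s.Phi k z)
      simp only [Function.comp]
      rw [this]
      simp only [hξ, s.Psi_Phi]
    rw [e1] at hcomp
    refine hcomp.congr_deriv ?_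
    rw [hr₀]
    have e2 := hcoord (fun p t => R.rhs s G.g j p * ξ t + G.g p j * (ξ' t * ε)) (s.Phi k z)
    rw [e2]
    have e3 : s.char k l ε (s.Phi l z - ε * s.Phi k z) (s.Phi k z) = (z, z) := by
      simp [Speeds.char]
    have e4 : s.char k l ε (-(ε * s.Phi k z)) (s.Phi k z) = (z, 0) := by
      simp [Speeds.char]
    simp only [s.Psi_Phi, e3, e4, hξ, hξ', sub_add_cancel, neg_add_cancel, s.Psi_zero]
    have e5 : ∀ ζ, (R.rhs s G.g j (z, ζ) * x ζ + G.g (z, ζ) j * (x' ζ * s.L l ζ * ε)) / s.L l ζ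
        = R.rhs s G.g j (z, ζ) * x ζ / s.L l ζ + ε * (G.g (z, ζ) j * x' ζ) := by
      intro ζ
      have := s.L_ne l ζ
      field_simp
    simp only [e5]
    ring
  · -- the right-hand side is continuous at all but at most one of these points
    have hae : ∀ᵐ u, (∀ ζ, R.source j ζ = 0) ∨
        s.Phi 1 (s.char k l ε u r₀).2 ≠ s.Phi 0 (s.char k l ε u r₀).1 := by
      have hsub : {u | s.Phi 1 (s.char k l ε u r₀).2 =
          s.Phi 0 (s.char k l ε u r₀).1}.Subsingleton := by
        intro u hu v hv
        have h1 : s.Phi 1 (s.Psi l (u + ε * r₀)) = s.Phi 1 (s.Psi l (v + ε * r₀)) :=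
          Eq.trans hu (Eq.symm hv)
        have h2 := (s.Phi_strictMono 1).injective h1
        have h3 := congrArg (s.Phi l) h2
        simp only [s.Phi_Psi] at h3
        linarith
      filter_upwards [compl_mem_ae_iff.2 (hsub.measure_zero volume)] with u hu
      exact Or.inr hu
    filter_upwards [hae] with u hu
    have hc : Continuous fun θ => s.char k l ε u θ :=
      (s.continuous_char k l ε).comp (Continuous.prodMk_right u)
    have hca : ContinuousAt (fun θ => R.rhs s G.g j (s.char k l ε u θ)) r₀ :=
      ContinuousAt.comp (f := fun θ => s.char k l ε u θ)
        (R.continuousAt_rhs s G.cont_retract j hu) hc.continuousAt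
    have hms : StronglyMeasurable fun θ => R.rhs s G.g j (s.char k l ε u θ) :=
      ((R.measurable_rhs s G.cont_retract j).comp hc.measurable).stronglyMeasurable
    have h1 := (intervalIntegral.integral_hasDerivAt_right
      (G.intervalIntegrable_rhs_char j u (s.start k l (sameSign R.i j) u) r₀)
      (hms.stronglyMeasurableAtFilter) hca).const_add (G.initial j u)
    refine h1.congr_of_eventuallyEq (Eventually.of_forall fun r => ?_)
    exact G.apply_char j u r
  · simpa using! ((hasDerivAt_id r₀).const_mul ε).neg
  · have h1 : HasDerivAt (fun r => s.Phi l (s.Psi k r)) (1 / s.L l z * s.L k z) r₀ := by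
      have h2 := s.hasDerivAt_Psi k r₀
      have h3 := s.hasDerivAt_Phi l (s.Psi k r₀)
      have := h3.comp r₀ h2
      rw [hr₀, s.Psi_Phi] at this
      exact this
    simpa using! h1.sub ((hasDerivAt_id r₀).const_mul ε)

end RowSol

/-! ### Integrals over the two parts of the triangle -/

namespace Speeds

variable (s : Speeds)

/-- The curve `φ₁(z) = φ₂(ζ)` as a graph `ζ = cut z`. -/
def cut (z : ℝ) : ℝ := s.Psi 1 (s.Phi 0 z)

lemma continuous_cut : Continuous s.cut := (s.continuous_Psi 1).comp (s.continuous_Phi 0)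

lemma cut_nonneg {z : ℝ} (hz : 0 ≤ z) : 0 ≤ s.cut z := by
  simpa [cut] using s.Psi_mono 1 (s.Phi_nonneg 0 hz)

lemma cut_le {z : ℝ} (hz : 0 ≤ z) : s.cut z ≤ z := by
  have := s.Psi_mono 1 (show s.Phi 0 z ≤ s.Phi 1 z by simpa using s.Phi_le_Phi hz)
  simpa [cut] using this

lemma hasDerivAt_cut (z : ℝ) : HasDerivAt s.cut (s.L 1 (s.cut z) / s.L 0 z) z := by
  have := (s.hasDerivAt_Psi 1 (s.Phi 0 z)).comp z (s.hasDerivAt_Phi 0 z)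
  exact this.congr_deriv (by rw [cut, mul_one_div])

lemma lt_cut_iff {z ζ : ℝ} : ζ < s.cut z ↔ s.Phi 1 ζ < s.Phi 0 z := by
  rw [← (s.Phi_strictMono 1).lt_iff_lt, cut, s.Phi_Psi]

lemma integral_below_mul (f : ℝ → ℝ) {z : ℝ} (hz : 0 ≤ z) :
    ∫ ζ in (0 : ℝ)..z, s.below (z, ζ) * f ζ = ∫ ζ in (0 : ℝ)..(s.cut z), f ζ := by
  rw [intervalIntegral.integral_of_le hz, intervalIntegral.integral_of_le (s.cut_nonneg hz),
    integral_Ioc_eq_integral_Ioo (y := s.cut z)]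
  have : (fun ζ => s.below (z, ζ) * f ζ) = (Iio (s.cut z)).indicator f := by
    funext ζ
    by_cases h : ζ < s.cut z
    · rw [indicator_of_mem (show ζ ∈ Iio _ from h), below, if_pos (s.lt_cut_iff.1 h), one_mul]
    · rw [indicator_of_notMem (show ζ ∉ Iio _ from h), below,
        if_neg (fun h' => h (s.lt_cut_iff.2 h')), zero_mul]
  rw [this, setIntegral_indicator measurableSet_Iio]
  congr 2
  ext ζ
  simp only [mem_inter_iff, mem_Ioc, mem_Iio, mem_Ioo]
  exact ⟨fun h => ⟨h.1.1, h.2⟩, fun h => ⟨⟨h.1, h.2.le.trans (s.cut_le hz)⟩, h.2⟩⟩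

lemma intervalIntegrable_below_mul {f : ℝ → ℝ} (hf : Continuous f) (z a b : ℝ) :
    IntervalIntegrable (fun ζ => s.below (z, ζ) * f ζ) volume a b := by
  refine (hf.norm.intervalIntegrable a b).mono_fun' ?_ (Eventually.of_forall fun ζ => ?_)
  · exact ((s.measurable_below.comp (measurable_const.prodMk measurable_id)).mul
      hf.measurable).aestronglyMeasurable
  · dsimp only
    rw [norm_mul]
    exact mul_le_of_le_one_left (norm_nonneg _) (s.abs_below_le _)

end Speeds

/-! ### The kernel -/

/-- The coefficients of the beam equations, extended to the real line. -/
structure Coeffs where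
  s : Speeds
  A : ℝ → Matrix Idx Idx ℝ
  bound : ℝ
  contA : Continuous A
  boundA : ∀ ζ l j, |A ζ l j| ≤ bound
  diagA : ∀ ζ i, A ζ i i = 0

namespace Coeffs

variable (c : Coeffs)

/-- The diagonal entries of `diag(Λ, -Λ)`. -/
def v (j : Idx) (z : ℝ) : ℝ := sgn j * c.s.L (proc j) z

lemma continuous_v (j : Idx) : Continuous (c.v j) := continuous_const.mul (c.s.cont _)

lemma v_ne_zero (j : Idx) (z : ℝ) : c.v j z ≠ 0 := by
  have := c.s.L_pos (proc j) z
  rcases j with j | j <;> simp [v, proc] <;> exact c.s.L_ne _ _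

lemma v_sub_ne_zero {i j : Idx} (h : j ≠ i) (z : ℝ) : c.v j z - c.v i z ≠ 0 := by
  have h0 := c.s.L_pos 0 z
  have h1 := c.s.L_pos 1 z
  have h2 := c.s.gap z
  have h3 := mul_pos c.s.δ_pos h1
  have key : c.s.L 1 z < c.s.L 0 z := by linarith
  rcases i with i | i <;> rcases j with j | j <;> fin_cases i <;> fin_cases j <;>
    simp [v] at h ⊢ <;> intro h' <;> linarith

lemma contA_apply (l j : Idx) : Continuous fun z => c.A z l j :=
  c.contA.matrix_elem l j

/-- The data for the row `i` of the kernel. -/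
def row (i : Idx) : RowData where
  i := i
  M l j ζ := c.s.L (proc j) ζ * c.A ζ l j / c.s.L (proc l) ζ
  bound := c.s.hi * c.bound / c.s.lo
  d j z := c.s.L (proc j) z * c.A z i j / (c.v j z - c.v i z)
  contM l j := ((c.s.cont _).mul (c.contA_apply l j)).div (c.s.cont _) (c.s.L_ne _)
  boundM l j ζ := by
    have h1 := c.s.L_pos (proc j) ζ
    have h2 := c.s.L_pos (proc l) ζ
    have h3 := c.s.lo_pos
    have h4 := c.s.hi_pos
    have h5 := c.boundA ζ l j
    have h6 := c.s.le_hi (proc j) ζ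
    have h7 := c.s.lo_le (proc l) ζ
    have h8 : 0 ≤ c.bound := (abs_nonneg _).trans h5
    rw [abs_div, abs_mul, abs_of_pos h1, abs_of_pos h2]
    gcongr
  diagM j ζ := by rw [c.diagA, mul_zero, zero_div]
  contd j := by
    by_cases h : j = i
    · subst h
      simp only [c.diagA, mul_zero, zero_div]
      exact continuous_const
    · exact ((c.s.cont _).mul (c.contA_apply i j)).div ((c.continuous_v j).sub (c.continuous_v i))
        (c.v_sub_ne_zero h)

/-- The row `i` of the kernel, multiplied by the speeds. -/
def sol (i : Idx) : RowSol c.s (c.row i) :=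
  ⟨((c.row i).exists_solution c.s).choose, ((c.row i).exists_solution c.s).choose_spec.1,
    ((c.row i).exists_solution c.s).choose_spec.2⟩

/-- The continuous part of the row `i`. -/
def g (i : Idx) (p : ℝ × ℝ) (j : Idx) : ℝ := (c.sol i).g p j

/-- The jump of the row `i` across the curve `φ₁(z) = φ₂(ζ)`. -/
def jump (i j : Idx) : ℝ := (c.row i).jump j

lemma continuous_g (i j : Idx) : Continuous fun p => c.g i p j :=
  (continuous_apply j).comp (c.sol i).cont

/-- The kernel of the Volterra transformation. -/
def K (z ζ : ℝ) : Matrix Idx Idx ℝ :=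
  fun i j => (c.g i (z, ζ) j + c.s.below (z, ζ) * c.jump i j) / c.s.L (proc j) ζ

/-- The coefficient of the nonlocal term in the component `i` of the transformed equations. -/
def alpha (i : Idx) (z : ℝ) : ℝ := c.g i (z, 0) (Sum.inl 0) + c.g i (z, 0) (Sum.inr 0)

lemma jump_mul_sgn (i j : Idx) : sgn i * c.jump i j = sgn j * c.jump i j := by
  rcases i with i | i <;> rcases j with j | j <;> simp [jump, RowData.jump, row, sameSign]

lemma jump_of_slow {i : Idx} (h : proc i = 1) (j : Idx) : c.jump i j = 0 := by
  simp [jump, RowData.jump, row, h]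

lemma jump_of_fast (i : Idx) {j : Idx} (h : proc j = 0) : c.jump i j = 0 := by
  simp [jump, RowData.jump, row, h]

lemma sgn_sign (i j : Idx) : sgn i * (c.row i).sign j = sgn j := by
  have : (c.row i).sign j = sgn i * sgn j := (sgn_mul_sgn i j).symm
  rw [this, ← mul_assoc, sgn_mul_self, one_mul]

/-- The equation along characteristics in terms of the kernel: the right-hand side is the one of the
kernel equations, multiplied by the speed. -/
lemma rhs_eq {i j : Idx} {z ζ : ℝ} (h : (z, ζ) ∈ triangle) :
    sgn i * (c.row i).rhs c.s (c.sol i).g j (z, ζ) =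
      c.s.L (proc j) ζ * (c.K z ζ * c.A ζ) i j := by
  have e : (c.row i).rhs c.s (c.sol i).g j (z, ζ) = sgn i *
      (∑ l, c.g i (z, ζ) l * (c.s.L (proc j) ζ * c.A ζ l j / c.s.L (proc l) ζ) +
        c.s.below (z, ζ) *
          ∑ l, c.jump i l * (c.s.L (proc j) ζ * c.A ζ l j / c.s.L (proc l) ζ)) := by
    rw [RowData.rhs, retract_of_mem h]
    rfl
  rw [e, ← mul_assoc, sgn_mul_self, one_mul, Matrix.mul_apply, Finset.mul_sum, Finset.mul_sum,
    ← Finset.sum_add_distrib]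
  refine Finset.sum_congr rfl fun l _ => ?_
  simp only [K]
  have := c.s.L_ne (proc l) ζ
  field_simp

/-- The condition on the diagonal. -/
lemma g_diag {i j : Idx} {z : ℝ} (hz : z ∈ Icc (0 : ℝ) 1) :
    (c.v j z - c.v i z) * c.g i (z, z) j = c.s.L (proc j) z * c.A z i j := by
  by_cases h : j = i
  · subst h
    rw [sub_self, zero_mul, c.diagA, mul_zero]
  · have := (c.sol i).apply_diag (j := j) h hz
    rw [show c.g i (z, z) j = _ from this]
    exact mul_div_cancel₀ _ (c.v_sub_ne_zero h z)

/-- On `ζ = 0`, the entries of the slow process in each row cancel. -/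
lemma g_zero_inl_slow (z : ℝ) (hz : 0 ≤ z) (i : Idx) :
    c.g i (z, 0) (Sum.inl 1) + c.jump i (Sum.inl 1) +
      (c.g i (z, 0) (Sum.inr 1) + c.jump i (Sum.inr 1)) = 0 := by
  rcases i with i | i <;> obtain rfl | rfl : i = 0 ∨ i = 1 := by omega
  · have h1 := (c.sol (Sum.inl 0)).apply_zero_slow (j := Sum.inl 1) rfl rfl rfl hz
    have h2 : c.jump (Sum.inl 0) (Sum.inr 1) = 0 := by simp [jump, RowData.jump, row, sameSign]
    rw [h2, add_zero]
    exact h1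
  · have h1 := (c.sol (Sum.inl 1)).apply_zero_self hz
    rw [c.jump_of_slow rfl, c.jump_of_slow rfl, add_zero, add_zero]
    have h2 : c.g (Sum.inl 1) (z, 0) (Sum.inl 1) = -c.g (Sum.inl 1) (z, 0) (Sum.inr 1) := h1
    linarith
  · have h1 := (c.sol (Sum.inr 0)).apply_zero_slow (j := Sum.inr 1) rfl rfl rfl hz
    have h2 : c.jump (Sum.inr 0) (Sum.inl 1) = 0 := by simp [jump, RowData.jump, row, sameSign]
    rw [h2, add_zero, add_comm]
    exact h1
  · have h1 := (c.sol (Sum.inr 1)).apply_zero_self hz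
    rw [c.jump_of_slow rfl, c.jump_of_slow rfl, add_zero, add_zero]
    have h2 : c.g (Sum.inr 1) (z, 0) (Sum.inr 1) = -c.g (Sum.inr 1) (z, 0) (Sum.inl 1) := h1
    linarith

/-- The fast components of the target system have no nonlocal term. This makes the flat output of the
fast process a pure delay of its state. -/
lemma alpha_fast {i : Idx} (hi : proc i = 0) {z : ℝ} (hz : 0 ≤ z) : c.alpha i z = 0 := by
  rcases i with i | i <;> simp only [proc_inl, proc_inr] at hi <;> subst hi
  · have h1 : c.g (Sum.inl 0) (z, 0) (Sum.inl 0) = -c.g (Sum.inl 0) (z, 0) (Sum.inr 0) :=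
      (c.sol (Sum.inl 0)).apply_zero_self hz
    simp only [alpha]
    linarith
  · have h1 : c.g (Sum.inr 0) (z, 0) (Sum.inr 0) = -c.g (Sum.inr 0) (z, 0) (Sum.inl 0) :=
      (c.sol (Sum.inr 0)).apply_zero_self hz
    simp only [alpha]
    linarith

lemma continuous_alpha (i : Idx) : Continuous (c.alpha i) :=
  ((c.continuous_g i _).comp (by fun_prop)).add ((c.continuous_g i _).comp (by fun_prop))

/-! ### The Volterra transformation turns the beam operator into the target operator -/

/-- The differential operator of the beam equations, for a function with derivative `x'`. -/
def beamOp (x x' : ℝ → Idx → ℝ) (z : ℝ) (j : Idx) : ℝ :=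
  c.v j z * x' z j + (Matrix.mulVec (c.A z) (x z)) j

lemma K_mulVec_beamOp {z ζ : ℝ} (h : (z, ζ) ∈ triangle) (x x' : ℝ → Idx → ℝ) (i : Idx) :
    Matrix.mulVec (c.K z ζ) (c.beamOp x x' ζ) i =
      ∑ j, (sgn i * ((c.row i).rhs c.s (c.sol i).g j (z, ζ) * x ζ j / c.s.L (proc j) ζ +
        (c.row i).sign j * (c.g i (z, ζ) j * x' ζ j)) +
        c.s.below (z, ζ) * (sgn j * c.jump i j * x' ζ j)) := by
  have e1 : ∀ j, sgn i * ((c.row i).rhs c.s (c.sol i).g j (z, ζ) * x ζ j / c.s.L (proc j) ζ +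
        (c.row i).sign j * (c.g i (z, ζ) j * x' ζ j)) +
        c.s.below (z, ζ) * (sgn j * c.jump i j * x' ζ j) =
      (c.K z ζ * c.A ζ) i j * x ζ j + c.K z ζ i j * (c.v j ζ * x' ζ j) := by
    intro j
    have hL := c.s.L_ne (proc j) ζ
    have h1 := c.rhs_eq (i := i) (j := j) h
    have h2 := c.sgn_sign i j
    calc _ = (sgn i * (c.row i).rhs c.s (c.sol i).g j (z, ζ)) * x ζ j / c.s.L (proc j) ζ +
          (sgn i * (c.row i).sign j) * (c.g i (z, ζ) j * x' ζ j) +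
          c.s.below (z, ζ) * (sgn j * c.jump i j * x' ζ j) := by ring
      _ = _ := by
        rw [h1, h2]
        simp only [K, v]
        field_simp
        ring
  simp only [e1, Finset.sum_add_distrib]
  have e2 : c.beamOp x x' ζ = (fun j => c.v j ζ * x' ζ j) + Matrix.mulVec (c.A ζ) (x ζ) := rfl
  rw [e2, Matrix.mulVec_add, Matrix.mulVec_mulVec, Pi.add_apply, add_comm]
  rfl

lemma K_mulVec (z ζ : ℝ) (y : Idx → ℝ) (i : Idx) :
    Matrix.mulVec (c.K z ζ) y i = ∑ j, (c.g i (z, ζ) j * y j / c.s.L (proc j) ζ +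
      c.s.below (z, ζ) * (c.jump i j * y j / c.s.L (proc j) ζ)) := by
  simp only [Matrix.mulVec, dotProduct, K]
  refine Finset.sum_congr rfl fun j _ => ?_
  ring

lemma integral_K_mulVec {x : ℝ → Idx → ℝ} (hx : ∀ j, Continuous fun z => x z j) {z : ℝ}
    (hz : 0 ≤ z) (i : Idx) :
    ∫ ζ in (0 : ℝ)..z, Matrix.mulVec (c.K z ζ) (x ζ) i =
      ∑ j, ((∫ ζ in (0 : ℝ)..z, c.g i (z, ζ) j * x ζ j / c.s.L (proc j) ζ) +
        ∫ ζ in (0 : ℝ)..(c.s.cut z), c.jump i j * x ζ j / c.s.L (proc j) ζ) := by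
  have h1 : ∀ j, Continuous fun ζ => c.g i (z, ζ) j * x ζ j / c.s.L (proc j) ζ := fun j =>
    (((c.continuous_g i j).comp (by fun_prop)).mul (hx j)).div (c.s.cont _) (c.s.L_ne _)
  have h2 : ∀ j, Continuous fun ζ => c.jump i j * x ζ j / c.s.L (proc j) ζ := fun j =>
    (continuous_const.mul (hx j)).div (c.s.cont _) (c.s.L_ne _)
  simp only [K_mulVec]
  rw [intervalIntegral.integral_finsetSum fun j _ => ((h1 j).intervalIntegrable _ _).add
    (c.s.intervalIntegrable_below_mul (h2 j) z _ _)]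
  refine Finset.sum_congr rfl fun j _ => ?_
  rw [intervalIntegral.integral_add ((h1 j).intervalIntegrable _ _)
    (c.s.intervalIntegrable_below_mul (h2 j) z _ _), c.s.integral_below_mul _ hz]

/-- The boundary terms on `ζ = 0` add up to the nonlocal term. -/
lemma boundary_terms {y : Idx → ℝ} (h0 : ∀ k, y (Sum.inr k) = -y (Sum.inl k)) {z : ℝ}
    (hz : 0 ≤ z) (i : Idx) :
    ∑ j, sgn j * ((c.g i (z, 0) j + c.jump i j) * y j) = c.alpha i z * y (Sum.inl 0) := by
  have h1 := c.g_zero_inl_slow z hz i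
  have j0 := c.jump_of_fast i (j := Sum.inl 0) rfl
  have j1 := c.jump_of_fast i (j := Sum.inr 0) rfl
  simp only [Fintype.sum_sum_type, Fin.sum_univ_two, sgn_inl, sgn_inr, h0, alpha, j0, j1]
  linear_combination h1 * y (Sum.inl 1)

/-- The intertwining property: with `ξ = volterra K x`, the operator `v ∂_z` applied to `ξ` equals
the Volterra transform of the beam operator applied to `x`, up to the nonlocal term
`α x₁⁻(0)`. The terms on the diagonal, on `ζ = 0`, on the curve `φ₁(z) = φ₂(ζ)` and in the interior
cancel by the respective parts of the kernel equations. -/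
theorem hasDerivWithinAt_volterra {x x' : ℝ → Idx → ℝ}
    (hx : ∀ j z, HasDerivAt (fun z => x z j) (x' z j) z) (hx' : ∀ j, Continuous fun z => x' z j)
    (h0 : ∀ k, x 0 (Sum.inr k) = -x 0 (Sum.inl k)) (i : Idx) {z : ℝ} (hz : z ∈ Icc (0 : ℝ) 1) :
    HasDerivWithinAt (fun z => volterra c.K x z i)
      ((volterra c.K (c.beamOp x x') z i - c.alpha i z * x 0 (Sum.inl 0)) / c.v i z)
      (Icc 0 1) z := by
  have hxc : ∀ j, Continuous fun z => x z j := fun j =>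
    continuous_iff_continuousAt.2 fun z => (hx j z).continuousAt
  have hLi := c.s.L_ne (proc i) z
  have hvi := c.v_ne_zero i z
  have hG := fun j => (c.sol i).hasDerivAt_integral j (hx j) (hx' j) z
  have hJ : ∀ j, HasDerivAt (fun z => ∫ ζ in (0 : ℝ)..(c.s.cut z),
      c.jump i j * x ζ j / c.s.L (proc j) ζ)
      (c.jump i j * x (c.s.cut z) j / c.s.L (proc i) z) z := by
    intro j
    have h2 : Continuous fun ζ => c.jump i j * x ζ j / c.s.L (proc j) ζ :=
      (continuous_const.mul (hxc j)).div (c.s.cont _) (c.s.L_ne _)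
    have h3 := (h2.integral_hasStrictDerivAt 0 (c.s.cut z)).hasDerivAt.comp z (c.s.hasDerivAt_cut z)
    refine h3.congr_deriv ?_
    by_cases hj : proc j = 0
    · rw [c.jump_of_fast i hj]; simp
    by_cases hi : proc i = 1
    · rw [c.jump_of_slow hi]; simp
    have hj1 : proc j = 1 := by omega
    have hi0 : proc i = 0 := by omega
    rw [hj1, hi0]
    have := c.s.L_ne 1 (c.s.cut z)
    field_simp
  have hsum := (hx i z).sub (HasDerivAt.fun_sum (u := Finset.univ) fun j _ => (hG j).add (hJ j))
  have heq : ∀ y ∈ Icc (0 : ℝ) 1, volterra c.K x y i = ((fun z => x z i) -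
      fun z => ∑ j, ((∫ ζ in (0 : ℝ)..z, c.g i (z, ζ) j * x ζ j / c.s.L (proc j) ζ) +
        ∫ ζ in (0 : ℝ)..(c.s.cut z), c.jump i j * x ζ j / c.s.L (proc j) ζ)) y := by
    intro y hy
    simp only [volterra, Pi.sub_apply]
    rw [c.integral_K_mulVec hxc hy.1]
  refine (hsum.hasDerivWithinAt.congr heq (heq z hz)).congr_deriv ?_
  -- the integral terms
  have hint : ∫ ζ in (0 : ℝ)..z, Matrix.mulVec (c.K z ζ) (c.beamOp x x' ζ) i =
      ∑ j, (sgn i * (∫ ζ in (0 : ℝ)..z,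
        ((c.row i).rhs c.s (c.sol i).g j (z, ζ) * x ζ j / c.s.L (proc j) ζ +
          (c.row i).sign j * (c.g i (z, ζ) j * x' ζ j))) +
        sgn j * c.jump i j * (x (c.s.cut z) j - x 0 j)) := by
    have e1 : ∫ ζ in (0 : ℝ)..z, Matrix.mulVec (c.K z ζ) (c.beamOp x x' ζ) i =
        ∫ ζ in (0 : ℝ)..z, ∑ j, (sgn i *
          ((c.row i).rhs c.s (c.sol i).g j (z, ζ) * x ζ j / c.s.L (proc j) ζ +
          (c.row i).sign j * (c.g i (z, ζ) j * x' ζ j)) +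
          c.s.below (z, ζ) * (sgn j * c.jump i j * x' ζ j)) := by
      refine intervalIntegral.integral_congr fun ζ hζ => ?_
      rw [uIcc_of_le hz.1] at hζ
      exact c.K_mulVec_beamOp ⟨hζ.1, hζ.2, hz.2⟩ x x' i
    rw [e1]
    have i1 : ∀ j, IntervalIntegrable (fun ζ => sgn i *
          ((c.row i).rhs c.s (c.sol i).g j (z, ζ) * x ζ j / c.s.L (proc j) ζ +
          (c.row i).sign j * (c.g i (z, ζ) j * x' ζ j))) volume 0 z := by
      intro j
      have h1 := (c.row i).intervalIntegrable_rhs c.s (c.sol i).cont_retract j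
        (γ := fun ζ => (z, ζ)) (by fun_prop) 0 z
      have h2 : Continuous fun ζ => x ζ j / c.s.L (proc j) ζ := (hxc j).div (c.s.cont _) (c.s.L_ne _)
      have h3 : Continuous fun ζ => (c.row i).sign j * (c.g i (z, ζ) j * x' ζ j) :=
        continuous_const.mul (((c.continuous_g i j).comp (by fun_prop)).mul (hx' j))
      refine IntervalIntegrable.const_mul ?_ _
      refine IntervalIntegrable.add ?_ (h3.intervalIntegrable _ _)
      simp only [mul_div_assoc]
      exact h1.mul_continuousOn h2.continuousOn
    have i2 : ∀ j, IntervalIntegrable (fun ζ => c.s.below (z, ζ) *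
        (sgn j * c.jump i j * x' ζ j)) volume 0 z := fun j =>
      c.s.intervalIntegrable_below_mul (continuous_const.mul (hx' j)) z _ _
    rw [intervalIntegral.integral_finsetSum fun j _ => (i1 j).add (i2 j)]
    refine Finset.sum_congr rfl fun j _ => ?_
    rw [intervalIntegral.integral_add (i1 j) (i2 j), c.s.integral_below_mul _ hz.1,
      intervalIntegral.integral_const_mul, intervalIntegral.integral_const_mul,
      intervalIntegral.integral_eq_sub_of_hasDerivAt (fun ζ _ => hx j ζ)
        ((hx' j).intervalIntegrable _ _)]
  rw [eq_div_iff hvi]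
  simp only [volterra]
  rw [hint, ← c.boundary_terms h0 hz.1 i]
  have hA : Matrix.mulVec (c.A z) (x z) i = ∑ j, c.A z i j * x z j := rfl
  simp only [beamOp]
  rw [hA]
  have key : ∀ j, ((((c.s.L (proc (c.row i).i) z / c.s.L (proc j) z - (c.row i).sign j) *
        ((c.sol i).g (z, z) j * x z j) +
        (c.row i).sign j * ((c.sol i).g (z, 0) j * x 0 j) +
        ∫ ζ in (0 : ℝ)..z, ((c.row i).rhs c.s (c.sol i).g j (z, ζ) * x ζ j / c.s.L (proc j) ζ +
          (c.row i).sign j * ((c.sol i).g (z, ζ) j * x' ζ j))) / c.s.L (proc (c.row i).i) z) +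
        c.jump i j * x (c.s.cut z) j / c.s.L (proc i) z) * c.v i z =
      -(c.A z i j * x z j) + (sgn i * (∫ ζ in (0 : ℝ)..z,
        ((c.row i).rhs c.s (c.sol i).g j (z, ζ) * x ζ j / c.s.L (proc j) ζ +
          (c.row i).sign j * (c.g i (z, ζ) j * x' ζ j))) +
        sgn j * c.jump i j * (x (c.s.cut z) j - x 0 j)) +
        sgn j * ((c.g i (z, 0) j + c.jump i j) * x 0 j) := by
    intro j
    have hLj := c.s.L_ne (proc j) z
    have h1 := c.g_diag (i := i) (j := j) hz
    have h2 := c.sgn_sign i j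
    have h3 := c.jump_mul_sgn i j
    have h4 : (sgn i * c.s.L (proc i) z / c.s.L (proc j) z - sgn j) * c.g i (z, z) j
        = -c.A z i j := by
      simp only [v] at h1
      field_simp
      linear_combination -h1
    change ((((c.s.L (proc i) z / c.s.L (proc j) z - (c.row i).sign j) *
        (c.g i (z, z) j * x z j) +
        (c.row i).sign j * (c.g i (z, 0) j * x 0 j) +
        ∫ ζ in (0 : ℝ)..z, ((c.row i).rhs c.s (c.sol i).g j (z, ζ) * x ζ j / c.s.L (proc j) ζ +
          (c.row i).sign j * (c.g i (z, ζ) j * x' ζ j))) / c.s.L (proc i) z) +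
        c.jump i j * x (c.s.cut z) j / c.s.L (proc i) z) * (sgn i * c.s.L (proc i) z) = _
    generalize (∫ ζ in (0 : ℝ)..z, ((c.row i).rhs c.s (c.sol i).g j (z, ζ) * x ζ j /
      c.s.L (proc j) ζ + (c.row i).sign j * (c.g i (z, ζ) j * x' ζ j))) = I
    have e : ∀ a b d : ℝ, (a / c.s.L (proc i) z + b / c.s.L (proc i) z) *
        (d * c.s.L (proc i) z) = d * a + d * b := by
      intros
      field_simp
    rw [e]
    linear_combination (x z j) * h4 + (c.g i (z, 0) j * x 0 j - c.g i (z, z) j * x z j) * h2 +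
      (x (c.s.cut z) j) * h3
  rw [sub_mul, Finset.sum_mul]
  simp only [key, Finset.sum_add_distrib, Finset.sum_neg_distrib]
  ring

end Coeffs

/-! ### The kernel solves the kernel equations -/

/-- The coefficients `c` agree with the given ones on `[0,1]`. -/
structure Coeffs.Extends (c : Coeffs) (lam : Fin 2 → ℝ → ℝ) (A : ℝ → Matrix Idx Idx ℝ) :
    Prop where
  lam_eq : ∀ k, ∀ z ∈ Icc (0 : ℝ) 1, lam k z = c.s.L k z
  A_eq : ∀ z ∈ Icc (0 : ℝ) 1, A z = c.A z

namespace Coeffs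

variable {c : Coeffs} {lam : Fin 2 → ℝ → ℝ} {A : ℝ → Matrix Idx Idx ℝ}

lemma Extends.phi_eq (h : c.Extends lam A) (k : Fin 2) {z : ℝ} (hz : z ∈ Icc (0 : ℝ) 1) :
    phi lam k z = c.s.Phi k z := by
  refine intervalIntegral.integral_congr fun ζ hζ => ?_
  rw [uIcc_of_le hz.1] at hζ
  simp only [h.lam_eq k ζ ⟨hζ.1, hζ.2.trans hz.2⟩]

lemma Extends.speed_eq (h : c.Extends lam A) (j : Idx) {z : ℝ} (hz : z ∈ Icc (0 : ℝ) 1) :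
    speed lam j z = c.v j z := by
  rcases j with j | j <;> simp [speed, v, h.lam_eq j z hz]

lemma continuous_K_parts (c : Coeffs) (a : ℝ) :
    Continuous fun p : ℝ × ℝ => (fun i j => (c.g i p j + a * c.jump i j) / c.s.L (proc j) p.2 :
      Matrix Idx Idx ℝ) :=
  continuous_matrix fun i j => ((c.continuous_g i j).add continuous_const).div
    ((c.s.cont _).comp continuous_snd) fun _ => c.s.L_ne _ _

lemma Extends.piecewiseContinuous (h : c.Extends lam A) : PiecewiseContinuous lam c.K := by
  refine ⟨_, _, (c.continuous_K_parts 0).continuousOn, (c.continuous_K_parts 1).continuousOn,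
    fun p hp => ⟨fun hle => ?_, fun hlt => ?_⟩⟩
  · rw [h.phi_eq 0 ⟨hp.1.trans hp.2.1, hp.2.2⟩, h.phi_eq 1 ⟨hp.1, hp.2.1.trans hp.2.2⟩] at hle
    funext i j
    simp only [K, Speeds.below]
    rw [if_neg (not_lt.2 hle)]
  · rw [h.phi_eq 0 ⟨hp.1.trans hp.2.1, hp.2.2⟩, h.phi_eq 1 ⟨hp.1, hp.2.1.trans hp.2.2⟩] at hlt
    funext i j
    simp only [K, Speeds.below]
    rw [if_pos hlt]

/-- Along an integral curve of the speed, the travel time grows linearly. -/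
lemma Extends.travel (h : c.Extends lam A) (i : Idx) {Z : ℝ → ℝ} {r : ℝ}
    (hZ : ∀ t ∈ Icc 0 r, HasDerivWithinAt Z (speed lam i (Z t)) (Icc 0 r) t ∧
      Z t ∈ Icc (0 : ℝ) 1) {t : ℝ} (ht : t ∈ Icc 0 r) :
    c.s.Phi (proc i) (Z t) = c.s.Phi (proc i) (Z 0) + sgn i * t := by
  have hd : ∀ t ∈ Icc 0 r, HasDerivWithinAt (fun t => c.s.Phi (proc i) (Z t) - sgn i * t) 0
      (Icc 0 r) t := by
    intro t ht
    obtain ⟨h1, h2⟩ := hZ t ht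
    rw [h.speed_eq i h2] at h1
    have h3 := (c.s.hasDerivAt_Phi (proc i) (Z t)).comp_hasDerivWithinAt t h1
    have h4 := h3.sub ((hasDerivAt_id t).const_mul (sgn i)).hasDerivWithinAt
    have h5 := c.s.L_ne (proc i) (Z t)
    refine h4.congr_deriv ?_
    rw [v]
    field_simp
    ring
  have h6 := constant_of_has_deriv_right_zero (a := 0) (b := r)
    (fun t ht => (hd t ht).continuousWithinAt)
    (fun t ht => (hd t (Ico_subset_Icc_self ht)).mono_of_mem_nhdsWithin
      (Icc_mem_nhdsGE_of_mem ht)) t ht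
  simp only [mul_zero, sub_zero] at h6
  linarith

/-- Any pair of integral curves of the speeds is one of the characteristics `Speeds.char`. The jump
contributes no increment: the characteristic of an entry that jumps cannot cross the curve
`φ₁(z) = φ₂(ζ)`, being parallel to it in travel time coordinates. -/
lemma Extends.kernel_pde (h : c.Extends lam A) (i j : Idx) {Z W : ℝ → ℝ} {r : ℝ} (hr : 0 ≤ r)
    (hZW : ∀ t ∈ Icc 0 r, HasDerivWithinAt Z (speed lam i (Z t)) (Icc 0 r) t ∧
      HasDerivWithinAt W (speed lam j (W t)) (Icc 0 r) t ∧ (Z t, W t) ∈ triangle) :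
    c.K (Z r) (W r) i j * speed lam j (W r) - c.K (Z 0) (W 0) i j * speed lam j (W 0) =
      ∫ t in (0 : ℝ)..r, speed lam j (W t) * (c.K (Z t) (W t) * A (W t)) i j := by
  have hZ1 : ∀ t ∈ Icc 0 r, Z t ∈ Icc (0 : ℝ) 1 := fun t ht =>
    ⟨(hZW t ht).2.2.1.trans (hZW t ht).2.2.2.1, (hZW t ht).2.2.2.2⟩
  have hW1 : ∀ t ∈ Icc 0 r, W t ∈ Icc (0 : ℝ) 1 := fun t ht =>
    ⟨(hZW t ht).2.2.1, (hZW t ht).2.2.2.1.trans (hZW t ht).2.2.2.2⟩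
  have hr' : r ∈ Icc 0 r := ⟨hr, le_rfl⟩
  have h0' : (0 : ℝ) ∈ Icc 0 r := ⟨le_rfl, hr⟩
  have eZ := fun t ht => h.travel i (Z := Z) (fun t ht => ⟨(hZW t ht).1, hZ1 t ht⟩) (t := t) ht
  have eW := fun t ht => h.travel j (Z := W) (fun t ht => ⟨(hZW t ht).2.1, hW1 t ht⟩) (t := t) ht
  set u := c.s.label (proc i) (proc j) ((c.row i).sign j) (Z 0, W 0) with hu
  have hsg := c.sgn_sign i j
  have hchar : ∀ t ∈ Icc 0 r, c.s.char (proc i) (proc j) ((c.row i).sign j) u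
      (c.s.Phi (proc i) (Z 0) + sgn i * t) = (Z t, W t) := by
    intro t ht
    have e1 : u + (c.row i).sign j * (c.s.Phi (proc i) (Z 0) + sgn i * t) =
        c.s.Phi (proc j) (W t) := by
      rw [eW t ht, hu, Speeds.label]
      linear_combination t * hsg
    simp only [Speeds.char]
    rw [e1, ← eZ t ht, c.s.Psi_Phi, c.s.Psi_Phi]
  have hg := (c.sol i).char_sub j u (c.s.Phi (proc i) (Z 0) + sgn i * 0)
    (c.s.Phi (proc i) (Z 0) + sgn i * r)
  rw [← intervalIntegral.mul_integral_comp_add_mul] at hg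
  change (c.sol i).g (c.s.char (proc i) (proc j) ((c.row i).sign j) u _) j -
    (c.sol i).g (c.s.char (proc i) (proc j) ((c.row i).sign j) u _) j = sgn i * ∫ t in (0 : ℝ)..r,
    (c.row i).rhs c.s (c.sol i).g j (c.s.char (proc i) (proc j) ((c.row i).sign j) u
      (c.s.Phi (proc i) (Z 0) + sgn i * t)) at hg
  rw [hchar r hr', hchar 0 h0', ← intervalIntegral.integral_const_mul] at hg
  have e2 : ∫ t in (0 : ℝ)..r, speed lam j (W t) * (c.K (Z t) (W t) * A (W t)) i j =
      sgn j * ∫ t in (0 : ℝ)..r, sgn i * (c.row i).rhs c.s (c.sol i).g j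
        (c.s.char (proc i) (proc j) ((c.row i).sign j) u
          (c.s.Phi (proc i) (Z 0) + sgn i * t)) := by
    rw [← intervalIntegral.integral_const_mul]
    refine intervalIntegral.integral_congr fun t ht => ?_
    rw [uIcc_of_le hr] at ht
    rw [hchar t ht, c.rhs_eq (hZW t ht).2.2, h.speed_eq j (hW1 t ht), h.A_eq _ (hW1 t ht), v]
    ring
  rw [e2, ← hg, h.speed_eq j (hW1 r hr'), h.speed_eq j (hW1 0 h0')]
  -- both end points lie on the same side of the curve if the entry jumps
  have e3 : c.s.below (Z r, W r) * c.jump i j = c.s.below (Z 0, W 0) * c.jump i j := by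
    by_cases hj : proc j = 0
    · rw [c.jump_of_fast i hj]; simp
    by_cases hi : proc i = 1
    · rw [c.jump_of_slow hi]; simp
    have hj1 : proc j = 1 := by omega
    have hi0 : proc i = 0 := by omega
    by_cases hs : sgn i = sgn j
    · have e4 := eZ r hr'
      have e5 := eW r hr'
      rw [hi0] at e4
      rw [hj1, ← hs] at e5
      congr 1
      simp only [Speeds.below, e4, e5]
      congr 1
      simp
    · have := c.jump_mul_sgn i j
      have : c.jump i j = 0 := by
        have h3 : (sgn i - sgn j) * c.jump i j = 0 := by linarith
        rcases mul_eq_zero.1 h3 with h4 | h4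
        · exact absurd (sub_eq_zero.1 h4) hs
        · exact h4
      rw [this]; simp
  have l1 := c.s.L_ne (proc j) (W r)
  have l0 := c.s.L_ne (proc j) (W 0)
  simp only [K, v]
  rw [e3]
  field_simp
  simp only [g]
  ring

lemma K_zero_mul (c : Coeffs) (i : Idx) (k : Fin 2) {z : ℝ} (hz : 0 < z) :
    (c.K z 0 i (Sum.inl k) + c.K z 0 i (Sum.inr k)) * c.s.L k 0 =
      if k = 0 then c.alpha i z else 0 := by
  have hb : c.s.below (z, 0) = 1 := by
    rw [Speeds.below, if_pos]
    simpa using (c.s.Phi_strictMono 0) hz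
  have hL := c.s.L_ne k 0
  have e : (c.K z 0 i (Sum.inl k) + c.K z 0 i (Sum.inr k)) * c.s.L k 0 =
      c.g i (z, 0) (Sum.inl k) + c.jump i (Sum.inl k) +
        (c.g i (z, 0) (Sum.inr k) + c.jump i (Sum.inr k)) := by
    simp only [K, hb, proc_inl, proc_inr]
    field_simp
  rw [e]
  obtain rfl | rfl : k = 0 ∨ k = 1 := by omega
  · rw [if_pos rfl, c.jump_of_fast i rfl, c.jump_of_fast i rfl, alpha]
    ring
  · rw [if_neg (by decide)]
    exact c.g_zero_inl_slow z hz.le i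

theorem Extends.isKernel (h : c.Extends lam A) :
    IsKernel lam A (c.alpha (Sum.inl 1)) (fun z => -c.alpha (Sum.inr 1) z) c.K where
  piecewise := h.piecewiseContinuous
  pde i j Z W r hr hZW := h.kernel_pde i j hr hZW
  bc_zero_minus z hz := by
    have h0 := fun k => h.lam_eq k 0 (by simp)
    ext a b
    have := c.K_zero_mul (Sum.inl a) b hz.1
    have h1 := c.alpha_fast (i := Sum.inl 0) rfl hz.1.le
    rw [Lam, Matrix.mul_diagonal, h0]
    simp only [Matrix.add_apply, Matrix.toBlocks₁₁, Matrix.toBlocks₁₂, Matrix.of_apply]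
    rw [this]
    fin_cases a <;> fin_cases b <;> simp [Azero, h1]
  bc_zero_plus z hz := by
    have h0 := fun k => h.lam_eq k 0 (by simp)
    ext a b
    have := c.K_zero_mul (Sum.inr a) b hz.1
    have h1 := c.alpha_fast (i := Sum.inr 0) rfl hz.1.le
    rw [Matrix.neg_apply, Lam, Matrix.mul_diagonal, h0]
    simp only [Matrix.add_apply, Matrix.toBlocks₂₁, Matrix.toBlocks₂₂, Matrix.of_apply]
    rw [this]
    fin_cases a <;> fin_cases b <;> simp [Azero, h1]
  bc_diag z hz := by
    have hb : c.s.below (z, z) = 0 := by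
      rw [Speeds.below, if_neg]
      simpa using c.s.Phi_le_Phi hz.1
    ext i j
    have h1 := c.g_diag (i := i) (j := j) hz
    have hL := c.s.L_ne (proc j) z
    rw [Matrix.sub_apply, LamT, Matrix.mul_diagonal, Matrix.diagonal_mul, h.speed_eq i hz,
      h.speed_eq j hz, h.A_eq z hz]
    simp only [K, hb, zero_mul, add_zero]
    field_simp
    linear_combination h1

end Coeffs

/-! ### Volterra operators with piecewise continuous kernels -/

/-- A bounded kernel that is the sum of a continuous kernel `U` and of a continuous kernel `D`
restricted to the part of the triangle below the curve `φ₁(z) = φ₂(ζ)`. -/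
structure PCKernel (s : Speeds) where
  U : ℝ × ℝ → Matrix Idx Idx ℝ
  D : ℝ × ℝ → Matrix Idx Idx ℝ
  bound : ℝ
  contU : Continuous U
  contD : Continuous D
  boundU : ∀ p i j, |U p i j| ≤ bound
  boundD : ∀ p i j, |D p i j| ≤ bound

namespace PCKernel

variable {s : Speeds} (κ : PCKernel s)

/-- The kernel itself. -/
def ker (z ζ : ℝ) : Matrix Idx Idx ℝ := κ.U (z, ζ) + s.below (z, ζ) • κ.D (z, ζ)

lemma ker_apply (z ζ : ℝ) (i j : Idx) :
    κ.ker z ζ i j = κ.U (z, ζ) i j + s.below (z, ζ) * κ.D (z, ζ) i j := rfl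

lemma bound_nonneg : 0 ≤ κ.bound := (abs_nonneg _).trans (κ.boundU 0 (Sum.inl 0) (Sum.inl 0))

lemma abs_ker_le (z ζ : ℝ) (i j : Idx) : |κ.ker z ζ i j| ≤ 2 * κ.bound := by
  rw [ker_apply]
  refine (abs_add_le _ _).trans ?_
  rw [abs_mul]
  have h1 := κ.boundU (z, ζ) i j
  have h2 := κ.boundD (z, ζ) i j
  have h3 := mul_le_mul (s.abs_below_le (z, ζ)) h2 (abs_nonneg _) zero_le_one
  linarith

lemma measurable_ker (i j : Idx) : Measurable fun p : ℝ × ℝ => κ.ker p.1 p.2 i j :=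
  (κ.contU.matrix_elem i j).measurable.add
    (s.measurable_below.mul (κ.contD.matrix_elem i j).measurable)

lemma continuousAt_ker (i j : Idx) {p : ℝ × ℝ} (h : s.Phi 1 p.2 ≠ s.Phi 0 p.1) :
    ContinuousAt (fun p : ℝ × ℝ => κ.ker p.1 p.2 i j) p :=
  (κ.contU.matrix_elem i j).continuousAt.add
    ((s.continuousAt_below h).mul (κ.contD.matrix_elem i j).continuousAt)

/-- The Volterra integral, written with continuous integrands. -/
def vint (f : ℝ → Idx → ℝ) (z : ℝ) (i : Idx) : ℝ :=
  (∫ ζ in (0 : ℝ)..z, ∑ j, κ.U (z, ζ) i j * f ζ j) +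
    ∫ ζ in (0 : ℝ)..(s.cut z), ∑ j, κ.D (z, ζ) i j * f ζ j

/-- Continuity jointly in `z` and in a parameter of the function. -/
lemma continuous_vint {X : Type*} [TopologicalSpace X] {f : X → ℝ → Idx → ℝ}
    (hf : ∀ j, Continuous fun p : X × ℝ => f p.1 p.2 j) (i : Idx) :
    Continuous fun p : X × ℝ => κ.vint (f p.1) p.2 i := by
  have hc := s.continuous_cut
  have h1 : Continuous fun q : (X × ℝ) × ℝ => ∑ j, κ.U (q.1.2, q.2) i j * f q.1.1 q.2 j :=
    continuous_finsetSum _ fun j _ => ((κ.contU.matrix_elem i j).comp (by fun_prop)).mul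
      ((hf j).comp (g := fun p : X × ℝ => f p.1 p.2 j)
        (f := fun q : (X × ℝ) × ℝ => (q.1.1, q.2)) (by fun_prop))
  have h2 : Continuous fun q : (X × ℝ) × ℝ => ∑ j, κ.D (q.1.2, q.2) i j * f q.1.1 q.2 j :=
    continuous_finsetSum _ fun j _ => ((κ.contD.matrix_elem i j).comp (by fun_prop)).mul
      ((hf j).comp (g := fun p : X × ℝ => f p.1 p.2 j)
        (f := fun q : (X × ℝ) × ℝ => (q.1.1, q.2)) (by fun_prop))
  exact (intervalIntegral.continuous_parametric_intervalIntegral_of_continuous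
      (f := fun (p : X × ℝ) ζ => ∑ j, κ.U (p.2, ζ) i j * f p.1 ζ j) h1 continuous_snd).add
    (intervalIntegral.continuous_parametric_intervalIntegral_of_continuous
      (f := fun (p : X × ℝ) ζ => ∑ j, κ.D (p.2, ζ) i j * f p.1 ζ j) h2 (hc.comp continuous_snd))

lemma integral_ker_mulVec {f : ℝ → Idx → ℝ} (hf : ∀ j, Continuous fun z => f z j) {z : ℝ}
    (hz : 0 ≤ z) (i : Idx) :
    ∫ ζ in (0 : ℝ)..z, Matrix.mulVec (κ.ker z ζ) (f ζ) i = κ.vint f z i := by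
  have h1 : Continuous fun ζ => ∑ j, κ.U (z, ζ) i j * f ζ j :=
    continuous_finsetSum _ fun j _ => ((κ.contU.matrix_elem i j).comp (by fun_prop)).mul (hf j)
  have h2 : Continuous fun ζ => ∑ j, κ.D (z, ζ) i j * f ζ j :=
    continuous_finsetSum _ fun j _ => ((κ.contD.matrix_elem i j).comp (by fun_prop)).mul (hf j)
  have e : ∀ ζ, Matrix.mulVec (κ.ker z ζ) (f ζ) i =
      (∑ j, κ.U (z, ζ) i j * f ζ j) + s.below (z, ζ) * ∑ j, κ.D (z, ζ) i j * f ζ j := by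
    intro ζ
    simp only [Matrix.mulVec, dotProduct, ker_apply, Finset.mul_sum, ← Finset.sum_add_distrib]
    exact Finset.sum_congr rfl fun j _ => by ring
  simp only [e]
  rw [intervalIntegral.integral_add (h1.intervalIntegrable _ _)
    (s.intervalIntegrable_below_mul h2 z _ _), s.integral_below_mul _ hz, vint]

lemma abs_ker_mulVec_le (z ζ : ℝ) {y : Idx → ℝ} {D : ℝ} (hy : ∀ j, |y j| ≤ D) (i : Idx) :
    |Matrix.mulVec (κ.ker z ζ) y i| ≤ 8 * κ.bound * D := by
  have hb := κ.bound_nonneg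
  change |∑ j, κ.ker z ζ i j * y j| ≤ _
  refine (Finset.abs_sum_le_sum_abs _ _).trans ?_
  have hj : ∀ j, |κ.ker z ζ i j * y j| ≤ 2 * κ.bound * D := by
    intro j
    rw [abs_mul]
    exact mul_le_mul (κ.abs_ker_le _ _ _ _) (hy j) (abs_nonneg _) (by positivity)
  refine (Finset.sum_le_sum fun j _ => hj j).trans (le_of_eq ?_)
  · simp only [Finset.sum_const, Finset.card_univ, Fintype.card_sum, Fintype.card_fin,
      nsmul_eq_mul]
    push_cast
    ring

lemma abs_exp_le {γ D : ℝ} {a : ℝ} {b θ : ℝ} (hθ : θ ∈ uIcc a b) (hab : a ≤ b) {y : ℝ}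
    (hy : |y| ≤ D * Real.exp (γ * θ)) :
    |y| ≤ D * Real.exp (γ * b) * Real.exp (-(γ * |b - θ|)) := by
  rw [uIcc_of_le hab] at hθ
  rw [mul_assoc, ← Real.exp_add, abs_of_nonneg (show 0 ≤ b - θ by linarith [hθ.2])]
  convert hy using 3
  ring

/-- The Volterra equation of the second kind `x = φ + ∫₀ᶻ K x` has exactly one continuous
solution. -/
lemma exists_solution {φ : ℝ → Idx → ℝ} (hφ : ContinuousOn φ (Icc 0 1)) :
    ∃ x : ℝ → Idx → ℝ, ContinuousOn x (Icc 0 1) ∧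
      (∀ z ∈ Icc (0 : ℝ) 1, ∀ i, x z i = φ z i +
        ∫ ζ in (0 : ℝ)..z, Matrix.mulVec (κ.ker z ζ) (x ζ) i) ∧
      ∀ y : ℝ → Idx → ℝ, ContinuousOn y (Icc 0 1) →
        (∀ z ∈ Icc (0 : ℝ) 1, ∀ i, y z i = φ z i +
          ∫ ζ in (0 : ℝ)..z, Matrix.mulVec (κ.ker z ζ) (y ζ) i) → EqOn y x (Icc 0 1) := by
  have hcl : ∀ {f : ℝ → Idx → ℝ}, ContinuousOn f (Icc 0 1) → ∀ j, Continuous fun z => f (clamp z) j :=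
    fun hf j => (continuous_apply j).comp (hf.comp_continuous continuous_clamp clamp_mem)
  have hcongr : ∀ (f : ℝ → Idx → ℝ), ∀ z ∈ Icc (0 : ℝ) 1, ∀ i,
      ∫ ζ in (0 : ℝ)..z, Matrix.mulVec (κ.ker z ζ) (f (clamp ζ)) i =
      ∫ ζ in (0 : ℝ)..z, Matrix.mulVec (κ.ker z ζ) (f ζ) i := by
    intro f z hz i
    refine intervalIntegral.integral_congr fun ζ hζ => ?_
    rw [uIcc_of_le hz.1] at hζ
    rw [clamp_of_mem ⟨hζ.1, hζ.2.trans hz.2⟩]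
  obtain ⟨x, hx, hfix, huniq⟩ := exists_fixedPoint_of_volterra (T := Icc (0 : ℝ) 1) isCompact_Icc
    (m := id) continuousOn_id
    (fun f z i => φ z i + ∫ ζ in (0 : ℝ)..z, Matrix.mulVec (κ.ker z ζ) (f (clamp ζ)) i)
    (fun f hf => continuousOn_pi.2 fun i => by
      refine (((continuous_apply i).comp_continuousOn hφ).add
        ((κ.continuous_vint (X := Unit) (f := fun _ ζ => f (clamp ζ))
          (fun j => (hcl hf j).comp continuous_snd) i).comp
          (f := fun z : ℝ => ((), z)) (by fun_prop)).continuousOn).congr fun z hz => ?_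
      rw [κ.integral_ker_mulVec (hcl hf) hz.1]
      rfl)
    (C := 8 * κ.bound) (fun γ hγ D hD f g hf hg h z hz i => by
      have hi : ∀ {f : ℝ → Idx → ℝ}, ContinuousOn f (Icc 0 1) → IntervalIntegrable
          (fun ζ => Matrix.mulVec (κ.ker z ζ) (f (clamp ζ)) i) volume 0 z := by
        intro f hf
        have e : (fun ζ => Matrix.mulVec (κ.ker z ζ) (f (clamp ζ)) i) =
            ∑ j, fun ζ => κ.ker z ζ i j * f (clamp ζ) j := by
          funext ζ
          simp [Matrix.mulVec, dotProduct, Finset.sum_apply]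
        rw [e]
        refine IntervalIntegrable.sum _ fun j _ => ?_
        have h1 : IntervalIntegrable (fun ζ => κ.ker z ζ i j) volume 0 z :=
          (intervalIntegrable_const (c := 2 * κ.bound)).mono_fun'
            ((κ.measurable_ker i j).comp measurable_prodMk_left).aestronglyMeasurable
            (Eventually.of_forall fun ζ => κ.abs_ker_le z ζ i j)
        exact h1.mul_continuousOn (hcl hf j).continuousOn
      simp only [id]
      rw [add_sub_add_left_eq_sub, ← intervalIntegral.integral_sub (hi hf) (hi hg)]
      have hb := κ.bound_nonneg
      refine (abs_integral_exp_le (c := γ) (D := 8 * κ.bound * D * Real.exp (γ * z)) hγ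
        (by positivity) fun ζ hζ => abs_exp_le hζ hz.1 ?_).trans (le_of_eq (by ring))
      rw [← Pi.sub_apply, ← Matrix.mulVec_sub, mul_assoc (8 * κ.bound)]
      rw [uIcc_of_le hz.1] at hζ
      have hζ1 : ζ ∈ Icc (0 : ℝ) 1 := ⟨hζ.1, hζ.2.trans hz.2⟩
      refine κ.abs_ker_mulVec_le z ζ (fun j => ?_) i
      rw [clamp_of_mem hζ1]
      exact h ζ hζ1 j)
  refine ⟨x, hx, fun z hz i => ?_, fun y hy hy2 => huniq y hy fun z hz => ?_⟩
  · rw [← hcongr x z hz i]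
    exact (congrFun (hfix z hz) i).symm
  · funext i
    rw [hcongr y z hz i, ← hy2 z hz i]

end PCKernel

namespace PCKernel

variable {s : Speeds}

/-! ### The resolvent kernel -/

/-- Kernels that are only given on the triangle are extended by the retraction onto it. -/
lemma exists_of_continuousOn (s : Speeds) {U D : ℝ × ℝ → Matrix Idx Idx ℝ}
    (hU : ContinuousOn U triangle) (hD : ContinuousOn D triangle) :
    ∃ κ : PCKernel s, (∀ p ∈ triangle, κ.U p = U p) ∧ ∀ p ∈ triangle, κ.D p = D p := by
  have key : ∀ {M : ℝ × ℝ → Matrix Idx Idx ℝ}, ContinuousOn M triangle →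
      ∃ B, ∀ p i j, |M (retract p) i j| ≤ B := by
    intro M hM
    have h1 : ∀ ij : Idx × Idx, ∃ B, ∀ p ∈ triangle, |M p ij.1 ij.2| ≤ B := fun ij =>
      isCompact_triangle.exists_bound_of_continuousOn (f := fun p => M p ij.1 ij.2)
        ((continuous_id.matrix_elem ij.1 ij.2).comp_continuousOn hM)
    choose B hB using h1
    refine ⟨∑ ij, |B ij|, fun p i j => ?_⟩
    exact ((hB (i, j) _ (retract_mem p)).trans (le_abs_self _)).trans
      (Finset.single_le_sum (f := fun ij => |B ij|) (fun _ _ => abs_nonneg _)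
        (Finset.mem_univ (i, j)))
  obtain ⟨B₁, h₁⟩ := key hU
  obtain ⟨B₂, h₂⟩ := key hD
  refine ⟨⟨fun p => U (retract p), fun p => D (retract p), max B₁ B₂,
    hU.comp_continuous continuous_retract retract_mem,
    hD.comp_continuous continuous_retract retract_mem,
    fun p i j => (h₁ p i j).trans (le_max_left _ _),
    fun p i j => (h₂ p i j).trans (le_max_right _ _)⟩, fun p hp => ?_, fun p hp => ?_⟩
  · simp only [retract_of_mem hp]
  · simp only [retract_of_mem hp]

variable (κ : PCKernel s)

lemma measurable_ker_comp (i j : Idx) {a b : ℝ → ℝ} (ha : Measurable a) (hb : Measurable b) :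
    Measurable fun σ => κ.ker (a σ) (b σ) i j :=
  (κ.measurable_ker i j).comp (ha.prodMk hb)

/-- The resolvent kernel: the kernel plus a continuous function. -/
lemma exists_resolvent : ∃ κI : PCKernel s, ∀ z ζ, (z, ζ) ∈ triangle → ∀ i j,
    κI.ker z ζ i j = κ.ker z ζ i j + ∫ σ in ζ..z, (κ.ker z σ * κI.ker σ ζ) i j := by
  have hB := κ.bound_nonneg
  have hcl : ∀ {f : ℝ × ℝ → Idx × Idx → ℝ}, ContinuousOn f triangle →
      ∀ ij, Continuous fun p => f (retract p) ij := fun hf ij =>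
    (continuous_apply ij).comp (hf.comp_continuous continuous_retract retract_mem)
  have hmeas : ∀ {f : ℝ × ℝ → Idx × Idx → ℝ}, ContinuousOn f triangle →
      ∀ (p : ℝ × ℝ) (i j : Idx), Measurable fun σ => ∑ l, κ.ker p.1 σ i l *
        (κ.ker σ p.2 l j + f (retract (σ, p.2)) (l, j)) := fun hf p i j =>
    Finset.measurable_sum _ fun l _ =>
      (κ.measurable_ker_comp i l measurable_const measurable_id).mul
        ((κ.measurable_ker_comp l j measurable_id measurable_const).add
          ((hcl hf (l, j)).comp (by fun_prop : Continuous fun σ : ℝ => (σ, p.2))).measurable)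
  have hbd : ∀ {f : ℝ × ℝ → Idx × Idx → ℝ}, ContinuousOn f triangle →
      ∃ C, ∀ (p : ℝ × ℝ) (σ : ℝ) (i j : Idx), |∑ l, κ.ker p.1 σ i l *
        (κ.ker σ p.2 l j + f (retract (σ, p.2)) (l, j))| ≤ C := by
    intro f hf
    obtain ⟨F, hF⟩ := isCompact_triangle.exists_bound_of_continuousOn hf
    refine ⟨∑ _l : Idx, 2 * κ.bound * (2 * κ.bound + F), fun p σ i j => ?_⟩
    refine (Finset.abs_sum_le_sum_abs _ _).trans (Finset.sum_le_sum fun l _ => ?_)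
    rw [abs_mul]
    exact mul_le_mul (κ.abs_ker_le _ _ _ _) ((abs_add_le _ _).trans (add_le_add
      (κ.abs_ker_le _ _ _ _) ((norm_le_pi_norm _ _).trans (hF _ (retract_mem _)))))
      (abs_nonneg _) (by positivity)
  have hint : ∀ {f : ℝ × ℝ → Idx × Idx → ℝ}, ContinuousOn f triangle →
      ∀ (p : ℝ × ℝ) (i j : Idx) (a b : ℝ), IntervalIntegrable (fun σ => ∑ l, κ.ker p.1 σ i l *
        (κ.ker σ p.2 l j + f (retract (σ, p.2)) (l, j))) volume a b := by
    intro f hf p i j a b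
    obtain ⟨C, hC⟩ := hbd hf
    exact (intervalIntegrable_const (c := C)).mono_fun' (hmeas hf p i j).aestronglyMeasurable
      (Eventually.of_forall fun σ => hC p σ i j)
  -- the unknown is the continuous difference `f` of the resolvent kernel and the kernel
  obtain ⟨f, hf, hfix, -⟩ := exists_fixedPoint_of_volterra (ι := Idx × Idx) isCompact_triangle
    (m := fun p => p.1) continuous_fst.continuousOn
    (fun f p ij => ∫ σ in p.2..p.1, ∑ l, κ.ker p.1 σ ij.1 l *
        (κ.ker σ p.2 l ij.2 + f (retract (σ, p.2)) (l, ij.2)))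
    (fun f hf => by
      refine (continuous_pi fun ij => continuous_iff_continuousAt.2 fun p => ?_).continuousOn
      obtain ⟨C, hC⟩ := hbd hf
      refine continuousAt_integral_moving (bound := fun _ => C)
        (fun p => (hmeas hf p ij.1 ij.2).aestronglyMeasurable)
        (Eventually.of_forall fun p σ => hC p σ ij.1 ij.2) (fun _ _ => intervalIntegrable_const)
        ?_ continuousAt_snd continuousAt_fst
      have n1 : {σ | s.Phi 1 σ = s.Phi 0 p.1}.Subsingleton := fun a ha b hb =>
        (s.Phi_strictMono 1).injective (Eq.trans ha (Eq.symm hb))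
      have n2 : {σ | s.Phi 1 p.2 = s.Phi 0 σ}.Subsingleton := fun a ha b hb =>
        (s.Phi_strictMono 0).injective (Eq.trans (Eq.symm ha) hb)
      filter_upwards [compl_mem_ae_iff.2 (n1.measure_zero volume),
        compl_mem_ae_iff.2 (n2.measure_zero volume)] with σ h1 h2
      have c1 : ∀ l, ContinuousAt (fun p : ℝ × ℝ => κ.ker p.1 σ ij.1 l) p := fun l =>
        ContinuousAt.comp (f := fun p : ℝ × ℝ => (p.1, σ)) (κ.continuousAt_ker ij.1 l h1)
          (by fun_prop)
      have c2 : ∀ l, ContinuousAt (fun p : ℝ × ℝ => κ.ker σ p.2 l ij.2) p := fun l =>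
        ContinuousAt.comp (f := fun p : ℝ × ℝ => (σ, p.2)) (κ.continuousAt_ker l ij.2 h2)
          (by fun_prop)
      have c3 : ∀ l, Continuous fun p : ℝ × ℝ => f (retract (σ, p.2)) (l, ij.2) := fun l =>
        (hcl hf (l, ij.2)).comp (by fun_prop : Continuous fun p : ℝ × ℝ => (σ, p.2))
      exact tendsto_finsetSum _ fun l _ => (c1 l).mul ((c2 l).add (c3 l).continuousAt))
    (C := 8 * κ.bound) (fun γ hγ D hD f g hf hg h p hp ij => by
      rw [← intervalIntegral.integral_sub (hint hf p ij.1 ij.2 _ _) (hint hg p ij.1 ij.2 _ _)]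
      refine (abs_integral_exp_le (c := γ) (D := 8 * κ.bound * D * Real.exp (γ * p.1)) hγ
        (by positivity) fun σ hσ => abs_exp_le hσ hp.2.1 ?_).trans (le_of_eq (by ring))
      rw [uIcc_of_le hp.2.1] at hσ
      have hm : (σ, p.2) ∈ triangle := ⟨hp.1, hσ.1, hσ.2.trans hp.2.2⟩
      rw [← Finset.sum_sub_distrib]
      have e : ∀ l, |κ.ker p.1 σ ij.1 l * (κ.ker σ p.2 l ij.2 + f (retract (σ, p.2)) (l, ij.2)) -
          κ.ker p.1 σ ij.1 l * (κ.ker σ p.2 l ij.2 + g (retract (σ, p.2)) (l, ij.2))| ≤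
          2 * κ.bound * (D * Real.exp (γ * σ)) := by
        intro l
        rw [← mul_sub, add_sub_add_left_eq_sub, abs_mul, retract_of_mem hm]
        exact mul_le_mul (κ.abs_ker_le _ _ _ _) (h _ hm _) (abs_nonneg _) (by positivity)
      refine (Finset.abs_sum_le_sum_abs _ _).trans ((Finset.sum_le_sum fun l _ => e l).trans
        (le_of_eq ?_))
      simp only [Finset.sum_const, Finset.card_univ, Fintype.card_sum, Fintype.card_fin,
        nsmul_eq_mul]
      push_cast
      ring)
  have hM : ContinuousOn (fun p => (fun i j => f p (i, j) : Matrix Idx Idx ℝ)) triangle :=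
    continuousOn_pi.2 fun i => continuousOn_pi.2 fun j =>
      (continuous_apply (i, j)).comp_continuousOn hf
  obtain ⟨κI, hU, hD⟩ := exists_of_continuousOn s (κ.contU.continuousOn.add hM)
    κ.contD.continuousOn
  have hker : ∀ z ζ, (z, ζ) ∈ triangle → ∀ i j, κI.ker z ζ i j = κ.ker z ζ i j + f (z, ζ) (i, j) := by
    intro z ζ h i j
    rw [ker_apply, ker_apply, hU _ h, hD _ h]
    change κ.U (z, ζ) i j + f (z, ζ) (i, j) + _ = _
    ring
  refine ⟨κI, fun z ζ h i j => ?_⟩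
  rw [hker z ζ h, ← hfix _ h]
  congr 1
  refine intervalIntegral.integral_congr fun σ hσ => ?_
  rw [uIcc_of_le h.2.1] at hσ
  have hm : (σ, ζ) ∈ triangle := ⟨h.1, hσ.1, hσ.2.trans h.2.2⟩
  simp only
  rw [retract_of_mem hm, Matrix.mul_apply]
  simp only [hker σ ζ hm]

/-! ### The inverse of the Volterra transformation -/

lemma intervalIntegrable_ker_mulVec {f : ℝ → Idx → ℝ} (hf : ∀ j, Continuous fun z => f z j)
    (z a b : ℝ) (i : Idx) :
    IntervalIntegrable (fun ζ => Matrix.mulVec (κ.ker z ζ) (f ζ) i) volume a b := by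
  have e : (fun ζ => Matrix.mulVec (κ.ker z ζ) (f ζ) i) =
      ∑ j, fun ζ => κ.ker z ζ i j * f ζ j := by
    funext ζ
    simp [Matrix.mulVec, dotProduct, Finset.sum_apply]
  rw [e]
  refine IntervalIntegrable.sum _ fun j _ => ?_
  have h1 : IntervalIntegrable (fun ζ => κ.ker z ζ i j) volume a b :=
    (intervalIntegrable_const (c := 2 * κ.bound)).mono_fun'
      (κ.measurable_ker_comp i j measurable_const measurable_id).aestronglyMeasurable
      (Eventually.of_forall fun ζ => κ.abs_ker_le z ζ i j)
  exact h1.mul_continuousOn (hf j).continuousOn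

lemma integral_congr_clamp {K : ℝ → ℝ → Matrix Idx Idx ℝ} {f g : ℝ → Idx → ℝ}
    (h : EqOn f g (Icc 0 1)) {z : ℝ} (hz : z ∈ Icc (0 : ℝ) 1) (i : Idx) :
    ∫ ζ in (0 : ℝ)..z, Matrix.mulVec (K z ζ) (f ζ) i =
      ∫ ζ in (0 : ℝ)..z, Matrix.mulVec (K z ζ) (g ζ) i := by
  refine intervalIntegral.integral_congr fun ζ hζ => ?_
  rw [uIcc_of_le hz.1] at hζ
  rw [h ⟨hζ.1, hζ.2.trans hz.2⟩]

lemma volterra_congr {K : ℝ → ℝ → Matrix Idx Idx ℝ} {f g : ℝ → Idx → ℝ}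
    (h : EqOn f g (Icc 0 1)) : EqOn (volterra K f) (volterra K g) (Icc 0 1) := fun z hz => by
  funext i
  simp only [volterra]
  rw [h hz, integral_congr_clamp h hz]

lemma volterraInv_congr {K : ℝ → ℝ → Matrix Idx Idx ℝ} {f g : ℝ → Idx → ℝ}
    (h : EqOn f g (Icc 0 1)) : EqOn (volterraInv K f) (volterraInv K g) (Icc 0 1) := fun z hz => by
  funext i
  simp only [volterraInv]
  rw [h hz, integral_congr_clamp h hz]

lemma eqOn_clamp (f : ℝ → Idx → ℝ) : EqOn f (fun z => f (clamp z)) (Icc 0 1) := fun z hz => by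
  simp only [clamp_of_mem hz]

lemma continuous_clamp_apply {f : ℝ → Idx → ℝ} (hf : ContinuousOn f (Icc 0 1)) (j : Idx) :
    Continuous fun z => f (clamp z) j :=
  (continuous_apply j).comp (hf.comp_continuous continuous_clamp clamp_mem)

lemma continuous_vint_apply {f : ℝ → Idx → ℝ} (hf : ∀ j, Continuous fun z => f z j) (i : Idx) :
    Continuous fun z => κ.vint f z i :=
  (κ.continuous_vint (X := Unit) (f := fun _ => f) (fun j => (hf j).comp continuous_snd) i).comp
    (f := fun z : ℝ => ((), z)) (by fun_prop)

lemma continuousOn_volterraInv {f : ℝ → Idx → ℝ} (hf : ContinuousOn f (Icc 0 1)) :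
    ContinuousOn (volterraInv κ.ker f) (Icc 0 1) := by
  have h := continuous_clamp_apply hf
  refine ContinuousOn.congr ?_ (volterraInv_congr (eqOn_clamp f))
  refine continuousOn_pi.2 fun i => ((h i).add (κ.continuous_vint_apply h i)).continuousOn.congr
    fun z hz => ?_
  simp only [volterraInv]
  rw [κ.integral_ker_mulVec h hz.1]
  rfl

lemma continuousOn_volterra {f : ℝ → Idx → ℝ} (hf : ContinuousOn f (Icc 0 1)) :
    ContinuousOn (volterra κ.ker f) (Icc 0 1) := by
  have h := continuous_clamp_apply hf
  refine ContinuousOn.congr ?_ (volterra_congr (eqOn_clamp f))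
  refine continuousOn_pi.2 fun i => ((h i).sub (κ.continuous_vint_apply h i)).continuousOn.congr
    fun z hz => ?_
  simp only [volterra]
  rw [κ.integral_ker_mulVec h hz.1]
  rfl

variable {κ} {κI : PCKernel s}

/-- The defining equation of the resolvent kernel `κI` of `κ`. -/
def IsResolvent (κ κI : PCKernel s) : Prop := ∀ z ζ, (z, ζ) ∈ triangle → ∀ i j,
    κI.ker z ζ i j = κ.ker z ζ i j + ∫ σ in ζ..z, (κ.ker z σ * κI.ker σ ζ) i j

/-- The resolvent equation, integrated against a function: Fubini's theorem on the triangle. -/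
lemma IsResolvent.integral_eq (h : IsResolvent κ κI) {y : ℝ → Idx → ℝ}
    (hy : ∀ j, Continuous fun z => y z j) {Y : ℝ} (hY : ∀ z j, |y z j| ≤ Y) {z : ℝ}
    (hz : z ∈ Icc (0 : ℝ) 1) (i : Idx) :
    ∫ σ in (0 : ℝ)..z, Matrix.mulVec (κ.ker z σ) (κI.vint y σ) i =
      κI.vint y z i - κ.vint y z i := by
  have hB := κ.bound_nonneg
  have e1 : ∫ σ in (0 : ℝ)..z, Matrix.mulVec (κ.ker z σ) (κI.vint y σ) i =
      ∫ σ in (0 : ℝ)..z, ∫ ζ in (0 : ℝ)..σ,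
        Matrix.mulVec (κ.ker z σ) (Matrix.mulVec (κI.ker σ ζ) (y ζ)) i := by
    refine intervalIntegral.integral_congr fun σ hσ => ?_
    rw [uIcc_of_le hz.1] at hσ
    change ∑ j, κ.ker z σ i j * κI.vint y σ j =
      ∫ ζ in (0 : ℝ)..σ, ∑ j, κ.ker z σ i j * Matrix.mulVec (κI.ker σ ζ) (y ζ) j
    rw [intervalIntegral.integral_finsetSum fun j _ =>
      (κI.intervalIntegrable_ker_mulVec hy σ _ _ j).const_mul _]
    refine Finset.sum_congr rfl fun j _ => ?_
    rw [intervalIntegral.integral_const_mul, ← κI.integral_ker_mulVec hy hσ.1]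
  have hmeas : Measurable (Function.uncurry fun σ ζ =>
      Matrix.mulVec (κ.ker z σ) (Matrix.mulVec (κI.ker σ ζ) (y ζ)) i) := by
    change Measurable fun p : ℝ × ℝ =>
      ∑ l, κ.ker z p.1 i l * ∑ j, κI.ker p.1 p.2 l j * y p.2 j
    refine Finset.measurable_fun_sum _ fun l _ => Measurable.mul ?_ ?_
    · exact (κ.measurable_ker i l).comp (f := fun p : ℝ × ℝ => (z, p.1)) (by fun_prop)
    · refine Finset.measurable_fun_sum _ fun j _ => Measurable.mul ?_ ?_
      · exact κI.measurable_ker l j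
      · exact (hy j).measurable.comp measurable_snd
  have e2 : ∀ ζ ∈ Icc 0 z, ∫ σ in ζ..z,
      Matrix.mulVec (κ.ker z σ) (Matrix.mulVec (κI.ker σ ζ) (y ζ)) i =
      Matrix.mulVec (κI.ker z ζ) (y ζ) i - Matrix.mulVec (κ.ker z ζ) (y ζ) i := by
    intro ζ hζ
    have hm : (z, ζ) ∈ triangle := ⟨hζ.1, hζ.2, hz.2⟩
    simp only [Matrix.mulVec_mulVec]
    simp only [Matrix.mulVec, dotProduct]
    rw [intervalIntegral.integral_finsetSum, ← Finset.sum_sub_distrib]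
    · refine Finset.sum_congr rfl fun j _ => ?_
      rw [intervalIntegral.integral_mul_const, h z ζ hm i j]
      ring
    · intro j _
      refine IntervalIntegrable.mul_const ?_ _
      refine (intervalIntegrable_const (c := 8 * κ.bound * (2 * κI.bound))).mono_fun' ?_
        (Eventually.of_forall fun σ => ?_)
      · refine Measurable.aestronglyMeasurable ?_
        simp only [Matrix.mul_apply]
        exact Finset.measurable_sum _ fun l _ =>
          (κ.measurable_ker_comp i l measurable_const measurable_id).mul
            (κI.measurable_ker_comp l j measurable_id measurable_const)
      · exact κ.abs_ker_mulVec_le z σ (y := fun l => κI.ker σ ζ l j)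
          (fun l => κI.abs_ker_le _ _ _ _) i
  rw [e1, integral_triangle_swap hmeas hz.1 (D := 8 * κ.bound * (8 * κI.bound * Y))
    (fun σ ζ => κ.abs_ker_mulVec_le _ _ (fun j => κI.abs_ker_mulVec_le _ _ (hY ζ) j) _),
    ← κI.integral_ker_mulVec hy hz.1, ← κ.integral_ker_mulVec hy hz.1,
    ← intervalIntegral.integral_sub (κI.intervalIntegrable_ker_mulVec hy _ _ _ _)
      (κ.intervalIntegrable_ker_mulVec hy _ _ _ _)]
  refine intervalIntegral.integral_congr fun ζ hζ => ?_
  rw [uIcc_of_le hz.1] at hζ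
  exact e2 ζ hζ

theorem IsResolvent.volterra_volterraInv (h : IsResolvent κ κI) {y : ℝ → Idx → ℝ}
    (hy : ContinuousOn y (Icc 0 1)) :
    EqOn (volterra κ.ker (volterraInv κI.ker y)) y (Icc 0 1) := by
  have hyc := continuous_clamp_apply hy
  obtain ⟨Y, hY⟩ := isCompact_Icc.exists_bound_of_continuousOn hy
  have hY' : ∀ z j, |y (clamp z) j| ≤ Y := fun z j =>
    (norm_le_pi_norm _ j).trans (hY _ (clamp_mem z))
  have hW : EqOn (volterraInv κI.ker y)
      (fun z => y (clamp z) + κI.vint (fun z => y (clamp z)) z) (Icc 0 1) := by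
    refine (volterraInv_congr (eqOn_clamp y)).trans fun z hz => ?_
    funext i
    simp only [volterraInv]
    rw [κI.integral_ker_mulVec hyc hz.1]
    rfl
  refine (volterra_congr hW).trans fun z hz => ?_
  funext i
  simp only [volterra, Matrix.mulVec_add, Pi.add_apply]
  rw [intervalIntegral.integral_add (κ.intervalIntegrable_ker_mulVec hyc _ _ _ _)
    (κ.intervalIntegrable_ker_mulVec (fun j => κI.continuous_vint_apply hyc j) _ _ _ _),
    h.integral_eq hyc hY' hz, κ.integral_ker_mulVec hyc hz.1, clamp_of_mem hz]
  ring

/-- The left inverse follows from the right inverse by uniqueness for Volterra equations. -/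
theorem IsResolvent.volterraInv_volterra (h : IsResolvent κ κI) {x : ℝ → Idx → ℝ}
    (hx : ContinuousOn x (Icc 0 1)) :
    EqOn (volterraInv κI.ker (volterra κ.ker x)) x (Icc 0 1) := by
  have hVx := κ.continuousOn_volterra hx
  obtain ⟨w, hw, hw2, huniq⟩ := κ.exists_solution hVx
  have h1 := huniq _ (κI.continuousOn_volterraInv hVx) fun z hz i => by
    have := congrFun (h.volterra_volterraInv hVx hz) i
    rw [← this]
    simp only [volterra]
    ring
  have h2 := huniq x hx fun z hz i => by
    simp only [volterra]
    ring
  exact h1.trans h2.symm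

end PCKernel

namespace Coeffs

variable {c : Coeffs} {lam : Fin 2 → ℝ → ℝ} {A : ℝ → Matrix Idx Idx ℝ}

lemma exists_pcKernel (c : Coeffs) : ∃ κ : PCKernel c.s, ∀ z ζ, (z, ζ) ∈ triangle →
    c.K z ζ = κ.ker z ζ := by
  have hL : Continuous fun p : ℝ × ℝ => (fun i j => c.jump i j / c.s.L (proc j) p.2 :
      Matrix Idx Idx ℝ) :=
    continuous_matrix fun i j => continuous_const.div
      ((c.s.cont _).comp continuous_snd) fun _ => c.s.L_ne _ _
  obtain ⟨κ, hU, hD⟩ := PCKernel.exists_of_continuousOn c.s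
    (c.continuous_K_parts 0).continuousOn hL.continuousOn
  refine ⟨κ, fun z ζ h => ?_⟩
  ext i j
  rw [κ.ker_apply, hU _ h, hD _ h]
  simp only [K]
  ring

lemma Extends.piecewiseContinuous_ker (h : c.Extends lam A) (κ : PCKernel c.s) :
    PiecewiseContinuous lam κ.ker := by
  refine ⟨_, _, κ.contU.continuousOn, (κ.contU.add κ.contD).continuousOn,
    fun p hp => ⟨fun hle => ?_, fun hlt => ?_⟩⟩
  · rw [h.phi_eq 0 ⟨hp.1.trans hp.2.1, hp.2.2⟩, h.phi_eq 1 ⟨hp.1, hp.2.1.trans hp.2.2⟩] at hle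
    rw [PCKernel.ker, Speeds.below, if_neg (not_lt.2 hle), zero_smul, add_zero]
  · rw [h.phi_eq 0 ⟨hp.1.trans hp.2.1, hp.2.2⟩, h.phi_eq 1 ⟨hp.1, hp.2.1.trans hp.2.2⟩] at hlt
    rw [PCKernel.ker, Speeds.below, if_pos hlt, one_smul]
    rfl

/-- The kernel as a piecewise continuous kernel. -/
def pc (c : Coeffs) : PCKernel c.s := c.exists_pcKernel.choose

lemma K_eq (c : Coeffs) {z ζ : ℝ} (h : (z, ζ) ∈ triangle) : c.K z ζ = c.pc.ker z ζ :=
  c.exists_pcKernel.choose_spec z ζ h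

/-- The kernel of the inverse Volterra transformation. -/
def pcI (c : Coeffs) : PCKernel c.s := c.pc.exists_resolvent.choose

lemma isResolvent (c : Coeffs) : PCKernel.IsResolvent c.pc c.pcI :=
  c.pc.exists_resolvent.choose_spec

lemma isInverseKernel (c : Coeffs) : IsInverseKernel c.K c.pcI.ker := by
  intro z ζ h i j
  rw [c.K_eq h, c.isResolvent z ζ h i j]
  congr 1
  refine intervalIntegral.integral_congr fun σ hσ => ?_
  rw [uIcc_of_le h.2.1] at hσ
  rw [c.K_eq ⟨h.1.trans hσ.1, hσ.2, h.2.2⟩]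

lemma volterra_eq (c : Coeffs) (x : ℝ → Idx → ℝ) :
    EqOn (volterra c.K x) (volterra c.pc.ker x) (Icc 0 1) := by
  intro z hz
  funext i
  simp only [volterra]
  congr 1
  refine intervalIntegral.integral_congr fun ζ hζ => ?_
  rw [uIcc_of_le hz.1] at hζ
  rw [c.K_eq ⟨hζ.1, hζ.2, hz.2⟩]

lemma continuousOn_volterra (c : Coeffs) {x : ℝ → Idx → ℝ} (hx : ContinuousOn x (Icc 0 1)) :
    ContinuousOn (volterra c.K x) (Icc 0 1) :=
  (c.pc.continuousOn_volterra hx).congr (c.volterra_eq x)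

lemma volterra_volterraInv (c : Coeffs) {y : ℝ → Idx → ℝ} (hy : ContinuousOn y (Icc 0 1)) :
    EqOn (volterra c.K (volterraInv c.pcI.ker y)) y (Icc 0 1) :=
  (c.volterra_eq _).trans (c.isResolvent.volterra_volterraInv hy)

lemma volterraInv_volterra (c : Coeffs) {x : ℝ → Idx → ℝ} (hx : ContinuousOn x (Icc 0 1)) :
    EqOn (volterraInv c.pcI.ker (volterra c.K x)) x (Icc 0 1) :=
  (PCKernel.volterraInv_congr (c.volterra_eq x)).trans (c.isResolvent.volterraInv_volterra hx)

/-! ### The inverse Volterra transformation turns the target operator into the beam operator -/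

/-- The beam operator can be inverted for given values at `z = 0`: a linear ordinary differential
equation, solved as a Volterra equation with the continuous kernel `-A / v`. -/
lemma exists_ode_solution (c : Coeffs) {F : ℝ → Idx → ℝ} (hF : ContinuousOn F (Icc 0 1))
    (x₀ : Idx → ℝ) : ∃ x x' : ℝ → Idx → ℝ, (∀ j z, HasDerivAt (fun z => x z j) (x' z j) z) ∧
      (∀ j, Continuous fun z => x' z j) ∧ x 0 = x₀ ∧
      EqOn (c.beamOp x x') F (Icc 0 1) := by
  have hM : Continuous fun p : ℝ × ℝ => (fun i j => -(c.A p.2 i j / c.v i p.2) :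
      Matrix Idx Idx ℝ) :=
    continuous_matrix fun i j => (((c.contA_apply i j).comp continuous_snd).div
      ((c.continuous_v i).comp continuous_snd) fun _ => c.v_ne_zero _ _).neg
  obtain ⟨κ, hU, hD⟩ := PCKernel.exists_of_continuousOn c.s hM.continuousOn
    (D := fun _ => 0) continuousOn_const
  have hFc := PCKernel.continuous_clamp_apply hF
  have hFv : ∀ i, Continuous fun ζ => F (clamp ζ) i / c.v i ζ := fun i =>
    (hFc i).div (c.continuous_v i) (c.v_ne_zero i)
  obtain ⟨x, hx, hxe, -⟩ := κ.exists_solution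
    (φ := fun z i => x₀ i + ∫ ζ in (0 : ℝ)..z, F (clamp ζ) i / c.v i ζ)
    (continuousOn_pi.2 fun i => (continuous_const.add
      (intervalIntegral.continuous_primitive (fun a b => (hFv i).intervalIntegrable a b)
        0)).continuousOn)
  have hxc := PCKernel.continuous_clamp_apply hx
  let x' : ℝ → Idx → ℝ := fun z i =>
    (F (clamp z) i - Matrix.mulVec (c.A z) (x (clamp z)) i) / c.v i z
  have hAx : ∀ i, Continuous fun z => Matrix.mulVec (c.A z) (x (clamp z)) i := fun i => by
    change Continuous fun z => ∑ j, c.A z i j * x (clamp z) j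
    exact continuous_finsetSum _ fun j _ => (c.contA_apply i j).mul (hxc j)
  have hx' : ∀ j, Continuous fun z => x' z j := fun j =>
    ((hFc j).sub (hAx j)).div (c.continuous_v j) (c.v_ne_zero j)
  let xg : ℝ → Idx → ℝ := fun z i => x₀ i + ∫ ζ in (0 : ℝ)..z, x' ζ i
  have hxg : EqOn xg x (Icc 0 1) := by
    intro z hz
    funext i
    rw [hxe z hz i]
    have e1 : ∫ ζ in (0 : ℝ)..z, Matrix.mulVec (κ.ker z ζ) (x ζ) i =
        ∫ ζ in (0 : ℝ)..z, -(Matrix.mulVec (c.A ζ) (x (clamp ζ)) i / c.v i ζ) := by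
      refine intervalIntegral.integral_congr fun ζ hζ => ?_
      rw [uIcc_of_le hz.1] at hζ
      have hm : (z, ζ) ∈ triangle := ⟨hζ.1, hζ.2, hz.2⟩
      simp only [Matrix.mulVec, dotProduct, κ.ker_apply, hU _ hm, hD _ hm]
      rw [clamp_of_mem ⟨hζ.1, hζ.2.trans hz.2⟩, Finset.sum_div, ← Finset.sum_neg_distrib]
      refine Finset.sum_congr rfl fun j _ => ?_
      simp only [Matrix.zero_apply]
      ring
    have i2 : Continuous fun ζ => -(Matrix.mulVec (c.A ζ) (x (clamp ζ)) i / c.v i ζ) :=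
      ((hAx i).div (c.continuous_v i) (c.v_ne_zero i)).neg
    rw [e1, add_assoc, ← intervalIntegral.integral_add ((hFv i).intervalIntegrable _ _)
      (i2.intervalIntegrable _ _)]
    simp only [xg, x']
    congr 1
    refine intervalIntegral.integral_congr fun ζ _ => ?_
    ring
  refine ⟨xg, x', fun j z => ?_, hx', ?_, fun z hz => ?_⟩
  · exact (((hx' j).integral_hasStrictDerivAt 0 z).hasDerivAt).const_add _
  · funext i
    simp [xg]
  · funext i
    have := c.v_ne_zero i z
    simp only [beamOp, x']
    rw [hxg hz, clamp_of_mem hz]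
    field_simp
    ring

/-- The converse of `hasDerivWithinAt_volterra`. Differentiating the inverse kernel is avoided: let
`x` solve the beam equations with right-hand side `volterraInv f` and the value `y 0` at `z = 0`.
Then the Volterra transform of `x` has the same derivative as `y`, hence equals `y`, and
`x = volterraInv y`. -/
theorem hasDerivWithinAt_volterraInv (c : Coeffs) {y y' f : ℝ → Idx → ℝ}
    (hy : ∀ i, ∀ z ∈ Icc (0 : ℝ) 1, HasDerivWithinAt (fun z => y z i) (y' z i) (Icc 0 1) z)
    (h0 : ∀ k, y 0 (Sum.inr k) = -y 0 (Sum.inl k)) (hf : ContinuousOn f (Icc 0 1))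
    (heq : ∀ i, ∀ z ∈ Icc (0 : ℝ) 1,
      f z i = c.v i z * y' z i + c.alpha i z * y 0 (Sum.inl 0)) (i : Idx)
    {z : ℝ} (hz : z ∈ Icc (0 : ℝ) 1) :
    HasDerivWithinAt (fun z => volterraInv c.pcI.ker y z i)
      ((volterraInv c.pcI.ker f z i -
        Matrix.mulVec (c.A z) (volterraInv c.pcI.ker y z) i) / c.v i z) (Icc 0 1) z := by
  obtain ⟨x, x', hx, hx', hx0, hxF⟩ := c.exists_ode_solution
    (c.pcI.continuousOn_volterraInv hf) (y 0)
  have hxc : ContinuousOn x (Icc 0 1) := continuousOn_pi.2 fun j =>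
    (continuous_iff_continuousAt.2 fun z => (hx j z).continuousAt).continuousOn
  have hy0 : (0 : ℝ) ∈ Icc (0 : ℝ) 1 := by simp
  -- both sides have the same value at `0` and the same derivative
  have hVx : EqOn (volterra c.K x) y (Icc 0 1) := by
    intro w hw
    funext j
    have hd : ∀ w ∈ Icc (0 : ℝ) 1, HasDerivWithinAt (fun z => volterra c.K x z j) (y' w j)
        (Icc 0 1) w := by
      intro w hw
      refine (c.hasDerivWithinAt_volterra hx hx' (by rw [hx0]; exact h0) j hw).congr_deriv ?_
      rw [PCKernel.volterra_congr hxF hw, c.volterra_volterraInv hf hw, hx0, heq j w hw]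
      have := c.v_ne_zero j w
      field_simp
      ring
    refine eq_of_has_deriv_right_eq (a := 0) (b := 1) (f' := fun w => y' w j)
      (fun w hw => (hd w (Ico_subset_Icc_self hw)).mono_of_mem_nhdsWithin
        (Icc_mem_nhdsGE_of_mem hw))
      (fun w hw => (hy j w (Ico_subset_Icc_self hw)).mono_of_mem_nhdsWithin
        (Icc_mem_nhdsGE_of_mem hw))
      (fun w hw => (hd w hw).continuousWithinAt) (fun w hw => (hy j w hw).continuousWithinAt)
      ?_ w hw
    simp [volterra, hx0]
  have hWy : EqOn (volterraInv c.pcI.ker y) x (Icc 0 1) :=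
    (PCKernel.volterraInv_congr hVx.symm).trans (c.volterraInv_volterra hxc)
  refine ((hx i z).hasDerivWithinAt.congr (fun w hw => congrFun (hWy hw) i)
    (congrFun (hWy hz) i)).congr_deriv ?_
  have h1 := congrFun (hxF hz) i
  have := c.v_ne_zero i z
  rw [hWy hz, ← h1, beamOp]
  field_simp
  ring

end Coeffs

namespace Coeffs

variable {c : Coeffs} {lam : Fin 2 → ℝ → ℝ} {A : ℝ → Matrix Idx Idx ℝ}

/-! ### The controller form as a convolution -/

/-- The transport time of the process `k`. -/
def T (c : Coeffs) (k : Fin 2) : ℝ := c.s.Phi k 1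

lemma T_pos (c : Coeffs) (k : Fin 2) : 0 < c.T k := by
  have h := c.s.Phi_strictMono k zero_lt_one
  rwa [c.s.Phi_zero] at h

lemma T_lt (c : Coeffs) : c.T 0 < c.T 1 := by
  have h := c.s.Phi_gap zero_le_one
  simp only [Speeds.Phi_zero, sub_zero] at h
  change (1 + c.s.δ) * c.T 0 ≤ c.T 1 at h
  nlinarith [c.s.δ_pos, c.T_pos 0, mul_pos c.s.δ_pos (c.T_pos 0)]

lemma Phi_mem (c : Coeffs) (k : Fin 2) {z : ℝ} (hz : z ∈ Icc (0 : ℝ) 1) :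
    c.s.Phi k z ∈ Icc 0 (c.T k) :=
  ⟨c.s.Phi_nonneg k hz.1, (c.s.Phi_le_iff k).2 hz.2⟩

lemma Psi_mem (c : Coeffs) (k : Fin 2) {r : ℝ} (hr : r ∈ Icc 0 (c.T k)) :
    c.s.Psi k r ∈ Icc (0 : ℝ) 1 := by
  have h1 := c.s.Psi_mono k hr.1
  have h2 := c.s.Psi_mono k hr.2
  rw [T, c.s.Psi_Phi] at h2
  rw [← c.s.Phi_zero k, c.s.Psi_Phi] at h1
  exact ⟨h1, h2⟩

lemma Extends.tau_eq (h : c.Extends lam A) (k : Fin 2) : tau lam k = c.T k :=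
  h.phi_eq k (by simp)

lemma Extends.dtau_eq (h : c.Extends lam A) : dtau lam = c.T 1 - c.T 0 := by
  rw [dtau, h.tau_eq, h.tau_eq]

lemma Extends.psi_eq (h : c.Extends lam A) (k : Fin 2) {r : ℝ} (hr : r ∈ Icc 0 (c.T k)) :
    psi lam k r = c.s.Psi k r := by
  have hm := c.Psi_mem k hr
  have he : ∃ z ∈ Icc (0 : ℝ) 1, phi lam k z = r := ⟨_, hm, by rw [h.phi_eq k hm, c.s.Phi_Psi]⟩
  have h1 := Function.invFunOn_mem he
  have h2 := Function.invFunOn_eq he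
  rw [h.phi_eq k h1] at h2
  rw [psi, ← c.s.Psi_Phi k (Function.invFunOn (phi lam k) (Icc 0 1) r), h2]

/-- The coupling of the process `k` to `x̄₁⁻(0)` on its incoming part `r ≤ τₖ`. -/
def coupPlus (c : Coeffs) (k : Fin 2) (r : ℝ) : ℝ :=
  -c.alpha (Sum.inr k) (clamp (c.s.Psi k (c.T k - r)))

/-- The coupling of the process `k` to `x̄₁⁻(0)` on its outgoing part `τₖ ≤ r`. -/
def coupMinus (c : Coeffs) (k : Fin 2) (r : ℝ) : ℝ :=
  c.alpha (Sum.inl k) (clamp (c.s.Psi k (r - c.T k)))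

/-- The coupling of the process `k` to `x̄₁⁻(0)`, as a function of the travel time `r` counted
from `z = 1` along `x̄ₖ⁺` to `z = 0` and then along `x̄ₖ⁻` back to `z = 1`. -/
def coup (c : Coeffs) (k : Fin 2) (r : ℝ) : ℝ :=
  if r < c.T k then c.coupPlus k r else c.coupMinus k r

lemma continuous_coupPlus (c : Coeffs) (k : Fin 2) : Continuous (c.coupPlus k) :=
  ((c.continuous_alpha _).comp (continuous_clamp.comp
    ((c.s.continuous_Psi k).comp (by fun_prop)))).neg

lemma continuous_coupMinus (c : Coeffs) (k : Fin 2) : Continuous (c.coupMinus k) :=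
  (c.continuous_alpha _).comp (continuous_clamp.comp
    ((c.s.continuous_Psi k).comp (by fun_prop)))

lemma measurable_coup (c : Coeffs) (k : Fin 2) : Measurable (c.coup k) :=
  Measurable.ite (measurableSet_lt measurable_id measurable_const)
    (c.continuous_coupPlus k).measurable (c.continuous_coupMinus k).measurable

lemma continuousAt_coup (c : Coeffs) (k : Fin 2) {r : ℝ} (hr : r ≠ c.T k) :
    ContinuousAt (c.coup k) r := by
  rcases lt_or_gt_of_ne hr with h | h
  · refine (c.continuous_coupPlus k).continuousAt.congr ?_
    filter_upwards [Iio_mem_nhds h] with x hx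
    rw [coup, if_pos (mem_Iio.1 hx)]
  · refine (c.continuous_coupMinus k).continuousAt.congr ?_
    filter_upwards [Ioi_mem_nhds h] with x hx
    rw [coup, if_neg (not_lt.2 (le_of_lt hx))]

lemma exists_coup_bound (c : Coeffs) (k : Fin 2) : ∃ C, 0 ≤ C ∧ ∀ r, |c.coup k r| ≤ C := by
  obtain ⟨C₁, h₁⟩ := isCompact_Icc.exists_bound_of_continuousOn (s := Icc (0 : ℝ) 1)
    (c.continuous_alpha (Sum.inr k)).continuousOn
  obtain ⟨C₂, h₂⟩ := isCompact_Icc.exists_bound_of_continuousOn (s := Icc (0 : ℝ) 1)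
    (c.continuous_alpha (Sum.inl k)).continuousOn
  refine ⟨max |C₁| |C₂|, (abs_nonneg _).trans (le_max_left _ _), fun r => ?_⟩
  rw [coup]
  split_ifs
  · rw [coupPlus, abs_neg]
    exact ((h₁ _ (clamp_mem _)).trans (le_abs_self _)).trans (le_max_left _ _)
  · exact ((h₂ _ (clamp_mem _)).trans (le_abs_self _)).trans (le_max_right _ _)

/-- A consequence of `alpha_fast`. -/
@[simp] lemma coup_fast (c : Coeffs) (r : ℝ) : c.coup 0 r = 0 := by
  rw [coup, coupPlus, coupMinus, c.alpha_fast rfl (clamp_mem _).1,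
    c.alpha_fast rfl (clamp_mem _).1]
  simp

/-- The contribution to `ηₖ(r)` of the signal `w`, the prediction of the first component of the
flat output. -/
def conv (c : Coeffs) (k : Fin 2) (w : ℝ → ℝ) (r : ℝ) : ℝ :=
  ∫ σ in (c.T 0)..(c.T 0 + r), c.coup k (c.T 0 + r - σ) * w σ

@[simp] lemma conv_fast (c : Coeffs) (w : ℝ → ℝ) (r : ℝ) : c.conv 0 w r = 0 := by
  simp [conv]

/-- The components `x̄ₖ⁺` and `-x̄ₖ⁻` as one function of the travel time from `z = 1`. -/
def unfold (c : Coeffs) (xb : ℝ → Idx → ℝ) (k : Fin 2) (r : ℝ) : ℝ :=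
  if r < c.T k then xb (c.s.Psi k (c.T k - r)) (Sum.inr k)
  else -xb (c.s.Psi k (r - c.T k)) (Sum.inl k)

/-- The signal `w` is `η₁` on `(τ₁, 2τ₁)`, continued by the prediction `-v` of the first input. -/
structure IsSignal (c : Coeffs) (e v w : ℝ → ℝ) : Prop where
  eq_state : ∀ σ ∈ Ioo (c.T 0) (2 * c.T 0), w σ = e σ
  eq_input : ∀ σ ∈ Ioo (2 * c.T 0) (c.T 0 + 2 * c.T 1), w σ = -v (σ - 2 * c.T 0)
  integrable : IntervalIntegrable w volume (c.T 0) (c.T 0 + 2 * c.T 1)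

lemma intervalIntegrable_coup_mul (c : Coeffs) (k : Fin 2) {w : ℝ → ℝ} {a b : ℝ}
    (hw : IntervalIntegrable w volume a b) (r : ℝ) :
    IntervalIntegrable (fun σ => c.coup k (r - σ) * w σ) volume a b := by
  obtain ⟨C, -, hC⟩ := c.exists_coup_bound k
  rw [intervalIntegrable_iff] at hw ⊢
  exact hw.bdd_mul (c := C)
    ((c.measurable_coup k).comp (measurable_const.sub measurable_id)).aestronglyMeasurable
    (Eventually.of_forall fun σ => hC _)

lemma continuousOn_conv (c : Coeffs) (k : Fin 2) {w : ℝ → ℝ}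
    (hw : IntervalIntegrable w volume (c.T 0) (c.T 0 + 2 * c.T 1)) :
    ContinuousOn (c.conv k w) (Icc 0 (2 * c.T 1)) := by
  obtain ⟨C, hC0, hC⟩ := c.exists_coup_bound k
  have hle : c.T 0 ≤ c.T 0 + 2 * c.T 1 := by linarith [c.T_pos 1]
  let S := Ioc (c.T 0) (c.T 0 + 2 * c.T 1)
  have hS : MeasurableSet S := measurableSet_Ioc
  have hi : Integrable (S.indicator w) := by
    rw [intervalIntegrable_iff_integrableOn_Ioc_of_le hle] at hw
    exact (integrable_indicator_iff hS).2 hw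
  have hc : Continuous fun r =>
      ∫ σ in (c.T 0)..(c.T 0 + r), c.coup k (c.T 0 + r - σ) * S.indicator w σ := by
    refine continuous_iff_continuousAt.2 fun r => ?_
    refine continuousAt_integral_moving (bound := fun σ => C * |S.indicator w σ|)
      (fun r => ?_) (Eventually.of_forall fun r σ => ?_) (fun a b => ?_) ?_ continuousAt_const
      (by fun_prop)
    · exact (((c.measurable_coup k).comp
        (measurable_const.sub measurable_id)).aestronglyMeasurable).mul hi.aestronglyMeasurable
    · rw [abs_mul]
      exact mul_le_mul_of_nonneg_right (hC _) (abs_nonneg _)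
    · exact (hi.abs.const_mul C).intervalIntegrable
    · have : {σ | c.T 0 + r - σ = c.T k}.Subsingleton := fun a ha b hb => by
        simp only [mem_ofPred_eq] at ha hb
        linarith
      filter_upwards [compl_mem_ae_iff.2 (this.measure_zero volume)] with σ hσ
      exact ((c.continuousAt_coup k hσ).comp (f := fun r => c.T 0 + r - σ)
        (by fun_prop)).mul continuousAt_const
  refine hc.continuousOn.congr fun r hr => ?_
  refine intervalIntegral.integral_congr_Ioo_of_le (by linarith [hr.1]) fun σ hσ => ?_
  rw [indicator_of_mem (show σ ∈ S from ⟨hσ.1, by linarith [hσ.2, hr.2]⟩)]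

/-- The two parts fit together by the boundary condition at `z = 0`. -/
lemma continuousOn_unfold (c : Coeffs) {xb : ℝ → Idx → ℝ} (hx : ContinuousOn xb (Icc 0 1))
    (h0 : ∀ k, xb 0 (Sum.inr k) = -xb 0 (Sum.inl k)) (k : Fin 2) :
    ContinuousOn (c.unfold xb k) (Icc 0 (2 * c.T k)) := by
  have h := PCKernel.continuous_clamp_apply hx
  have hΨ := c.s.continuous_Psi k
  have hP : c.s.Psi k 0 = 0 := by rw [← c.s.Phi_zero k, c.s.Psi_Phi, c.s.Phi_zero]
  -- on either side of the junction, the two values at `z = 0` cancel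
  have hc : Continuous fun r => xb (clamp (c.s.Psi k (max (c.T k - r) 0))) (Sum.inr k) -
      xb (clamp (c.s.Psi k (max (r - c.T k) 0))) (Sum.inl k) + xb 0 (Sum.inl k) :=
    (((h (Sum.inr k)).comp (hΨ.comp (by fun_prop : Continuous fun r => max (c.T k - r) 0))).sub
      ((h (Sum.inl k)).comp (hΨ.comp (by fun_prop : Continuous fun r => max (r - c.T k) 0)))).add
      continuous_const
  refine hc.continuousOn.congr fun r hr => ?_
  simp only [unfold]
  split_ifs with hlt
  · rw [max_eq_left (by linarith), max_eq_right (by linarith), hP, clamp_zero,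
      clamp_of_mem (c.Psi_mem k ⟨by linarith, by linarith [hr.1]⟩)]
    ring
  · rw [not_lt] at hlt
    rw [max_eq_right (by linarith), max_eq_left (by linarith), hP, clamp_zero,
      clamp_of_mem (c.Psi_mem k ⟨by linarith, by linarith [hr.2]⟩), h0]
    ring

lemma Extends.abar_plus (h : c.Extends lam A) {r : ℝ} (hr : r ∈ Icc 0 (c.T 1)) :
    abar lam (fun z => -c.alpha (Sum.inr 1) z) r = c.coupPlus 1 (c.T 1 - r) := by
  rw [abar, h.psi_eq 1 hr, coupPlus, sub_sub_cancel, clamp_of_mem (c.Psi_mem 1 hr)]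

lemma Extends.abar_minus (h : c.Extends lam A) {r : ℝ} (hr : r ∈ Icc 0 (c.T 1)) :
    abar lam (c.alpha (Sum.inl 1)) r = c.coupMinus 1 (c.T 1 + r) := by
  rw [abar, h.psi_eq 1 hr, coupMinus, add_sub_cancel_left, clamp_of_mem (c.Psi_mem 1 hr)]

lemma IsSignal.mono_integrable {e v w : ℝ → ℝ} (hw : c.IsSignal e v w) {a b : ℝ}
    (ha : a ∈ Icc (c.T 0) (c.T 0 + 2 * c.T 1)) (hb : b ∈ Icc (c.T 0) (c.T 0 + 2 * c.T 1)) :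
    IntervalIntegrable w volume a b := by
  refine hw.integrable.mono_set ?_
  rw [uIcc_of_le (a := c.T 0) (by linarith [c.T_pos 1])]
  exact uIcc_subset_Icc ha hb

/-- The incoming part of the convolution, split at the end of the state. -/
lemma Extends.conv_incoming (h : c.Extends lam A) {e v w : ℝ → ℝ} (hw : c.IsSignal e v w) {r : ℝ}
    (hr : r ∈ Icc 0 (c.T 1)) :
    c.conv 1 w r =
      (∫ σ in (c.T 0)..(min (2 * c.T 0) (c.T 0 + r)),
        abar lam (fun z => -c.alpha (Sum.inr 1) z) (c.T 1 - c.T 0 - r + σ) * e σ) -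
      ∫ σ in (min 0 (r - c.T 0))..(r - c.T 0),
        abar lam (fun z => -c.alpha (Sum.inr 1) z) (c.T 0 + c.T 1 - r + σ) * v σ := by
  have h0 := c.T_pos 0
  have h1 := c.T_lt
  obtain ⟨hr0, hr1⟩ := hr
  set m := min (2 * c.T 0) (c.T 0 + r) with hm
  have m1 : m ≤ c.T 0 + r := min_le_right _ _
  have m2 : m ≤ 2 * c.T 0 := min_le_left _ _
  have m3 : c.T 0 ≤ m := le_min (by linarith) (by linarith)
  have em : min 0 (r - c.T 0) = m - 2 * c.T 0 := by
    rw [hm, ← min_sub_sub_right]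
    congr 1 <;> ring
  have er : r - c.T 0 = c.T 0 + r - 2 * c.T 0 := by ring
  rw [em, er, ← intervalIntegral.integral_comp_sub_right (fun σ =>
      abar lam (fun z => -c.alpha (Sum.inr 1) z) (c.T 0 + c.T 1 - r + σ) * v σ),
    sub_eq_add_neg, ← intervalIntegral.integral_neg, conv,
    ← intervalIntegral.integral_add_adjacent_intervals (b := m)
      (c.intervalIntegrable_coup_mul 1 (hw.mono_integrable ⟨le_rfl, by linarith⟩
        ⟨m3, by linarith⟩) _)
      (c.intervalIntegrable_coup_mul 1 (hw.mono_integrable ⟨m3, by linarith⟩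
        ⟨by linarith, by linarith⟩) _)]
  congr 1
  · refine intervalIntegral.integral_congr_Ioo_of_le m3 fun σ hσ => ?_
    rw [h.abar_plus ⟨by linarith [hσ.1], by linarith [hσ.2]⟩, coup, if_pos (by linarith [hσ.1]),
      hw.eq_state σ ⟨hσ.1, by linarith [hσ.2]⟩]
    congr 2
    ring
  · refine intervalIntegral.integral_congr_Ioo_of_le m1 fun σ hσ => ?_
    have hσ2 : 2 * c.T 0 < σ := by
      rcases min_choice (2 * c.T 0) (c.T 0 + r) with h | h <;> linarith [hσ.1, hσ.2]
    rw [h.abar_plus ⟨by linarith [hσ.1], by linarith [hσ.2]⟩, coup, if_pos (by linarith [hσ.1]),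
      hw.eq_input σ ⟨hσ2, by linarith [hσ.2]⟩, mul_neg]
    congr 3
    ring

/-- The outgoing part of the convolution, split at the end of the state and at the junction. -/
lemma Extends.conv_outgoing (h : c.Extends lam A) {e v w : ℝ → ℝ} (hw : c.IsSignal e v w) {r : ℝ}
    (hr : r ∈ Icc (c.T 1) (2 * c.T 1)) :
    c.conv 1 w r =
      (∫ σ in (c.T 0 + (r - c.T 1))..(max (2 * c.T 0) (c.T 0 + (r - c.T 1))),
        abar lam (fun z => -c.alpha (Sum.inr 1) z) (c.T 1 - c.T 0 - r + σ) * e σ) +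
      (∫ σ in (c.T 0)..(min (2 * c.T 0) (c.T 0 + (r - c.T 1))),
        abar lam (c.alpha (Sum.inl 1)) (c.T 0 - c.T 1 + r - σ) * e σ) -
      (∫ σ in (max 0 (r - c.T 1 - c.T 0))..(r - c.T 0),
        abar lam (fun z => -c.alpha (Sum.inr 1) z) (c.T 0 + c.T 1 - r + σ) * v σ) -
      ∫ σ in (min 0 (r - c.T 1 - c.T 0))..(r - c.T 1 - c.T 0),
        abar lam (c.alpha (Sum.inl 1)) (-c.T 0 - c.T 1 + r - σ) * v σ := by
  have h0 := c.T_pos 0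
  have h1 := c.T_lt
  obtain ⟨hr0, hr1⟩ := hr
  set n := c.T 0 + (r - c.T 1) with hn
  set m := min (2 * c.T 0) n with hm
  set M := max (2 * c.T 0) n with hM
  have m1 : m ≤ n := min_le_right _ _
  have m2 : m ≤ 2 * c.T 0 := min_le_left _ _
  have m3 : c.T 0 ≤ m := le_min (by linarith) (by linarith)
  have M1 : n ≤ M := le_max_right _ _
  have M2 : 2 * c.T 0 ≤ M := le_max_left _ _
  have M3 : M ≤ c.T 0 + r := max_le (by linarith) (by linarith)
  have e1 : max 0 (r - c.T 1 - c.T 0) = M - 2 * c.T 0 := by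
    rw [hM, ← max_sub_sub_right]
    congr 1
    · ring
    · rw [hn]; ring
  have e2 : min 0 (r - c.T 1 - c.T 0) = m - 2 * c.T 0 := by
    rw [hm, ← min_sub_sub_right]
    congr 1
    · ring
    · rw [hn]; ring
  have e3 : r - c.T 0 = c.T 0 + r - 2 * c.T 0 := by ring
  have e4 : r - c.T 1 - c.T 0 = n - 2 * c.T 0 := by rw [hn]; ring
  have hi : ∀ {a b : ℝ}, c.T 0 ≤ a → a ≤ c.T 0 + r → c.T 0 ≤ b → b ≤ c.T 0 + r →
      IntervalIntegrable (fun σ => c.coup 1 (c.T 0 + r - σ) * w σ) volume a b :=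
    fun ha ha' hb hb' => c.intervalIntegrable_coup_mul 1
      (hw.mono_integrable ⟨ha, by linarith⟩ ⟨hb, by linarith⟩) _
  rw [e1, e2, e3, e4, ← intervalIntegral.integral_comp_sub_right (fun σ =>
      abar lam (fun z => -c.alpha (Sum.inr 1) z) (c.T 0 + c.T 1 - r + σ) * v σ),
    ← intervalIntegral.integral_comp_sub_right (fun σ =>
      abar lam (c.alpha (Sum.inl 1)) (-c.T 0 - c.T 1 + r - σ) * v σ), conv,
    ← intervalIntegral.integral_add_adjacent_intervals (b := n)
      (hi le_rfl (by linarith) (by linarith) (by linarith))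
      (hi (by linarith) (by linarith) (by linarith) le_rfl),
    ← intervalIntegral.integral_add_adjacent_intervals (a := c.T 0) (b := m) (c := n)
      (hi le_rfl (by linarith) (by linarith) (by linarith))
      (hi (by linarith) (by linarith) (by linarith) (by linarith)),
    ← intervalIntegral.integral_add_adjacent_intervals (a := n) (b := M)
      (hi (by linarith) (by linarith) (by linarith) (by linarith))
      (hi (by linarith) (by linarith) (by linarith) le_rfl)]
  have i1 : ∫ σ in (c.T 0)..m, c.coup 1 (c.T 0 + r - σ) * w σ =
      ∫ σ in (c.T 0)..m, abar lam (c.alpha (Sum.inl 1)) (c.T 0 - c.T 1 + r - σ) * e σ := by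
    refine intervalIntegral.integral_congr_Ioo_of_le m3 fun σ hσ => ?_
    rw [h.abar_minus ⟨by linarith [hσ.2], by linarith [hσ.1]⟩, coup,
      if_neg (by linarith [hσ.2]), hw.eq_state σ ⟨hσ.1, by linarith [hσ.2]⟩]
    congr 2
    ring
  have i2 : ∫ σ in m..n, c.coup 1 (c.T 0 + r - σ) * w σ =
      -∫ σ in m..n, abar lam (c.alpha (Sum.inl 1)) (-c.T 0 - c.T 1 + r - (σ - 2 * c.T 0)) *
        v (σ - 2 * c.T 0) := by
    rw [← intervalIntegral.integral_neg]
    refine intervalIntegral.integral_congr_Ioo_of_le m1 fun σ hσ => ?_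
    have hσ2 : 2 * c.T 0 < σ := by
      rcases min_choice (2 * c.T 0) n with h | h <;> linarith [hσ.1, hσ.2]
    rw [h.abar_minus ⟨by linarith [hσ.2], by linarith [hσ.1]⟩, coup,
      if_neg (by linarith [hσ.2]), hw.eq_input σ ⟨hσ2, by linarith [hσ.2]⟩, mul_neg]
    congr 3
    ring
  have i3 : ∫ σ in n..M, c.coup 1 (c.T 0 + r - σ) * w σ =
      ∫ σ in n..M, abar lam (fun z => -c.alpha (Sum.inr 1) z) (c.T 1 - c.T 0 - r + σ) * e σ := by
    refine intervalIntegral.integral_congr_Ioo_of_le M1 fun σ hσ => ?_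
    have hσ2 : σ < 2 * c.T 0 := by
      rcases max_choice (2 * c.T 0) n with h | h <;> linarith [hσ.1, hσ.2]
    rw [h.abar_plus ⟨by linarith [hσ.1], by linarith [hσ.2]⟩, coup,
      if_pos (by linarith [hσ.1]), hw.eq_state σ ⟨by linarith [hσ.1], hσ2⟩]
    congr 2
    ring
  have i4 : ∫ σ in M..(c.T 0 + r), c.coup 1 (c.T 0 + r - σ) * w σ =
      -∫ σ in M..(c.T 0 + r), abar lam (fun z => -c.alpha (Sum.inr 1) z)
        (c.T 0 + c.T 1 - r + (σ - 2 * c.T 0)) * v (σ - 2 * c.T 0) := by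
    rw [← intervalIntegral.integral_neg]
    refine intervalIntegral.integral_congr_Ioo_of_le M3 fun σ hσ => ?_
    rw [h.abar_plus ⟨by linarith [hσ.1], by linarith [hσ.2]⟩, coup,
      if_pos (by linarith [hσ.1]), hw.eq_input σ ⟨by linarith [hσ.1], by linarith [hσ.2]⟩, mul_neg]
    congr 3
    ring
  rw [i1, i2, i3, i4]
  ring

end Coeffs

namespace Coeffs

variable {c : Coeffs} {lam : Fin 2 → ℝ → ℝ} {A : ℝ → Matrix Idx Idx ℝ}

/-- The function `e` on the state interval, continued by the prediction `-v` of the input. -/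
def signal (c : Coeffs) (e v : ℝ → ℝ) (σ : ℝ) : ℝ :=
  if σ ≤ 2 * c.T 0 then e σ else -v (σ - 2 * c.T 0)

lemma isSignal_signal (c : Coeffs) {e v : ℝ → ℝ}
    (he : IntervalIntegrable e volume (c.T 0) (2 * c.T 0))
    (hv : IntervalIntegrable v volume 0 (c.T 1 - c.T 0 + c.T 1)) :
    c.IsSignal e v (c.signal e v) where
  eq_state σ hσ := if_pos hσ.2.le
  eq_input σ hσ := if_neg (not_le.2 hσ.1)
  integrable := by
    have h0 := c.T_pos 0
    have h1 := c.T_lt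
    have i1 : IntervalIntegrable (c.signal e v) volume (c.T 0) (2 * c.T 0) := by
      refine he.congr fun σ hσ => ?_
      rw [uIoc_of_le (by linarith)] at hσ
      exact (if_pos hσ.2).symm
    have i2 : IntervalIntegrable (c.signal e v) volume (2 * c.T 0) (c.T 0 + 2 * c.T 1) := by
      have h := (hv.comp_sub_right (2 * c.T 0)).neg
      rw [zero_add, show c.T 1 - c.T 0 + c.T 1 + 2 * c.T 0 = c.T 0 + 2 * c.T 1 by ring] at h
      refine h.congr fun σ hσ => ?_
      rw [uIoc_of_le (by linarith)] at hσ
      exact (if_neg (not_le.2 hσ.1)).symm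
    exact i1.trans i2

lemma Extends.barSlowPlus_eq (h : c.Extends lam A) {e : Fin 2 → ℝ → ℝ} {v w : ℝ → ℝ}
    (hw : c.IsSignal (e 0) v w) {z : ℝ} (hz : z ∈ Icc (0 : ℝ) 1) :
    barSlowPlus lam (fun z => -c.alpha (Sum.inr 1) z) v e z =
      e 1 (c.T 1 - c.s.Phi 1 z) - c.conv 1 w (c.T 1 - c.s.Phi 1 z) := by
  obtain ⟨h0, h1⟩ := c.Phi_mem 1 hz
  rw [h.conv_incoming hw ⟨by linarith, by linarith⟩]
  simp only [barSlowPlus, h.tau_eq, h.dtau_eq, h.phi_eq 1 hz]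
  generalize c.s.Phi 1 z = φ
  have e1 : c.T 0 + (c.T 1 - φ) = c.T 0 + c.T 1 - φ := by ring
  have e2 : c.T 1 - φ - c.T 0 = c.T 1 - c.T 0 - φ := by ring
  have e3 : ∀ σ, c.T 1 - c.T 0 - (c.T 1 - φ) + σ = φ - c.T 0 + σ := fun σ => by ring
  have e4 : ∀ σ, c.T 0 + c.T 1 - (c.T 1 - φ) + σ = φ + c.T 0 + σ := fun σ => by ring
  simp only [e1, e2, e3, e4]
  ring

lemma Extends.barSlowMinus_eq (h : c.Extends lam A) {e : Fin 2 → ℝ → ℝ} {v w : ℝ → ℝ}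
    (hw : c.IsSignal (e 0) v w) {z : ℝ} (hz : z ∈ Icc (0 : ℝ) 1) :
    barSlowMinus lam (c.alpha (Sum.inl 1)) (fun z => -c.alpha (Sum.inr 1) z) v e z =
      -(e 1 (c.T 1 + c.s.Phi 1 z) - c.conv 1 w (c.T 1 + c.s.Phi 1 z)) := by
  obtain ⟨h0, h1⟩ := c.Phi_mem 1 hz
  rw [h.conv_outgoing hw ⟨by linarith, by linarith⟩]
  simp only [barSlowMinus, h.tau_eq, h.dtau_eq, h.phi_eq 1 hz]
  generalize c.s.Phi 1 z = φ
  have e1 : c.T 1 + φ - c.T 1 = φ := by ring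
  have e2 : c.T 1 + φ - c.T 0 = c.T 1 - c.T 0 + φ := by ring
  have e3 : ∀ σ, c.T 1 - c.T 0 - (c.T 1 + φ) + σ = -φ - c.T 0 + σ := fun σ => by ring
  have e4 : ∀ σ, c.T 0 - c.T 1 + (c.T 1 + φ) - σ = φ + c.T 0 - σ := fun σ => by ring
  have e5 : ∀ σ, c.T 0 + c.T 1 - (c.T 1 + φ) + σ = -φ + c.T 0 + σ := fun σ => by ring
  have e6 : ∀ σ, -c.T 0 - c.T 1 + (c.T 1 + φ) - σ = φ - c.T 0 - σ := fun σ => by ring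
  simp only [e1, e2, e3, e4, e5, e6]
  ring

/-- `x̄` consists of `η`, minus the contribution of the prediction, on the two parts of the travel
time interval. -/
lemma Extends.barOfEta_eq (h : c.Extends lam A) {e : Fin 2 → ℝ → ℝ} {v w : ℝ → ℝ}
    (hw : c.IsSignal (e 0) v w) {z : ℝ} (hz : z ∈ Icc (0 : ℝ) 1) (k : Fin 2) :
    barOfEta lam (c.alpha (Sum.inl 1)) (fun z => -c.alpha (Sum.inr 1) z) v e z (Sum.inr k) =
        e k (c.T k - c.s.Phi k z) - c.conv k w (c.T k - c.s.Phi k z) ∧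
      barOfEta lam (c.alpha (Sum.inl 1)) (fun z => -c.alpha (Sum.inr 1) z) v e z (Sum.inl k) =
        -(e k (c.T k + c.s.Phi k z) - c.conv k w (c.T k + c.s.Phi k z)) := by
  fin_cases k
  · simp [barOfEta, h.tau_eq, h.phi_eq 0 hz]
  · exact ⟨h.barSlowPlus_eq hw hz, h.barSlowMinus_eq hw hz⟩

lemma Extends.unfold_eq (h : c.Extends lam A) (xb : ℝ → Idx → ℝ) (k : Fin 2) {r : ℝ}
    (hr : r ∈ Icc 0 (2 * c.T k)) :
    c.unfold xb k r = if r < tau lam k then xb (psi lam k (tau lam k - r)) (Sum.inr k)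
      else -xb (psi lam k (r - tau lam k)) (Sum.inl k) := by
  rw [unfold, h.tau_eq]
  split_ifs with hlt
  · rw [h.psi_eq k ⟨by linarith, by linarith [hr.1]⟩]
  · rw [h.psi_eq k ⟨by linarith, by linarith [hr.2]⟩]

/-- `η` consists of the components of `x̄` on the travel time interval, plus the contribution of
the prediction. -/
lemma Extends.etaOfBar_eq (h : c.Extends lam A) {xb : ℝ → Idx → ℝ} {v w : ℝ → ℝ}
    (hw : c.IsSignal (c.unfold xb 0) v w) (k : Fin 2) {r : ℝ} (hr : r ∈ Icc 0 (2 * c.T k)) :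
    etaOfBar lam (c.alpha (Sum.inl 1)) (fun z => -c.alpha (Sum.inr 1) z) v xb k r =
      c.unfold xb k r + c.conv k w r := by
  have hw' : c.IsSignal (fun σ => -xb (psi lam 0 (σ - c.T 0)) (Sum.inl 0)) v w :=
    { hw with
      eq_state := fun σ hσ => by
        rw [hw.eq_state σ hσ, h.unfold_eq xb 0 ⟨by linarith [hσ.1, c.T_pos 0], hσ.2.le⟩,
          h.tau_eq, if_neg (not_lt.2 hσ.1.le)] }
  fin_cases k
  · simp only [Fin.zero_eta, conv_fast, add_zero]
    exact (h.unfold_eq xb 0 hr).symm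
  · simp only [Fin.mk_one] at hr ⊢
    rw [h.unfold_eq xb 1 hr]
    change etaSlow lam _ _ v xb r = _
    rw [etaSlow]
    split_ifs with hlt
    · rw [h.tau_eq] at hlt
      rw [h.conv_incoming hw' ⟨hr.1, hlt.le⟩]
      simp only [h.tau_eq, h.dtau_eq, mul_neg, intervalIntegral.integral_neg]
      ring
    · rw [h.tau_eq, not_lt] at hlt
      rw [h.conv_outgoing hw' ⟨hlt, hr.2⟩]
      simp only [h.tau_eq, h.dtau_eq, mul_neg, intervalIntegral.integral_neg]
      have e1 : r - (c.T 1 - c.T 0) = c.T 0 + (r - c.T 1) := by ring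
      have e2 : ∀ σ, -(c.T 1 - c.T 0) + r - σ = c.T 0 - c.T 1 + r - σ := fun σ => by ring
      simp only [e1, e2]
      ring

/-! ### The bijection of the states -/

/-- The transformation adds the convolution with the signal to the unfolded state, the inverse
subtracts it again. The signal itself is the same in both, since the fast component of `η` is the
fast part of the unfolded state. -/
lemma Extends.etaOfBar_mem (h : c.Extends lam A) {xb : ℝ → Idx → ℝ} (hxb : xb ∈ beamStates)
    {v : ℝ → ℝ} (hv : IntervalIntegrable v volume 0 (dtau lam + tau lam 1)) :
    etaOfBar lam (c.alpha (Sum.inl 1)) (fun z => -c.alpha (Sum.inr 1) z) v xb ∈ hcfStates lam ∧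
      EqOn (barOfEta lam (c.alpha (Sum.inl 1)) (fun z => -c.alpha (Sum.inr 1) z) v
        (etaOfBar lam (c.alpha (Sum.inl 1)) (fun z => -c.alpha (Sum.inr 1) z) v xb)) xb
        (Icc 0 1) := by
  have h0 := c.T_pos 0
  have h1 := c.T_lt
  rw [h.dtau_eq, h.tau_eq] at hv
  have hu := c.continuousOn_unfold hxb.1 hxb.2
  have hw : c.IsSignal (c.unfold xb 0) v (c.signal (c.unfold xb 0) v) :=
    c.isSignal_signal (((hu 0).mono (by
      rw [uIcc_of_le (by linarith)]
      exact Icc_subset_Icc_left (by linarith))).intervalIntegrable) hv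
  have he := fun k r hr => h.etaOfBar_eq hw k (r := r) hr
  refine ⟨fun k => ?_, fun z hz => ?_⟩
  · rw [h.tau_eq]
    refine ((hu k).add ((c.continuousOn_conv k hw.integrable).mono ?_)).congr fun r hr => he k r hr
    refine Icc_subset_Icc_right ?_
    fin_cases k <;> simp [h1.le]
  · have hw' : c.IsSignal (etaOfBar lam (c.alpha (Sum.inl 1))
        (fun z => -c.alpha (Sum.inr 1) z) v xb 0) v (c.signal (c.unfold xb 0) v) :=
      { hw with
        eq_state := fun σ hσ => by
          rw [hw.eq_state σ hσ, he 0 σ ⟨by linarith [hσ.1], hσ.2.le⟩, conv_fast, add_zero] }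
    have hb := fun k => h.barOfEta_eq hw' hz k
    funext i
    rcases i with k | k
    · obtain ⟨p0, p1⟩ := c.Phi_mem k hz
      rw [(hb k).2, he k _ ⟨by linarith, by linarith⟩, unfold, if_neg (by linarith),
        add_sub_cancel_left, c.s.Psi_Phi]
      ring
    · obtain ⟨p0, p1⟩ := c.Phi_mem k hz
      rw [(hb k).1, he k _ ⟨by linarith, by linarith [c.T_pos k]⟩, add_sub_cancel_right, unfold]
      split_ifs with hlt
      · rw [sub_sub_cancel, c.s.Psi_Phi]
      · have e0 : c.s.Phi k z = 0 := by linarith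
        have z0 : z = 0 := (c.s.Phi_strictMono k).injective (by rw [e0, c.s.Phi_zero])
        rw [e0, sub_zero, sub_self, z0, hxb.2 k]
        nth_rewrite 1 [← c.s.Phi_zero k]
        rw [c.s.Psi_Phi]

lemma Extends.barOfEta_mem (h : c.Extends lam A) {e : Fin 2 → ℝ → ℝ} (he : e ∈ hcfStates lam)
    {v : ℝ → ℝ} (hv : IntervalIntegrable v volume 0 (dtau lam + tau lam 1)) :
    barOfEta lam (c.alpha (Sum.inl 1)) (fun z => -c.alpha (Sum.inr 1) z) v e ∈ beamStates ∧
      ∀ k, EqOn (etaOfBar lam (c.alpha (Sum.inl 1)) (fun z => -c.alpha (Sum.inr 1) z) v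
        (barOfEta lam (c.alpha (Sum.inl 1)) (fun z => -c.alpha (Sum.inr 1) z) v e) k) (e k)
        (Icc 0 (2 * tau lam k)) := by
  have h0 := c.T_pos 0
  have h1 := c.T_lt
  rw [h.dtau_eq, h.tau_eq] at hv
  have hec : ∀ k, ContinuousOn (e k) (Icc 0 (2 * c.T k)) := fun k => h.tau_eq k ▸ he k
  have hw : c.IsSignal (e 0) v (c.signal (e 0) v) :=
    c.isSignal_signal (((hec 0).mono (by
      rw [uIcc_of_le (by linarith)]
      exact Icc_subset_Icc_left (by linarith))).intervalIntegrable) hv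
  have hb := fun z hz k => h.barOfEta_eq hw (z := z) hz k
  set xb := barOfEta lam (c.alpha (Sum.inl 1)) (fun z => -c.alpha (Sum.inr 1) z) v e
  have hq : ∀ k, ContinuousOn (fun r => e k r - c.conv k (c.signal (e 0) v) r)
      (Icc 0 (2 * c.T k)) := fun k => (hec k).sub ((c.continuousOn_conv k hw.integrable).mono
        (Icc_subset_Icc_right (by fin_cases k <;> simp [h1.le])))
  have hu : ∀ k, ∀ r ∈ Icc 0 (2 * c.T k),
      c.unfold xb k r = e k r - c.conv k (c.signal (e 0) v) r := by
    intro k r hr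
    rw [unfold]
    split_ifs with hlt
    · rw [(hb _ (c.Psi_mem k ⟨by linarith, by linarith [hr.1]⟩) k).1, c.s.Phi_Psi, sub_sub_cancel]
    · rw [(hb _ (c.Psi_mem k ⟨by linarith, by linarith [hr.2]⟩) k).2, c.s.Phi_Psi,
        add_sub_cancel, neg_neg]
  refine ⟨⟨continuousOn_pi.2 fun i => ?_, fun k => ?_⟩, fun k r hr => ?_⟩
  · rcases i with k | k
    · refine ContinuousOn.congr (f := fun z => -(e k (c.T k + c.s.Phi k z) -
        c.conv k (c.signal (e 0) v) (c.T k + c.s.Phi k z))) ?_ fun z hz => (hb z hz k).2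
      refine ((hq k).comp (f := fun z => c.T k + c.s.Phi k z)
        (continuous_const.add (c.s.continuous_Phi k)).continuousOn fun z hz => ?_).neg
      obtain ⟨p0, p1⟩ := c.Phi_mem k hz
      exact ⟨by linarith, by linarith⟩
    · refine ContinuousOn.congr (f := fun z => e k (c.T k - c.s.Phi k z) -
        c.conv k (c.signal (e 0) v) (c.T k - c.s.Phi k z)) ?_ fun z hz => (hb z hz k).1
      refine (hq k).comp (f := fun z => c.T k - c.s.Phi k z)
        (continuous_const.sub (c.s.continuous_Phi k)).continuousOn fun z hz => ?_
      obtain ⟨p0, p1⟩ := c.Phi_mem k hz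
      exact ⟨by linarith, by linarith [c.T_pos k]⟩
  · have h00 : (0 : ℝ) ∈ Icc (0 : ℝ) 1 := by simp
    rw [(hb 0 h00 k).1, (hb 0 h00 k).2, c.s.Phi_zero, sub_zero, add_zero, neg_neg]
  · rw [h.tau_eq] at hr
    have hw' : c.IsSignal (c.unfold xb 0) v (c.signal (e 0) v) :=
      { hw with
        eq_state := fun σ hσ => by
          rw [hw.eq_state σ hσ, hu 0 σ ⟨by linarith [hσ.1], hσ.2.le⟩, conv_fast, sub_zero] }
    rw [h.etaOfBar_eq hw' k hr, hu k r hr]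
    ring

/-- Only the values on `[0,1]` enter. -/
lemma unfold_congr {xb xb' : ℝ → Idx → ℝ} (he : EqOn xb' xb (Icc 0 1)) (k : Fin 2) {r : ℝ}
    (hr : r ∈ Icc 0 (2 * c.T k)) : c.unfold xb' k r = c.unfold xb k r := by
  rw [unfold, unfold]
  split_ifs with hlt
  · rw [he (c.Psi_mem k ⟨by linarith, by linarith [hr.1]⟩)]
  · rw [he (c.Psi_mem k ⟨by linarith, by linarith [hr.2]⟩)]

lemma Extends.etaOfBar_congr (h : c.Extends lam A) {xb xb' : ℝ → Idx → ℝ} (hxb : xb ∈ beamStates)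
    (he : EqOn xb' xb (Icc 0 1)) {v : ℝ → ℝ}
    (hv : IntervalIntegrable v volume 0 (dtau lam + tau lam 1)) (k : Fin 2) :
    EqOn (etaOfBar lam (c.alpha (Sum.inl 1)) (fun z => -c.alpha (Sum.inr 1) z) v xb' k)
      (etaOfBar lam (c.alpha (Sum.inl 1)) (fun z => -c.alpha (Sum.inr 1) z) v xb k)
      (Icc 0 (2 * tau lam k)) := by
  have h0 := c.T_pos 0
  rw [h.dtau_eq, h.tau_eq] at hv
  intro r hr
  rw [h.tau_eq] at hr
  have hw : c.IsSignal (c.unfold xb 0) v (c.signal (c.unfold xb 0) v) :=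
    c.isSignal_signal (((c.continuousOn_unfold hxb.1 hxb.2 0).mono (by
      rw [uIcc_of_le (by linarith)]
      exact Icc_subset_Icc_left (by linarith))).intervalIntegrable) hv
  have hw' : c.IsSignal (c.unfold xb' 0) v (c.signal (c.unfold xb 0) v) :=
    { hw with
      eq_state := fun σ hσ => by
        rw [hw.eq_state σ hσ, unfold_congr he 0 ⟨by linarith [hσ.1], hσ.2.le⟩] }
  rw [h.etaOfBar_eq hw' k hr, h.etaOfBar_eq hw k hr, unfold_congr he k hr]

lemma volterra_zero (K : ℝ → ℝ → Matrix Idx Idx ℝ) (x : ℝ → Idx → ℝ) (i : Idx) :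
    volterra K x 0 i = x 0 i := by simp [volterra]

lemma volterraInv_zero (K : ℝ → ℝ → Matrix Idx Idx ℝ) (x : ℝ → Idx → ℝ) (i : Idx) :
    volterraInv K x 0 i = x 0 i := by simp [volterraInv]

lemma volterra_mem (c : Coeffs) {x : ℝ → Idx → ℝ} (hx : x ∈ beamStates) :
    volterra c.K x ∈ beamStates :=
  ⟨c.continuousOn_volterra hx.1, fun k => by rw [volterra_zero, volterra_zero, hx.2]⟩

/-- One half of the bijection of the states, composed with the Volterra transformation. -/
theorem Extends.toHCF_mem (h : c.Extends lam A) {x : ℝ → Idx → ℝ} (hx : x ∈ beamStates)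
    {v : ℝ → ℝ} (hv : IntervalIntegrable v volume 0 (dtau lam + tau lam 1)) :
    toHCF lam (c.alpha (Sum.inl 1)) (fun z => -c.alpha (Sum.inr 1) z) c.K v x ∈ hcfStates lam ∧
      EqOn (ofHCF lam (c.alpha (Sum.inl 1)) (fun z => -c.alpha (Sum.inr 1) z) c.pcI.ker v
        (toHCF lam (c.alpha (Sum.inl 1)) (fun z => -c.alpha (Sum.inr 1) z) c.K v x)) x
        (Icc 0 1) := by
  obtain ⟨h1, h2⟩ := h.etaOfBar_mem (c.volterra_mem hx) hv
  exact ⟨h1, (PCKernel.volterraInv_congr h2).trans (c.volterraInv_volterra hx.1)⟩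

/-- The other half of the bijection of the states. -/
theorem Extends.ofHCF_mem (h : c.Extends lam A) {e : Fin 2 → ℝ → ℝ} (he : e ∈ hcfStates lam)
    {v : ℝ → ℝ} (hv : IntervalIntegrable v volume 0 (dtau lam + tau lam 1)) :
    ofHCF lam (c.alpha (Sum.inl 1)) (fun z => -c.alpha (Sum.inr 1) z) c.pcI.ker v e
        ∈ beamStates ∧
      ∀ k, EqOn (toHCF lam (c.alpha (Sum.inl 1)) (fun z => -c.alpha (Sum.inr 1) z) c.K v
        (ofHCF lam (c.alpha (Sum.inl 1)) (fun z => -c.alpha (Sum.inr 1) z) c.pcI.ker v e) k) (e k)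
        (Icc 0 (2 * tau lam k)) := by
  obtain ⟨h1, h2⟩ := h.barOfEta_mem he hv
  have hm : ofHCF lam (c.alpha (Sum.inl 1)) (fun z => -c.alpha (Sum.inr 1) z) c.pcI.ker v e
      ∈ beamStates := ⟨c.pcI.continuousOn_volterraInv h1.1, fun k => by
    rw [ofHCF, volterraInv_zero, volterraInv_zero, h1.2]⟩
  refine ⟨hm, fun k => ?_⟩
  exact (h.etaOfBar_congr h1 (c.volterra_volterraInv h1.1) hv k).trans (h2 k)

end Coeffs

/-! ### Partial derivatives on the space-time strip -/

lemma exists_partial_of_contDiffOn {E : Type*} [NormedAddCommGroup E] [NormedSpace ℝ E]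
    {f : ℝ → ℝ → E} {s t : Set ℝ} (hs : UniqueDiffOn ℝ s) (ht : UniqueDiffOn ℝ t)
    (hf : ContDiffOn ℝ 1 (fun p : ℝ × ℝ => f p.1 p.2) (s ×ˢ t)) :
    ∃ fx fy : ℝ → ℝ → E, ContinuousOn (Function.uncurry fx) (s ×ˢ t) ∧
      ContinuousOn (Function.uncurry fy) (s ×ˢ t) ∧
      (∀ x ∈ s, ∀ y ∈ t, HasDerivWithinAt (fun x => f x y) (fx x y) s x) ∧
      ∀ x ∈ s, ∀ y ∈ t, HasDerivWithinAt (fun y => f x y) (fy x y) t y := by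
  have hc := hf.continuousOn_fderivWithin (hs.prod ht) le_rfl
  refine ⟨fun x y => fderivWithin ℝ (fun p : ℝ × ℝ => f p.1 p.2) (s ×ˢ t) (x, y) (1, 0),
    fun x y => fderivWithin ℝ (fun p : ℝ × ℝ => f p.1 p.2) (s ×ˢ t) (x, y) (0, 1),
    hc.clm_apply continuousOn_const, hc.clm_apply continuousOn_const, ?_, ?_⟩
  · intro x hx y hy
    have h := (hf.differentiableOn one_ne_zero (x, y) ⟨hx, hy⟩).hasFDerivWithinAt
    exact h.comp_hasDerivWithinAt x (f := fun x => (x, y))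
      ((hasDerivWithinAt_id x s).prodMk (hasDerivWithinAt_const x s y)) fun x hx => ⟨hx, hy⟩
  · intro x hx y hy
    have h := (hf.differentiableOn one_ne_zero (x, y) ⟨hx, hy⟩).hasFDerivWithinAt
    exact h.comp_hasDerivWithinAt y (f := fun y => (x, y))
      ((hasDerivWithinAt_const y t x).prodMk (hasDerivWithinAt_id y t)) fun y hy => ⟨hx, hy⟩

/-- The strip on which the beam equations hold. -/
def strip : Set (ℝ × ℝ) := Icc 0 1 ×ˢ Ici 0

lemma retract_strip_mem (p : ℝ × ℝ) : (clamp p.1, max p.2 0) ∈ strip :=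
  ⟨clamp_mem _, mem_Ici.2 (le_max_right _ _)⟩

lemma continuous_strip_apply {f : ℝ → ℝ → Idx → ℝ}
    (hf : ContinuousOn (Function.uncurry f) strip) (j : Idx) :
    Continuous fun p : ℝ × ℝ => f (clamp p.1) (max p.2 0) j :=
  (continuous_apply j).comp (hf.comp_continuous (f := fun p : ℝ × ℝ => (clamp p.1, max p.2 0))
    ((continuous_clamp.comp continuous_fst).prodMk (by fun_prop)) retract_strip_mem)

namespace PCKernel

variable {s : Speeds} (κ : PCKernel s)

lemma continuousOn_integral_strip {f : ℝ → ℝ → Idx → ℝ}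
    (hf : ContinuousOn (Function.uncurry f) strip) (i : Idx) :
    ContinuousOn (fun p : ℝ × ℝ =>
      ∫ ζ in (0 : ℝ)..p.1, Matrix.mulVec (κ.ker p.1 ζ) (f ζ p.2) i) strip := by
  have h := κ.continuous_vint (f := fun t ζ => f (clamp ζ) (max t 0))
    (fun j => (continuous_strip_apply hf j).comp (f := fun p : ℝ × ℝ => (p.2, p.1))
      (by fun_prop)) i
  refine ((h.comp (f := fun p : ℝ × ℝ => (p.2, p.1)) (by fun_prop)).continuousOn (s := strip)).congr
    fun p hp => ?_
  obtain ⟨z, t⟩ := p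
  obtain ⟨hz, ht⟩ := hp
  simp only [mem_Ici] at hz ht
  simp only [Function.comp]
  rw [integral_congr_clamp (eqOn_clamp fun ζ => f ζ t) hz]
  rw [κ.integral_ker_mulVec (f := fun ζ => f (clamp ζ) t) (fun j => ?_) hz.1, max_eq_left ht]
  have := (continuous_strip_apply hf j).comp (f := fun z : ℝ => (z, t)) (by fun_prop)
  simpa only [Function.comp_def, max_eq_left ht] using this

lemma hasDerivAt_vint {f f' : ℝ → ℝ → Idx → ℝ}
    (hf : ∀ j, Continuous fun p : ℝ × ℝ => f p.1 p.2 j)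
    (hf' : ∀ j, Continuous fun p : ℝ × ℝ => f' p.1 p.2 j)
    (hd : ∀ t ζ j, HasDerivAt (fun t => f t ζ j) (f' t ζ j) t) (z : ℝ) (i : Idx) (t : ℝ) :
    HasDerivAt (fun t => κ.vint (f t) z i) (κ.vint (f' t) z i) t := by
  have key : ∀ {M : ℝ → Idx → ℝ} (_ : ∀ j, Continuous fun ζ => M ζ j) (b : ℝ),
      HasDerivAt (fun t => ∫ ζ in (0 : ℝ)..b, ∑ j, M ζ j * f t ζ j)
        (∫ ζ in (0 : ℝ)..b, ∑ j, M ζ j * f' t ζ j) t := by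
    intro M hM b
    have hs : ∀ {g : ℝ → ℝ → Idx → ℝ} (_ : ∀ j, Continuous fun p : ℝ × ℝ => g p.1 p.2 j) (t : ℝ),
        ∫ ζ in (0 : ℝ)..b, ∑ j, M ζ j * g t ζ j = ∑ j, ∫ ζ in (0 : ℝ)..b, M ζ j * g t ζ j :=
      fun hg t => intervalIntegral.integral_finsetSum fun j _ =>
        ((hM j).mul ((hg j).comp (f := fun ζ : ℝ => (t, ζ)) (by fun_prop))).intervalIntegrable _ _
    simp only [hs hf, hs hf']
    refine HasDerivAt.fun_sum fun j _ => ?_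
    have h := hasDerivAt_integral_moving (P := fun _ ζ => M ζ j) (X := fun t ζ => f t ζ j)
      (X' := fun t ζ => f' t ζ j) (F := fun _ => 0) (a := fun _ => 0) (b := fun _ => b) (C := 0)
      (r₀ := t) ((hM j).comp continuous_snd) (hf j) (hf' j) (fun t ζ => hd t ζ j)
      (fun u r r' => by simp) measurable_const
      (Eventually.of_forall fun u => hasDerivAt_const _ _) (hasDerivAt_const _ _)
      (hasDerivAt_const _ _)
    simpa using h
  exact (key (M := fun ζ j => κ.U (z, ζ) i j)
      (fun j => (κ.contU.matrix_elem i j).comp (by fun_prop)) z).add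
    (key (M := fun ζ j => κ.D (z, ζ) i j)
      (fun j => (κ.contD.matrix_elem i j).comp (by fun_prop)) (s.cut z))

/-- Differentiation in time commutes with the integral operator. -/
lemma hasDerivWithinAt_integral_strip {f f' : ℝ → ℝ → Idx → ℝ}
    (hf : ContinuousOn (Function.uncurry f) strip) (hf' : ContinuousOn (Function.uncurry f') strip)
    (hd : ∀ z ∈ Icc (0 : ℝ) 1, ∀ t ∈ Ici (0 : ℝ), ∀ j,
      HasDerivWithinAt (fun t => f z t j) (f' z t j) (Ici 0) t) (i : Idx) {z : ℝ}
    (hz : z ∈ Icc (0 : ℝ) 1) {t : ℝ} (ht : t ∈ Ici (0 : ℝ)) :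
    HasDerivWithinAt (fun t => ∫ ζ in (0 : ℝ)..z, Matrix.mulVec (κ.ker z ζ) (f ζ t) i)
      (∫ ζ in (0 : ℝ)..z, Matrix.mulVec (κ.ker z ζ) (f' ζ t) i) (Ici 0) t := by
  have c' := fun j => (continuous_strip_apply hf' j).comp (f := fun p : ℝ × ℝ => (p.2, p.1))
    (by fun_prop)
  let F : ℝ → ℝ → Idx → ℝ := fun t ζ j =>
    f (clamp ζ) 0 j + ∫ τ in (0 : ℝ)..t, f' (clamp ζ) (max τ 0) j
  have cF : ∀ j, Continuous fun p : ℝ × ℝ => F p.1 p.2 j := by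
    intro j
    have h1 := (continuous_strip_apply hf j).comp (f := fun p : ℝ × ℝ => (p.2, (0 : ℝ)))
      (by fun_prop)
    simp only [Function.comp_def, max_self] at h1
    refine h1.add ?_
    exact intervalIntegral.continuous_parametric_intervalIntegral_of_continuous
      (f := fun (p : ℝ × ℝ) τ => f' (clamp p.2) (max τ 0) j)
      ((continuous_strip_apply hf' j).comp (f := fun q : (ℝ × ℝ) × ℝ => (q.1.2, q.2))
        (by fun_prop)) continuous_fst
  have dF : ∀ t ζ j, HasDerivAt (fun t => F t ζ j) (f' (clamp ζ) (max t 0) j) t := fun t ζ j =>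
    (((continuous_strip_apply hf' j).comp (f := fun τ : ℝ => (ζ, τ))
      (by fun_prop)).integral_hasStrictDerivAt 0 t).hasDerivAt.const_add _
  have eF : ∀ t ∈ Ici (0 : ℝ), ∀ ζ ∈ Icc (0 : ℝ) 1, f ζ t = F t ζ := by
    intro t ht ζ hζ
    funext j
    simp only [F]
    rw [clamp_of_mem hζ]
    have := intervalIntegral.integral_eq_sub_of_hasDeriv_right_of_le (mem_Ici.1 ht)
      (f := fun t => f ζ t j) (f' := fun τ => f' (clamp ζ) (max τ 0) j)
      (fun τ hτ => (hd ζ hζ τ hτ.1 j).continuousWithinAt.mono Icc_subset_Ici_self)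
      (fun τ hτ => by
        rw [clamp_of_mem hζ, max_eq_left hτ.1.le]
        exact (hd ζ hζ τ hτ.1.le j).mono (Ioi_subset_Ici hτ.1.le))
      (((continuous_strip_apply hf' j).comp (f := fun τ : ℝ => (ζ, τ))
        (by fun_prop)).intervalIntegrable _ _)
    rw [clamp_of_mem hζ] at this
    rw [this]
    ring
  have key : ∀ t ∈ Ici (0 : ℝ), ∫ ζ in (0 : ℝ)..z, Matrix.mulVec (κ.ker z ζ) (f ζ t) i =
      κ.vint (F t) z i := by
    intro t ht
    rw [← κ.integral_ker_mulVec (f := F t) (fun j => (cF j).comp (f := fun ζ : ℝ => (t, ζ))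
      (by fun_prop)) hz.1]
    exact integral_congr_clamp (f := fun ζ => f ζ t) (fun ζ hζ => eF t ht ζ hζ) hz i
  refine (((κ.hasDerivAt_vint cF c' dF z i t).hasDerivWithinAt).congr key
    (key t ht)).congr_deriv ?_
  rw [← κ.integral_ker_mulVec (f := fun ζ => f' (clamp ζ) (max t 0)) (fun j => (c' j).comp (f := fun ζ : ℝ => (t, ζ))
      (by fun_prop)) hz.1]
  refine (integral_congr_clamp (f := fun ζ => f' ζ t) (fun ζ hζ => ?_) hz i).symm
  funext j
  rw [clamp_of_mem hζ, max_eq_left (mem_Ici.1 ht)]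

end PCKernel

namespace Coeffs

variable {c : Coeffs} {lam : Fin 2 → ℝ → ℝ} {A : ℝ → Matrix Idx Idx ℝ}

lemma hasDerivWithinAt_volterra_of_Icc (c : Coeffs) {x x' : ℝ → Idx → ℝ}
    (hx : ∀ j, ∀ z ∈ Icc (0 : ℝ) 1, HasDerivWithinAt (fun z => x z j) (x' z j) (Icc 0 1) z)
    (hx' : ContinuousOn x' (Icc 0 1)) (h0 : ∀ k, x 0 (Sum.inr k) = -x 0 (Sum.inl k)) (i : Idx)
    {z : ℝ} (hz : z ∈ Icc (0 : ℝ) 1) :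
    HasDerivWithinAt (fun z => volterra c.K x z i)
      ((volterra c.K (c.beamOp x x') z i - c.alpha i z * x 0 (Sum.inl 0)) / c.v i z)
      (Icc 0 1) z := by
  have c' := PCKernel.continuous_clamp_apply hx'
  let X : ℝ → Idx → ℝ := fun z j => x 0 j + ∫ ζ in (0 : ℝ)..z, x' (clamp ζ) j
  have hX : ∀ j z, HasDerivAt (fun z => X z j) (x' (clamp z) j) z := fun j z =>
    ((c' j).integral_hasStrictDerivAt 0 z).hasDerivAt.const_add _
  have h00 : X 0 = x 0 := by
    funext j
    simp [X]
  have hE : EqOn x X (Icc 0 1) := by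
    intro z hz
    funext j
    refine eq_of_has_deriv_right_eq (a := 0) (b := 1) (f' := fun w => x' w j)
      (fun w hw => (hx j w (Ico_subset_Icc_self hw)).mono_of_mem_nhdsWithin
        (Icc_mem_nhdsGE_of_mem hw))
      (fun w hw => ?_) (fun w hw => (hx j w hw).continuousWithinAt)
      (fun w hw => (hX j w).continuousAt.continuousWithinAt) (congrFun h00 j).symm z hz
    have := (hX j w).hasDerivWithinAt (s := Ici w)
    rwa [clamp_of_mem (Ico_subset_Icc_self hw)] at this
  have hV := PCKernel.volterra_congr (K := c.K) hE
  refine ((c.hasDerivWithinAt_volterra hX c' (by rw [h00]; exact h0) i hz).congr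
    (fun w hw => congrFun (hV hw) i) (congrFun (hV hz) i)).congr_deriv ?_
  rw [h00]
  have hop : EqOn (c.beamOp x x') (c.beamOp X fun z => x' (clamp z)) (Icc 0 1) := by
    intro w hw
    funext j
    simp only [beamOp]
    rw [← hE hw, clamp_of_mem hw]
  rw [PCKernel.volterra_congr hop hz]

end Coeffs

namespace Coeffs

variable {c : Coeffs} {lam : Fin 2 → ℝ → ℝ} {A : ℝ → Matrix Idx Idx ℝ}

lemma unfold_zero (y : ℝ → Idx → ℝ) (k : Fin 2) : c.unfold y k 0 = y 1 (Sum.inr k) := by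
  rw [unfold, if_pos (c.T_pos k), sub_zero, T, c.s.Psi_Phi]

lemma unfold_T (y : ℝ → Idx → ℝ) (k : Fin 2) : c.unfold y k (c.T k) = -y 0 (Sum.inl k) := by
  rw [unfold, if_neg (lt_irrefl _), sub_self]
  nth_rewrite 1 [← c.s.Phi_zero k]
  rw [c.s.Psi_Phi]

lemma unfold_end (y : ℝ → Idx → ℝ) (k : Fin 2) :
    c.unfold y k (2 * c.T k) = -y 1 (Sum.inl k) := by
  rw [unfold, if_neg (by linarith [c.T_pos k]), two_mul, add_sub_cancel_right, T, c.s.Psi_Phi]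

/-! ### The target system -/

/-- `y`, with time derivative `yt`, is a classical solution of the target system
`∂ₜ yᵢ = λ̃ᵢ ∂_z yᵢ + αᵢ y₁⁻(0)`, `y⁺(0) = -y⁻(0)`. -/
structure IsTarget (c : Coeffs) (y yt : ℝ → ℝ → Idx → ℝ) : Prop where
  cont : ContinuousOn (Function.uncurry y) strip
  cont_deriv : ContinuousOn (Function.uncurry yt) strip
  deriv_time : ∀ z ∈ Icc (0 : ℝ) 1, ∀ t ∈ Ici (0 : ℝ), ∀ i,
    HasDerivWithinAt (fun t => y z t i) (yt z t i) (Ici 0) t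
  deriv_space : ∀ z ∈ Icc (0 : ℝ) 1, ∀ t ∈ Ici (0 : ℝ), ∀ i,
    HasDerivWithinAt (fun z => y z t i)
      ((yt z t i - c.alpha i z * y 0 t (Sum.inl 0)) / c.v i z) (Icc 0 1) z
  bc_zero : ∀ t ∈ Ici (0 : ℝ), ∀ k, y 0 t (Sum.inr k) = -y 0 t (Sum.inl k)

lemma continuousOn_volterra_strip (c : Coeffs) {f : ℝ → ℝ → Idx → ℝ}
    (hf : ContinuousOn (Function.uncurry f) strip) :
    ContinuousOn (Function.uncurry fun z t => volterra c.K (fun ζ => f ζ t) z) strip := by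
  refine continuousOn_pi.2 fun i => ?_
  refine (((continuous_apply i).comp_continuousOn hf).sub
    (c.pc.continuousOn_integral_strip hf i)).congr fun p hp => ?_
  exact congrFun (c.volterra_eq (fun ζ => f ζ p.2) hp.1) i

lemma hasDerivWithinAt_volterra_time (c : Coeffs) {f f' : ℝ → ℝ → Idx → ℝ}
    (hf : ContinuousOn (Function.uncurry f) strip) (hf' : ContinuousOn (Function.uncurry f') strip)
    (hd : ∀ z ∈ Icc (0 : ℝ) 1, ∀ t ∈ Ici (0 : ℝ), ∀ j,
      HasDerivWithinAt (fun t => f z t j) (f' z t j) (Ici 0) t) {z : ℝ}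
    (hz : z ∈ Icc (0 : ℝ) 1) {t : ℝ} (ht : t ∈ Ici (0 : ℝ)) (i : Idx) :
    HasDerivWithinAt (fun t => volterra c.K (fun ζ => f ζ t) z i)
      (volterra c.K (fun ζ => f' ζ t) z i) (Ici 0) t := by
  have e := fun g : ℝ → Idx → ℝ => congrFun (c.volterra_eq g hz) i
  simp only [e]
  exact (hd z hz t ht i).sub (c.pc.hasDerivWithinAt_integral_strip hf hf' hd i hz ht)

/-- The Volterra transformation maps classical solutions of the beam system to classical solutions
of the target system. -/
theorem Extends.isTarget_volterra (h : c.Extends lam A) {B : Matrix (Fin 2) (Fin 2) ℝ}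
    {x : ℝ → ℝ → Idx → ℝ} {u : ℝ → Fin 2 → ℝ} (hx : IsBeamSolution lam A B x u) :
    ∃ yt, c.IsTarget (fun z t => volterra c.K (fun ζ => x ζ t) z) yt := by
  have uI : UniqueDiffOn ℝ (Icc (0 : ℝ) 1) := uniqueDiffOn_Icc zero_lt_one
  have uJ : UniqueDiffOn ℝ (Ici (0 : ℝ)) := uniqueDiffOn_Ici 0
  obtain ⟨xz, xt, cz, ct, dz, dt⟩ := exists_partial_of_contDiffOn uI uJ hx.smooth
  have cx : ContinuousOn (Function.uncurry x) strip := hx.smooth.continuousOn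
  have dt' := fun z hz t ht => hasDerivWithinAt_pi.1 (dt z hz t ht)
  have dz' := fun z hz t ht => hasDerivWithinAt_pi.1 (dz z hz t ht)
  have cslice : ∀ {f : ℝ → ℝ → Idx → ℝ}, ContinuousOn (Function.uncurry f) strip →
      ∀ t ∈ Ici (0 : ℝ), ContinuousOn (fun z => f z t) (Icc 0 1) := fun hf t ht =>
    hf.comp (f := fun z : ℝ => (z, t)) (by fun_prop) fun z hz => ⟨hz, ht⟩
  have op : ∀ t ∈ Ici (0 : ℝ), EqOn (c.beamOp (fun z => x z t) fun z => xz z t)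
      (fun z => xt z t) (Icc 0 1) := by
    intro t ht z hz
    funext i
    have hp := congrFun (hx.pde z hz t ht) i
    rw [(dt z hz t ht).derivWithin (uJ t ht), (dz z hz t ht).derivWithin (uI z hz)] at hp
    change c.beamOp (fun z => x z t) (fun z => xz z t) z i = xt z t i
    rw [hp, Pi.add_apply, LamT, Matrix.mulVec_diagonal, h.speed_eq i hz, h.A_eq z hz, beamOp]
  refine ⟨fun z t => volterra c.K (fun ζ => xt ζ t) z, c.continuousOn_volterra_strip cx,
    c.continuousOn_volterra_strip ct, fun z hz t ht i => ?_, fun z hz t ht i => ?_,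
    fun t ht k => ?_⟩
  · exact c.hasDerivWithinAt_volterra_time cx ct dt' hz ht i
  · refine (c.hasDerivWithinAt_volterra_of_Icc (x := fun z => x z t) (x' := fun z => xz z t)
      (fun j z hz => dz' z hz t ht j) (cslice cz t ht) (hx.bc_zero t ht) i hz).congr_deriv ?_
    rw [PCKernel.volterra_congr (op t ht) hz, volterra_zero]
  · simp only [volterra_zero]
    exact hx.bc_zero t ht k

namespace IsTarget

variable {y yt : ℝ → ℝ → Idx → ℝ}

lemma hasFDerivWithinAt (hy : c.IsTarget y yt) (i : Idx) {p : ℝ × ℝ} (hp : p ∈ strip) :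
    HasFDerivWithinAt (fun p : ℝ × ℝ => y p.1 p.2 i)
      (((yt p.1 p.2 i - c.alpha i p.1 * y 0 p.2 (Sum.inl 0)) / c.v i p.1) •
        ContinuousLinearMap.fst ℝ ℝ ℝ + yt p.1 p.2 i • ContinuousLinearMap.snd ℝ ℝ ℝ)
      strip p := by
  have ci : ContinuousOn (fun p : ℝ × ℝ => yt p.1 p.2 i) strip :=
    (continuous_apply i).comp_continuousOn hy.cont_deriv
  have c0 : ContinuousOn (fun p : ℝ × ℝ => y 0 p.2 (Sum.inl 0)) strip :=
    (continuous_apply (Sum.inl 0 : Idx)).comp_continuousOn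
      (hy.cont.comp (f := fun p : ℝ × ℝ => ((0 : ℝ), p.2)) (by fun_prop)
        fun p hp => ⟨by simp, hp.2⟩)
  refine hasFDerivWithinAt_of_partial (f := fun z t => y z t i)
    (fx := fun z t => (yt z t i - c.alpha i z * y 0 t (Sum.inl 0)) / c.v i z)
    (fy := fun z t => yt z t i) (convex_Icc 0 1)
    (convex_Ici 0) (fun z hz t ht => hy.deriv_space z hz t ht i)
    (fun z hz t ht => hy.deriv_time z hz t ht i) ?_ ci hp
  exact (ci.sub (((c.continuous_alpha i).comp continuous_fst).continuousOn.mul c0)).div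
    ((c.continuous_v i).comp continuous_fst).continuousOn fun p _ => c.v_ne_zero i p.1

lemma slice_mem (hy : c.IsTarget y yt) {t : ℝ} (ht : t ∈ Ici (0 : ℝ)) : (fun z => y z t) ∈ beamStates :=
  ⟨hy.cont.comp (f := fun z : ℝ => (z, t)) (by fun_prop) fun z hz => ⟨hz, ht⟩, hy.bc_zero t ht⟩

/-- The state is followed along a characteristic that runs backwards in `r` while time advances; the
boundary condition at `z = 0` makes it continuous at the reflection. -/
lemma continuousOn_unfold_char (hy : c.IsTarget y yt) (k : Fin 2) {t r : ℝ} (ht : 0 ≤ t)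
    (hr : r ∈ Icc 0 (2 * c.T k)) :
    ContinuousOn (fun θ => c.unfold (fun z => y z (t + θ)) k (r - θ)) (Icc 0 r) := by
  have h := continuous_strip_apply hy.cont
  have hΨ := c.s.continuous_Psi k
  have hP : c.s.Psi k 0 = 0 := by rw [← c.s.Phi_zero k, c.s.Psi_Phi, c.s.Phi_zero]
  have h1 := (h (Sum.inr k)).comp
    (f := fun θ => (c.s.Psi k (max (c.T k - (r - θ)) 0), t + θ))
    ((hΨ.comp (by fun_prop)).prodMk (by fun_prop))
  have h2 := (h (Sum.inl k)).comp
    (f := fun θ => (c.s.Psi k (max ((r - θ) - c.T k) 0), t + θ))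
    ((hΨ.comp (by fun_prop)).prodMk (by fun_prop))
  have h3 := (h (Sum.inl k)).comp (f := fun θ => ((0 : ℝ), t + θ)) (by fun_prop)
  refine ((h1.sub h2).add h3).continuousOn.congr fun θ hθ => ?_
  have hm : max (t + θ) 0 = t + θ := max_eq_left (by linarith [hθ.1])
  change _ = y (clamp (c.s.Psi k (max (c.T k - (r - θ)) 0))) (max (t + θ) 0) (Sum.inr k) -
    y (clamp (c.s.Psi k (max ((r - θ) - c.T k) 0))) (max (t + θ) 0) (Sum.inl k) +
    y (clamp 0) (max (t + θ) 0) (Sum.inl k)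
  rw [hm, clamp_zero]
  simp only [unfold]
  split_ifs with hlt
  · rw [max_eq_left (by linarith), max_eq_right (a := r - θ - c.T k) (by linarith), hP, clamp_zero,
      clamp_of_mem (c.Psi_mem k ⟨by linarith, by linarith [hθ.2]⟩)]
    ring
  · rw [not_lt] at hlt
    rw [max_eq_right (by linarith), max_eq_left (a := r - θ - c.T k) (by linarith), hP, clamp_zero,
      clamp_of_mem (c.Psi_mem k ⟨by linarith, by linarith [hθ.1, hr.2]⟩),
      hy.bc_zero _ (mem_Ici.2 (by linarith [hθ.1]))]
    ring

/-- Along the characteristic only the coupling to `y₁⁻(0)` changes the unfolded state. The reflection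
at `z = 0` is excluded: the coupling may jump there. -/
lemma hasDerivAt_unfold_char (hy : c.IsTarget y yt) (k : Fin 2) {t r θ : ℝ} (ht : 0 ≤ t)
    (hr : r ∈ Icc 0 (2 * c.T k))
    (hθ : θ ∈ Ioo 0 r) (hne : r - θ ≠ c.T k) :
    HasDerivAt (fun θ => c.unfold (fun z => y z (t + θ)) k (r - θ))
      (-(c.coup k (r - θ) * y 0 (t + θ) (Sum.inl 0))) θ := by
  have hL : ∀ z, c.s.L k z ≠ 0 := c.s.L_ne k
  have ht' : HasDerivAt (fun θ : ℝ => t + θ) 1 θ := (hasDerivAt_id θ).const_add t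
  rcases lt_or_gt_of_ne hne with hlt | hlt
  · have hz : HasDerivAt (fun θ => c.s.Psi k (c.T k - (r - θ)))
        (c.s.L k (c.s.Psi k (c.T k - (r - θ))) * 1) θ :=
      (c.s.hasDerivAt_Psi k _).comp θ (h := fun θ => c.T k - (r - θ)) (by
        simpa using ((hasDerivAt_id θ).const_sub r).const_sub (c.T k))
    have hmem : ∀ θ', θ' ∈ Ioo 0 r → r - θ' < c.T k →
        c.s.Psi k (c.T k - (r - θ')) ∈ Icc (0 : ℝ) 1 := fun θ' h1 h2 =>
      c.Psi_mem k ⟨by linarith, by linarith [h1.2]⟩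
    have hnear : ∀ᶠ θ' in 𝓝 θ, θ' ∈ Ioo 0 r ∧ r - θ' < c.T k := by
      filter_upwards [Ioo_mem_nhds hθ.1 hθ.2, Ioi_mem_nhds (show r - c.T k < θ by linarith)]
        with θ' h1 h2
      exact ⟨h1, by linarith [mem_Ioi.1 h2]⟩
    have hd := (hy.hasFDerivWithinAt (Sum.inr k)
      (p := (c.s.Psi k (c.T k - (r - θ)), t + θ))
      ⟨hmem θ hθ hlt, mem_Ici.2 (by linarith [hθ.1])⟩).comp_hasDerivAt θ
      (hz.prodMk ht') (by
        filter_upwards [hnear] with θ' h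
        exact ⟨hmem θ' h.1 h.2, mem_Ici.2 (by linarith [h.1.1])⟩)
    refine (hd.congr_of_eventuallyEq ?_).congr_deriv ?_
    · filter_upwards [hnear] with θ' h
      simp only [unfold, if_pos h.2]
      rfl
    · rw [coup, if_pos hlt, coupPlus, clamp_of_mem (hmem θ hθ hlt)]
      simp only [add_apply, smul_apply,
        ContinuousLinearMap.coe_fst', ContinuousLinearMap.coe_snd', smul_eq_mul, v, sgn_inr,
        proc_inr]
      have := hL (c.s.Psi k (c.T k - (r - θ)))
      field_simp
      ring
  · have hz : HasDerivAt (fun θ => c.s.Psi k ((r - θ) - c.T k))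
        (c.s.L k (c.s.Psi k ((r - θ) - c.T k)) * (-1)) θ :=
      (c.s.hasDerivAt_Psi k _).comp θ (h := fun θ => (r - θ) - c.T k) (by
        simpa using ((hasDerivAt_id θ).const_sub r).sub_const (c.T k))
    have hmem : ∀ θ', θ' ∈ Ioo 0 r → c.T k < r - θ' →
        c.s.Psi k ((r - θ') - c.T k) ∈ Icc (0 : ℝ) 1 := fun θ' h1 h2 =>
      c.Psi_mem k ⟨by linarith, by linarith [h1.1, hr.2]⟩
    have hnear : ∀ᶠ θ' in 𝓝 θ, θ' ∈ Ioo 0 r ∧ c.T k < r - θ' := by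
      filter_upwards [Ioo_mem_nhds hθ.1 hθ.2, Iio_mem_nhds (show θ < r - c.T k by linarith)]
        with θ' h1 h2
      exact ⟨h1, by linarith [mem_Iio.1 h2]⟩
    have hd := ((hy.hasFDerivWithinAt (Sum.inl k)
      (p := (c.s.Psi k ((r - θ) - c.T k), t + θ))
      ⟨hmem θ hθ hlt, mem_Ici.2 (by linarith [hθ.1])⟩).comp_hasDerivAt θ
      (hz.prodMk ht') (by
        filter_upwards [hnear] with θ' h
        exact ⟨hmem θ' h.1 h.2, mem_Ici.2 (by linarith [h.1.1])⟩)).neg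
    refine (hd.congr_of_eventuallyEq ?_).congr_deriv ?_
    · filter_upwards [hnear] with θ' h
      simp only [unfold, if_neg (not_lt.2 h.2.le)]
      rfl
    · rw [coup, if_neg (not_lt.2 hlt.le), coupMinus, clamp_of_mem (hmem θ hθ hlt)]
      simp only [add_apply, smul_apply,
        ContinuousLinearMap.coe_fst', ContinuousLinearMap.coe_snd', smul_eq_mul, v, sgn_inl,
        proc_inl]
      have := hL (c.s.Psi k ((r - θ) - c.T k))
      field_simp
      ring

end IsTarget

end Coeffs

namespace Coeffs

variable {c : Coeffs} {lam : Fin 2 → ℝ → ℝ} {A : ℝ → Matrix Idx Idx ℝ}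

lemma conv_eq (c : Coeffs) (k : Fin 2) (w : ℝ → ℝ) (r : ℝ) :
    c.conv k w r = ∫ θ in (0 : ℝ)..r, c.coup k (r - θ) * w (c.T 0 + θ) := by
  have h := intervalIntegral.integral_comp_add_left (a := 0) (b := r)
    (fun σ => c.coup k (c.T 0 + r - σ) * w σ) (c.T 0)
  rw [add_zero] at h
  rw [conv, ← h]
  simp only [add_sub_add_left_eq_sub]

/-- The convolution at the end of the travel time interval, in the form in which it occurs in the
boundary condition of the controller form. -/
lemma Extends.conv_end (h : c.Extends lam A) {e v w : ℝ → ℝ} (hw : c.IsSignal e v w) :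
    c.conv 1 w (2 * c.T 1) =
      (∫ σ in (c.T 0)..(2 * c.T 0),
        abar lam (c.alpha (Sum.inl 1)) (c.T 0 + c.T 1 - σ) * e σ) -
      ∫ σ in (0 : ℝ)..(c.T 1 - c.T 0 + c.T 1),
        atilde lam (c.alpha (Sum.inl 1)) (fun z => -c.alpha (Sum.inr 1) z) σ * v σ := by
  have h0 := c.T_pos 0
  have h1 := c.T_lt
  have e1 : (0 : ℝ) = 2 * c.T 0 - 2 * c.T 0 := by ring
  have e2 : c.T 1 - c.T 0 + c.T 1 = c.T 0 + 2 * c.T 1 - 2 * c.T 0 := by ring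
  rw [e2]
  nth_rewrite 1 [e1]
  rw [← intervalIntegral.integral_comp_sub_right (fun σ =>
      atilde lam (c.alpha (Sum.inl 1)) (fun z => -c.alpha (Sum.inr 1) z) σ * v σ),
    sub_eq_add_neg, ← intervalIntegral.integral_neg, conv,
    ← intervalIntegral.integral_add_adjacent_intervals (b := 2 * c.T 0)
      (c.intervalIntegrable_coup_mul 1 (hw.mono_integrable ⟨le_rfl, by linarith⟩
        ⟨by linarith, by linarith⟩) _)
      (c.intervalIntegrable_coup_mul 1 (hw.mono_integrable ⟨by linarith, by linarith⟩
        ⟨by linarith, le_rfl⟩) _)]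
  congr 1
  · refine intervalIntegral.integral_congr_Ioo_of_le (by linarith) fun σ hσ => ?_
    simp only [mem_Ioo] at hσ
    rw [h.abar_minus ⟨by linarith, by linarith⟩, coup, if_neg (by linarith), hw.eq_state σ hσ]
    congr 2
    ring
  · -- `ã₀` takes the sum of both branches at `Δτ`
    have hs : ({c.T 0 + c.T 1} : Set ℝ).Subsingleton := subsingleton_singleton
    refine intervalIntegral.integral_congr_ae ?_
    filter_upwards [compl_mem_ae_iff.2 (hs.measure_zero volume),
      compl_mem_ae_iff.2 ((subsingleton_singleton (a := c.T 0 + 2 * c.T 1)).measure_zero volume)]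
      with σ hne hne2 hσ
    rw [uIoc_of_le (by linarith)] at hσ
    have hlt := lt_of_le_of_ne hσ.2 hne2
    rw [hw.eq_input σ ⟨hσ.1, hlt⟩, mul_neg]
    congr 2
    rw [atilde, h.dtau_eq, coup, heaviside, heaviside]
    rcases lt_or_gt_of_ne (show σ ≠ c.T 0 + c.T 1 from hne) with hl | hl
    · rw [if_neg (by linarith), if_pos (by linarith), if_neg (by linarith), mul_one, mul_zero,
        add_zero, h.abar_minus ⟨by linarith, by linarith [hσ.1]⟩]
      congr 1
      ring
    · rw [if_pos (by linarith), if_neg (by linarith), if_pos (by linarith), mul_one, mul_zero,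
        zero_add, h.abar_plus ⟨by linarith, by linarith [hσ.1]⟩]
      congr 1
      ring

namespace IsTarget

variable {y yt : ℝ → ℝ → Idx → ℝ}

/-- Integration along the characteristics expresses the state through the predictions of the
output `y⁺(1)`. -/
lemma unfold_eq_sub_conv (hy : c.IsTarget y yt) (k : Fin 2) {t r : ℝ} (ht : 0 ≤ t)
    (hr : r ∈ Icc 0 (2 * c.T k)) :
    c.unfold (fun z => y z t) k r =
      y 1 (t + r) (Sum.inr k) - c.conv k (fun σ => y 1 (t + σ) (Sum.inr 0)) r := by
  have key : ∀ (k : Fin 2) {t r : ℝ}, 0 ≤ t → r ∈ Icc 0 (2 * c.T k) →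
      ∫ θ in (0 : ℝ)..r, -(c.coup k (r - θ) * y 0 (t + θ) (Sum.inl 0)) =
        y 1 (t + r) (Sum.inr k) - c.unfold (fun z => y z t) k r := by
    intro k t r ht hr
    have h := MeasureTheory.integral_eq_of_hasDerivAt_off_countable_of_le
      (fun θ => c.unfold (fun z => y z (t + θ)) k (r - θ)) _ hr.1
      (countable_singleton (r - c.T k)) (hy.continuousOn_unfold_char k ht hr)
      (fun θ hθ => hy.hasDerivAt_unfold_char k ht hr hθ.1 fun he => hθ.2 (by
        rw [mem_singleton_iff]
        linarith)) (IntervalIntegrable.neg (c.intervalIntegrable_coup_mul k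
          (w := fun θ => y 0 (t + θ) (Sum.inl 0)) (ContinuousOn.intervalIntegrable ?_) r))
    · rw [h, sub_self, unfold_zero, sub_zero, add_zero]
    · rw [uIcc_of_le hr.1]
      exact (continuous_apply (Sum.inl 0 : Idx)).comp_continuousOn
        (hy.cont.comp (f := fun θ : ℝ => ((0 : ℝ), t + θ)) (by fun_prop)
          fun θ hθ => ⟨by simp, mem_Ici.2 (by linarith [hθ.1])⟩)
  -- the fast process is a pure delay, so that `-y₁⁻(0,t)` is the first output at time `t + τ₁`
  have h0 : ∀ {t r : ℝ}, 0 ≤ t → r ∈ Icc 0 (2 * c.T 0) →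
      c.unfold (fun z => y z t) 0 r = y 1 (t + r) (Sum.inr 0) := by
    intro t r ht hr
    have := key 0 ht hr
    simp only [coup_fast, zero_mul, neg_zero, intervalIntegral.integral_zero] at this
    linarith
  have h1 := key k ht hr
  have e : ∫ θ in (0 : ℝ)..r, -(c.coup k (r - θ) * y 0 (t + θ) (Sum.inl 0)) =
      c.conv k (fun σ => y 1 (t + σ) (Sum.inr 0)) r := by
    rw [conv_eq]
    refine intervalIntegral.integral_congr fun θ hθ => ?_
    rw [uIcc_of_le hr.1] at hθ
    have h2 := h0 (t := t + θ) (r := c.T 0) (by linarith [hθ.1])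
      ⟨(c.T_pos 0).le, by linarith [c.T_pos 0]⟩
    rw [unfold_T] at h2
    rw [show t + (c.T 0 + θ) = t + θ + c.T 0 by ring, ← h2]
    ring
  rw [← e, h1]
  ring

lemma hasDerivWithinAt_output (hy : c.IsTarget y yt) (i : Idx) {t : ℝ} (ht : t ∈ Ici (0 : ℝ)) :
    HasDerivWithinAt (fun t => y 1 t i) (yt 1 t i) (Ici 0) t :=
  hy.deriv_time 1 (by simp) t ht i

lemma continuousOn_output (hy : c.IsTarget y yt) (i : Idx) :
    ContinuousOn (fun t => y 1 t i) (Ici 0) := fun _ ht =>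
  (hy.hasDerivWithinAt_output i ht).continuousWithinAt

lemma continuousOn_output_deriv (hy : c.IsTarget y yt) (i : Idx) :
    ContinuousOn (fun t => yt 1 t i) (Ici 0) :=
  (continuous_apply i).comp_continuousOn (hy.cont_deriv.comp (f := fun t : ℝ => ((1 : ℝ), t))
    (by fun_prop) fun t ht => ⟨by simp, ht⟩)

/-- The first component of the output is a signal in the sense of `IsSignal`, since the fast process
is a pure delay. -/
lemma isSignal_output (hy : c.IsTarget y yt) {t : ℝ} (ht : 0 ≤ t) :
    c.IsSignal (c.unfold (fun z => y z t) 0) (fun s => y 1 (t + s) (Sum.inl 0))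
      fun σ => y 1 (t + σ) (Sum.inr 0) where
  eq_state σ hσ := by
    rw [hy.unfold_eq_sub_conv 0 ht ⟨by linarith [hσ.1, c.T_pos 0], hσ.2.le⟩, conv_fast, sub_zero]
  eq_input σ hσ := by
    have h := hy.unfold_eq_sub_conv 0 (t := t + (σ - 2 * c.T 0)) (r := 2 * c.T 0)
      (by linarith [hσ.1]) ⟨by linarith [c.T_pos 0], le_rfl⟩
    rw [unfold_end, conv_fast, sub_zero, add_assoc, sub_add_cancel] at h
    exact h.symm
  integrable := by
    refine ContinuousOn.intervalIntegrable ?_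
    rw [uIcc_of_le (by linarith [c.T_pos 1])]
    exact (hy.continuousOn_output (Sum.inr 0)).comp (f := fun σ => t + σ) (by fun_prop)
      fun σ hσ => mem_Ici.2 (by linarith [hσ.1, c.T_pos 0])

/-- The state of the controller form consists of the predictions of the flat output: the convolution
that is added by the transformation is the one that `unfold_eq_sub_conv` subtracts. -/
lemma etaOfBar_eq_output (hy : c.IsTarget y yt) (h : c.Extends lam A) {t : ℝ} (ht : 0 ≤ t)
    (k : Fin 2) {r : ℝ} (hr : r ∈ Icc 0 (2 * c.T k)) :
    etaOfBar lam (c.alpha (Sum.inl 1)) (fun z => -c.alpha (Sum.inr 1) z)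
      (fun s => y 1 (t + s) (Sum.inl 0)) (fun z => y z t) k r = y 1 (t + r) (Sum.inr k) := by
  rw [h.etaOfBar_eq (hy.isSignal_output ht) k hr, hy.unfold_eq_sub_conv k ht hr]
  ring

end IsTarget

end Coeffs

/-! ### From the beam system to the controller form -/

section Shift

variable {Y Y' : ℝ → ℝ}

lemma hasDerivWithinAt_shift_time (hd : ∀ t ∈ Ici (0 : ℝ), HasDerivWithinAt Y (Y' t) (Ici 0) t)
    {σ t : ℝ} (hσ : 0 ≤ σ) (ht : t ∈ Ici (0 : ℝ)) :
    HasDerivWithinAt (fun t => Y (t + σ)) (Y' (t + σ)) (Ici 0) t := by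
  have := (hd (t + σ) (mem_Ici.2 (add_nonneg ht hσ))).comp t (h := fun t => t + σ)
    ((hasDerivWithinAt_id t (Ici 0)).add_const σ) fun s hs => mem_Ici.2 (add_nonneg hs hσ)
  rwa [mul_one] at this

lemma hasDerivWithinAt_shift_delay (hd : ∀ t ∈ Ici (0 : ℝ), HasDerivWithinAt Y (Y' t) (Ici 0) t)
    {σ t T : ℝ} (hσ : σ ∈ Icc 0 T) (ht : t ∈ Ici (0 : ℝ)) :
    HasDerivWithinAt (fun σ => Y (t + σ)) (Y' (t + σ)) (Icc 0 T) σ := by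
  have := (hd (t + σ) (mem_Ici.2 (add_nonneg ht hσ.1))).comp σ (h := fun σ => t + σ)
    ((hasDerivWithinAt_id σ (Icc 0 T)).const_add t) fun s hs => mem_Ici.2 (add_nonneg ht hs.1)
  rwa [mul_one] at this

lemma contDiffOn_shift (hd : ∀ t ∈ Ici (0 : ℝ), HasDerivWithinAt Y (Y' t) (Ici 0) t)
    (hc : ContinuousOn Y' (Ici 0)) {T : ℝ} (hT : 0 < T) :
    ContDiffOn ℝ 1 (fun p : ℝ × ℝ => Y (p.2 + p.1)) (Icc 0 T ×ˢ Ici 0) := by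
  have hc' : ContinuousOn (Function.uncurry fun σ t : ℝ => Y' (t + σ)) (Icc 0 T ×ˢ Ici 0) :=
    hc.comp (f := fun p : ℝ × ℝ => p.2 + p.1) (by fun_prop)
      fun p hp => mem_Ici.2 (add_nonneg hp.2 hp.1.1)
  exact contDiffOn_one_of_partial (f := fun σ t => Y (t + σ)) (convex_Icc 0 T) (convex_Ici 0)
    (uniqueDiffOn_Icc hT) (uniqueDiffOn_Ici 0)
    (fun σ hσ t ht => hasDerivWithinAt_shift_delay hd hσ ht)
    (fun σ hσ t ht => hasDerivWithinAt_shift_time hd hσ.1 ht) hc' hc'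

end Shift

namespace Coeffs

variable {c : Coeffs} {lam : Fin 2 → ℝ → ℝ} {A : ℝ → Matrix Idx Idx ℝ}

lemma mulVec_inl (M : Matrix Idx Idx ℝ) (x : Idx → ℝ) (k : Fin 2) :
    Matrix.mulVec M.toBlocks₁₁ (fun l => x (Sum.inl l)) k +
      Matrix.mulVec M.toBlocks₁₂ (fun l => x (Sum.inr l)) k = Matrix.mulVec M x (Sum.inl k) := by
  simp only [Matrix.mulVec, dotProduct, Fintype.sum_sum_type]
  rfl

lemma feedback_eq (B : Matrix (Fin 2) (Fin 2) ℝ) (K : ℝ → ℝ → Matrix Idx Idx ℝ)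
    (x : ℝ → Idx → ℝ) (ubar : Fin 2 → ℝ) :
    feedback B K x ubar = Matrix.mulVec B⁻¹ fun k =>
      x 1 (Sum.inl k) - x 1 (Sum.inr k) + (ubar k - volterra K x 1 (Sum.inl k)) := by
  rw [feedback]
  congr 1
  funext k
  simp only [mulVec_inl, volterra]
  ring

/-- With `ū` chosen as the Volterra transform of `x⁻` at `z = 1`, the feedback law is the boundary
condition of the beam at `z = 1`, and the state of the controller form is a shift of the output. -/
theorem Extends.hcf_of_beam (h : c.Extends lam A) {B : Matrix (Fin 2) (Fin 2) ℝ}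
    (hB : IsUnit B.det) {x : ℝ → ℝ → Idx → ℝ} {u : ℝ → Fin 2 → ℝ}
    (hx : IsBeamSolution lam A B x u) :
    ∃ ubar : ℝ → Fin 2 → ℝ,
      (∀ t ∈ Ici (0 : ℝ), u t = feedback B c.K (fun z => x z t) (ubar t)) ∧
      IsHCFSolution lam (c.alpha (Sum.inl 1)) (fun z => -c.alpha (Sum.inr 1) z)
        (fun i σ t => toHCF lam (c.alpha (Sum.inl 1)) (fun z => -c.alpha (Sum.inr 1) z) c.K
          (fun s => ubar (t + s) 0) (fun z => x z t) i σ) ubar ∧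
      ∀ i, ∀ t ∈ Ici (0 : ℝ), ∀ σ ∈ Icc 0 (2 * tau lam i),
        toHCF lam (c.alpha (Sum.inl 1)) (fun z => -c.alpha (Sum.inr 1) z) c.K
          (fun s => ubar (t + s) 0) (fun z => x z t) i σ =
            volterra c.K (fun z => x z (t + σ)) 1 (Sum.inr i) := by
  obtain ⟨yt, hy⟩ := h.isTarget_volterra hx
  have key : ∀ i, ∀ t ∈ Ici (0 : ℝ), ∀ σ ∈ Icc 0 (2 * tau lam i),
      toHCF lam (c.alpha (Sum.inl 1)) (fun z => -c.alpha (Sum.inr 1) z) c.K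
        (fun s => volterra c.K (fun z => x z (t + s)) 1 (Sum.inl 0)) (fun z => x z t) i σ =
          volterra c.K (fun z => x z (t + σ)) 1 (Sum.inr i) := fun i t ht σ hσ =>
    hy.etaOfBar_eq_output h ht i (h.tau_eq i ▸ hσ)
  have hT : ∀ i, 0 < 2 * tau lam i := fun i => by
    rw [h.tau_eq]
    linarith [c.T_pos i]
  have hd := fun i t ht => hy.hasDerivWithinAt_output (Sum.inr i) (t := t) ht
  refine ⟨fun t k => volterra c.K (fun z => x z t) 1 (Sum.inl k), fun t ht => ?_, ?_, key⟩
  · rw [feedback_eq]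
    have e : (fun k => x 1 t (Sum.inl k) - x 1 t (Sum.inr k) +
        (volterra c.K (fun z => x z t) 1 (Sum.inl k) -
          volterra c.K (fun z => x z t) 1 (Sum.inl k))) = Matrix.mulVec B (u t) := by
      funext k
      rw [hx.bc_one t ht k]
      ring
    rw [e, Matrix.mulVec_mulVec, Matrix.nonsing_inv_mul B hB, Matrix.one_mulVec]
  · refine ⟨fun i => ?_, fun i σ hσ t ht => ?_, fun t ht => ?_, fun t ht => ?_⟩
    · exact (contDiffOn_shift (hd i) (hy.continuousOn_output_deriv (Sum.inr i)) (hT i)).congr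
        fun p hp => key i p.2 hp.2 p.1 hp.1
    · have hσ' : σ ∈ Icc 0 (2 * tau lam i) := Ico_subset_Icc_self hσ
      have d1 := (hasDerivWithinAt_shift_time (hd i) hσ.1 ht).congr
        (fun s hs => key i s hs σ hσ') (key i t ht σ hσ')
      have d2 := (hasDerivWithinAt_shift_delay (hd i) hσ' ht).congr
        (fun ρ hρ => key i t ht ρ hρ) (key i t ht σ hσ')
      rw [d1.derivWithin (uniqueDiffOn_Ici 0 t ht),
        d2.derivWithin (uniqueDiffOn_Icc (hT i) σ hσ')]
    · rw [key 0 t ht _ ⟨(hT 0).le, le_rfl⟩]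
      have e := hy.unfold_eq_sub_conv 0 ht (r := 2 * c.T 0) ⟨by linarith [c.T_pos 0], le_rfl⟩
      rw [unfold_end, conv_fast, sub_zero] at e
      rw [h.tau_eq, ← e]
    · rw [key 1 t ht _ ⟨(hT 1).le, le_rfl⟩]
      have e := hy.unfold_eq_sub_conv 1 ht (r := 2 * c.T 1) ⟨by linarith [c.T_pos 1], le_rfl⟩
      rw [unfold_end, h.conv_end (hy.isSignal_output ht)] at e
      have e2 : ∀ σ ∈ Ioo (c.T 0) (2 * c.T 0),
          c.unfold (fun z => volterra c.K (fun ζ => x ζ t) z) 0 σ =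
            toHCF lam (c.alpha (Sum.inl 1)) (fun z => -c.alpha (Sum.inr 1) z) c.K
              (fun s => volterra c.K (fun z => x z (t + s)) 1 (Sum.inl 0)) (fun z => x z t) 0 σ := by
        intro σ hσ
        have hσ' : σ ∈ Icc 0 (2 * c.T 0) := ⟨by linarith [hσ.1, c.T_pos 0], hσ.2.le⟩
        rw [key 0 t ht σ (h.tau_eq 0 ▸ hσ'), hy.unfold_eq_sub_conv 0 ht hσ', conv_fast, sub_zero]
      have e3 : ∫ σ in (c.T 0)..(2 * c.T 0), abar lam (c.alpha (Sum.inl 1)) (c.T 0 + c.T 1 - σ) *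
            c.unfold (fun z => volterra c.K (fun ζ => x ζ t) z) 0 σ =
          ∫ σ in (c.T 0)..(2 * c.T 0), abar lam (c.alpha (Sum.inl 1)) (c.T 0 + c.T 1 - σ) *
            toHCF lam (c.alpha (Sum.inl 1)) (fun z => -c.alpha (Sum.inr 1) z) c.K
              (fun s => volterra c.K (fun z => x z (t + s)) 1 (Sum.inl 0)) (fun z => x z t) 0 σ :=
        intervalIntegral.integral_congr_Ioo_of_le (by linarith [c.T_pos 0]) fun σ hσ => by
          simp only [e2 σ hσ]
      rw [e3] at e
      simp only [h.tau_eq, h.dtau_eq]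
      linarith

end Coeffs

/-! ### From the controller form to the target system -/

lemma continuous_parametric_delay {X : Type*} [TopologicalSpace X] {P Y : ℝ → ℝ} (hP : Continuous P)
    (hY : Continuous Y) (a : ℝ) {b τ : X → ℝ} (hb : Continuous b) (hτ : Continuous τ) :
    Continuous fun x => ∫ ρ in a..(b x), P ρ * Y (τ x - ρ) :=
  intervalIntegral.continuous_parametric_intervalIntegral_of_continuous
    (f := fun x ρ => P ρ * Y (τ x - ρ))
    ((hP.comp continuous_snd).mul (hY.comp ((hτ.comp continuous_fst).sub continuous_snd))) hb

lemma hasDerivAt_delay {P Y Y' : ℝ → ℝ} (hP : Continuous P) (hY' : Continuous Y')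
    (hd : ∀ t, HasDerivAt Y (Y' t) t) (a : ℝ) {b τ τ' : ℝ → ℝ} {b' x : ℝ}
    (hb : HasDerivAt b b' x) (hτ : ∀ x, HasDerivAt τ (τ' x) x) (hτ' : Continuous τ') :
    HasDerivAt (fun x => ∫ ρ in a..(b x), P ρ * Y (τ x - ρ))
      (b' * (P (b x) * Y (τ x - b x)) + τ' x * ∫ ρ in a..(b x), P ρ * Y' (τ x - ρ)) x := by
  have hY : Continuous Y := continuous_iff_continuousAt.2 fun t => (hd t).continuousAt
  have cτ : Continuous τ := continuous_iff_continuousAt.2 fun t => (hτ t).continuousAt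
  have h := hasDerivAt_integral_moving (P := fun _ ρ => P ρ) (X := fun x ρ => Y (τ x - ρ))
    (X' := fun x ρ => Y' (τ x - ρ) * τ' x) (F := fun _ => 0) (a := fun _ => a) (b := b) (C := 0)
    (r₀ := x) (hP.comp continuous_snd)
    (hY.comp ((cτ.comp continuous_fst).sub continuous_snd))
    ((hY'.comp ((cτ.comp continuous_fst).sub continuous_snd)).mul (hτ'.comp continuous_fst))
    (fun x ρ => (hd (τ x - ρ)).comp x (h := fun x => τ x - ρ) ((hτ x).sub_const ρ))
    (fun u r r' => by simp) measurable_const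
    (Eventually.of_forall fun u => hasDerivAt_const _ _) (hasDerivAt_const _ _) hb
  refine h.congr_deriv ?_
  rw [← intervalIntegral.integral_const_mul]
  simp only [zero_mul, sub_zero, zero_add]
  congr 1
  refine intervalIntegral.integral_congr fun ρ _ => ?_
  ring

namespace Coeffs

variable {c : Coeffs} {lam : Fin 2 → ℝ → ℝ} {A : ℝ → Matrix Idx Idx ℝ}

/-- The convolution on the incoming part, for the signal `Y` shifted by `t`. -/
def convPlus (c : Coeffs) (k : Fin 2) (Y : ℝ → ℝ) (t r : ℝ) : ℝ :=
  ∫ ρ in (0 : ℝ)..r, c.coupPlus k ρ * Y (t + c.T 0 + r - ρ)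

/-- The convolution on the outgoing part, for the signal `Y` shifted by `t`. -/
def convMinus (c : Coeffs) (k : Fin 2) (Y : ℝ → ℝ) (t r : ℝ) : ℝ :=
  (∫ ρ in (0 : ℝ)..(c.T k), c.coupPlus k ρ * Y (t + c.T 0 + r - ρ)) +
    ∫ ρ in (c.T k)..r, c.coupMinus k ρ * Y (t + c.T 0 + r - ρ)

lemma conv_reverse (c : Coeffs) (k : Fin 2) (Y : ℝ → ℝ) (t r : ℝ) :
    c.conv k (fun σ => Y (t + σ)) r =
      ∫ ρ in (0 : ℝ)..r, c.coup k ρ * Y (t + c.T 0 + r - ρ) := by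
  have h := intervalIntegral.integral_comp_sub_left (a := 0) (b := r)
    (fun ρ => c.coup k ρ * Y (t + c.T 0 + r - ρ)) r
  rw [sub_self, sub_zero] at h
  rw [conv_eq, ← h]
  refine intervalIntegral.integral_congr fun θ _ => ?_
  congr 2
  ring

lemma conv_eq_convPlus (c : Coeffs) (k : Fin 2) (Y : ℝ → ℝ) (t : ℝ) {r : ℝ}
    (hr : r ∈ Icc 0 (c.T k)) : c.conv k (fun σ => Y (t + σ)) r = c.convPlus k Y t r := by
  rw [conv_reverse, convPlus]
  refine intervalIntegral.integral_congr_Ioo_of_le hr.1 fun ρ hρ => ?_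
  rw [coup, if_pos (by linarith [hρ.2, hr.2])]

lemma conv_eq_convMinus (c : Coeffs) (k : Fin 2) {Y : ℝ → ℝ} (hY : Continuous Y) (t : ℝ) {r : ℝ}
    (hr : c.T k ≤ r) : c.conv k (fun σ => Y (t + σ)) r = c.convMinus k Y t r := by
  have hi : ∀ a b, IntervalIntegrable (fun ρ => c.coup k ρ * Y (t + c.T 0 + r - ρ)) volume a b := by
    intro a b
    have hc : Continuous fun ρ => Y (t + c.T 0 + r - ρ) := by fun_prop
    have := (c.intervalIntegrable_coup_mul k (w := fun ρ => Y (t + c.T 0 + ρ))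
      (a := r - a) (b := r - b) ((by fun_prop : Continuous fun ρ =>
        Y (t + c.T 0 + ρ)).intervalIntegrable _ _) r).comp_sub_left r
    simpa only [sub_sub_cancel, add_sub_assoc] using this
  rw [conv_reverse, convMinus, ← intervalIntegral.integral_add_adjacent_intervals
    (hi 0 (c.T k)) (hi (c.T k) r)]
  congr 1
  · refine intervalIntegral.integral_congr_Ioo_of_le (c.T_pos k).le fun ρ hρ => ?_
    rw [coup, if_pos hρ.2]
  · refine intervalIntegral.integral_congr_Ioo_of_le hr fun ρ hρ => ?_
    rw [coup, if_neg (not_lt.2 hρ.1.le)]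

/-- The state `x̄` of the target system with the outputs `Y k`, extended to all times. -/
def barState (c : Coeffs) (Y : Fin 2 → ℝ → ℝ) (z t : ℝ) : Idx → ℝ :=
  Sum.elim
    (fun k => -(Y k (t + c.T k + c.s.Phi k z) - c.convMinus k (Y 0) t (c.T k + c.s.Phi k z)))
    (fun k => Y k (t + c.T k - c.s.Phi k z) - c.convPlus k (Y 0) t (c.T k - c.s.Phi k z))

variable {Y Y' : Fin 2 → ℝ → ℝ}

lemma continuous_barState (c : Coeffs) (hY : ∀ k, Continuous (Y k)) :
    Continuous (Function.uncurry (c.barState Y)) := by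
  have hΦ : ∀ k, Continuous fun p : ℝ × ℝ => c.s.Phi k p.1 := fun k =>
    (c.s.continuous_Phi k).comp continuous_fst
  refine continuous_pi fun i => ?_
  rcases i with k | k
  · have h := hΦ k
    exact (((hY k).comp (by fun_prop : Continuous fun p : ℝ × ℝ =>
      p.2 + c.T k + c.s.Phi k p.1)).sub
      ((continuous_parametric_delay (c.continuous_coupPlus k) (hY 0) 0 continuous_const
        (by fun_prop : Continuous fun p : ℝ × ℝ => p.2 + c.T 0 + (c.T k + c.s.Phi k p.1))).add
      (continuous_parametric_delay (c.continuous_coupMinus k) (hY 0) (c.T k)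
        (by fun_prop : Continuous fun p : ℝ × ℝ => c.T k + c.s.Phi k p.1)
        (by fun_prop : Continuous fun p : ℝ × ℝ => p.2 + c.T 0 + (c.T k + c.s.Phi k p.1))))).neg
  · have h := hΦ k
    exact ((hY k).comp (by fun_prop : Continuous fun p : ℝ × ℝ =>
      p.2 + c.T k - c.s.Phi k p.1)).sub
      (continuous_parametric_delay (c.continuous_coupPlus k) (hY 0) 0
        (by fun_prop : Continuous fun p : ℝ × ℝ => c.T k - c.s.Phi k p.1)
        (by fun_prop : Continuous fun p : ℝ × ℝ => p.2 + c.T 0 + (c.T k - c.s.Phi k p.1)))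

lemma hasDerivAt_barState_time (c : Coeffs) (hd : ∀ k t, HasDerivAt (Y k) (Y' k t) t)
    (hY' : ∀ k, Continuous (Y' k)) (z t : ℝ) (i : Idx) :
    HasDerivAt (fun t => c.barState Y z t i) (c.barState Y' z t i) t := by
  have hτ : ∀ a b t : ℝ, HasDerivAt (fun t : ℝ => t + a + b) 1 t := fun a b t =>
    ((hasDerivAt_id t).add_const a).add_const b
  rcases i with k | k
  · have h1 := (hd k (t + c.T k + c.s.Phi k z)).comp t (hτ (c.T k) (c.s.Phi k z) t)
    have h2 := hasDerivAt_delay (c.continuous_coupPlus k) (hY' 0) (hd 0) 0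
      (hasDerivAt_const t (c.T k)) (hτ (c.T 0) (c.T k + c.s.Phi k z)) continuous_const
    have h3 := hasDerivAt_delay (c.continuous_coupMinus k) (hY' 0) (hd 0) (c.T k)
      (hasDerivAt_const t (c.T k + c.s.Phi k z)) (hτ (c.T 0) (c.T k + c.s.Phi k z))
      continuous_const
    refine (h1.sub (h2.add h3)).neg.congr_deriv ?_
    simp only [barState, convMinus, Sum.elim_inl]
    ring
  · have h1 := (hd k (t + c.T k - c.s.Phi k z)).comp t
      (((hasDerivAt_id t).add_const (c.T k)).sub_const (c.s.Phi k z))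
    have h2 := hasDerivAt_delay (c.continuous_coupPlus k) (hY' 0) (hd 0) 0
      (hasDerivAt_const t (c.T k - c.s.Phi k z)) (hτ (c.T 0) (c.T k - c.s.Phi k z))
      continuous_const
    refine (h1.sub h2).congr_deriv ?_
    simp only [barState, convPlus, Sum.elim_inr]
    ring

/-- The only value of the state that enters the nonlocal terms is the delayed first output. -/
lemma barState_zero_fast (c : Coeffs) (t : ℝ) : c.barState Y 0 t (Sum.inl 0) =
    -Y 0 (t + c.T 0) := by
  have h0 : ∀ ρ, c.coupPlus 0 ρ = 0 := fun ρ => by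
    rw [coupPlus, c.alpha_fast rfl (clamp_mem _).1, neg_zero]
  simp [barState, convMinus, h0]

/-- The endpoints of the convolutions move with `z`; their boundary terms are the nonlocal terms of
the target system. -/
lemma hasDerivAt_barState_space (c : Coeffs) (hd : ∀ k t, HasDerivAt (Y k) (Y' k t) t)
    (hY' : ∀ k, Continuous (Y' k)) {z : ℝ} (hz : z ∈ Icc (0 : ℝ) 1) (t : ℝ) (i : Idx) :
    HasDerivAt (fun z => c.barState Y z t i)
      ((c.barState Y' z t i - c.alpha i z * c.barState Y 0 t (Sum.inl 0)) / c.v i z) z := by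
  have hΦ := c.s.hasDerivAt_Phi
  have hL := c.s.L_ne
  rw [barState_zero_fast]
  rcases i with k | k
  · have h1 := (hd k (t + c.T k + c.s.Phi k z)).comp z ((hΦ k z).const_add (t + c.T k))
    have hτ : ∀ z, HasDerivAt (fun z => t + c.T 0 + (c.T k + c.s.Phi k z)) (1 / c.s.L k z) z :=
      fun z => ((hΦ k z).const_add (c.T k)).const_add (t + c.T 0)
    have h2 := hasDerivAt_delay (c.continuous_coupPlus k) (hY' 0) (hd 0) 0
      (hasDerivAt_const z (c.T k)) hτ (c.s.cont_inv k)
    have h3 := hasDerivAt_delay (c.continuous_coupMinus k) (hY' 0) (hd 0) (c.T k)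
      ((hΦ k z).const_add (c.T k)) hτ (c.s.cont_inv k)
    refine (h1.sub (h2.add h3)).neg.congr_deriv ?_
    have e : c.coupMinus k (c.T k + c.s.Phi k z) = c.alpha (Sum.inl k) z := by
      rw [coupMinus, add_sub_cancel_left, c.s.Psi_Phi, clamp_of_mem hz]
    have := hL k z
    rw [e, add_sub_cancel_right]
    simp only [barState, convMinus, Sum.elim_inl, v, sgn_inl, proc_inl]
    field_simp
    ring
  · have h1 := (hd k (t + c.T k - c.s.Phi k z)).comp z ((hΦ k z).const_sub (t + c.T k))
    have hτ : ∀ z, HasDerivAt (fun z => t + c.T 0 + (c.T k - c.s.Phi k z)) (-(1 / c.s.L k z)) z :=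
      fun z => ((hΦ k z).const_sub (c.T k)).const_add (t + c.T 0)
    have h2 := hasDerivAt_delay (c.continuous_coupPlus k) (hY' 0) (hd 0) 0
      ((hΦ k z).const_sub (c.T k)) hτ (c.s.cont_inv k).neg
    refine (h1.sub h2).congr_deriv ?_
    have e : c.coupPlus k (c.T k - c.s.Phi k z) = -c.alpha (Sum.inr k) z := by
      rw [coupPlus, sub_sub_cancel, c.s.Psi_Phi, clamp_of_mem hz]
    have := hL k z
    rw [e, add_sub_cancel_right]
    simp only [barState, convPlus, Sum.elim_inr, v, sgn_inr, proc_inr]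
    field_simp
    ring

lemma isTarget_barState (c : Coeffs) (hd : ∀ k t, HasDerivAt (Y k) (Y' k t) t)
    (hY' : ∀ k, Continuous (Y' k)) : c.IsTarget (c.barState Y) (c.barState Y') where
  cont := (c.continuous_barState fun k =>
    continuous_iff_continuousAt.2 fun t => (hd k t).continuousAt).continuousOn
  cont_deriv := (c.continuous_barState hY').continuousOn
  deriv_time z _ t _ i := (c.hasDerivAt_barState_time hd hY' z t i).hasDerivWithinAt
  deriv_space z hz t _ i := (c.hasDerivAt_barState_space hd hY' hz t i).hasDerivWithinAt
  bc_zero t _ k := by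
    simp [barState, convPlus, convMinus]

/-! ### From the target system to the beam system -/

/-- The inverse Volterra transformation maps classical solutions of the target system to classical
solutions of the beam system. -/
theorem Extends.isBeamSolution_of_isTarget (h : c.Extends lam A) {B : Matrix (Fin 2) (Fin 2) ℝ}
    (hB : IsUnit B.det) {y yt : ℝ → ℝ → Idx → ℝ} (hy : c.IsTarget y yt)
    {ubar : ℝ → Fin 2 → ℝ} (hu : ∀ t ∈ Ici (0 : ℝ), ∀ k, y 1 t (Sum.inl k) = ubar t k)
    {x : ℝ → ℝ → Idx → ℝ}
    (hx : ∀ t ∈ Ici (0 : ℝ), EqOn (fun z => x z t) (volterraInv c.pcI.ker fun z => y z t)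
      (Icc 0 1)) :
    IsBeamSolution lam A B x
      (fun t => feedback B c.K (fun z => x z t) (ubar t)) := by
  have uI : UniqueDiffOn ℝ (Icc (0 : ℝ) 1) := uniqueDiffOn_Icc zero_lt_one
  have uJ : UniqueDiffOn ℝ (Ici (0 : ℝ)) := uniqueDiffOn_Ici 0
  have hI0 : (0 : ℝ) ∈ Icc (0 : ℝ) 1 := by simp
  have hI1 : (1 : ℝ) ∈ Icc (0 : ℝ) 1 := by simp
  let xt : ℝ → ℝ → Idx → ℝ := fun z t => volterraInv c.pcI.ker (fun ζ => yt ζ t) z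
  let xz : ℝ → ℝ → Idx → ℝ := fun z t i => (xt z t i - Matrix.mulVec (c.A z) (x z t) i) / c.v i z
  have cV : ∀ {f : ℝ → ℝ → Idx → ℝ}, ContinuousOn (Function.uncurry f) strip →
      ContinuousOn (Function.uncurry fun z t => volterraInv c.pcI.ker (fun ζ => f ζ t) z) strip :=
    fun {f} hf => continuousOn_pi.2 fun i => ((continuous_apply i).comp_continuousOn hf).add
      (c.pcI.continuousOn_integral_strip hf i)
  have cx : ContinuousOn (Function.uncurry x) strip :=
    (cV hy.cont).congr fun p hp => hx p.2 hp.2 hp.1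
  have cxt : ContinuousOn (Function.uncurry xt) strip := cV hy.cont_deriv
  have cxz : ∀ i, ContinuousOn (Function.uncurry fun z t => xz z t i) strip := by
    intro i
    have hAx : ContinuousOn (fun p : ℝ × ℝ => Matrix.mulVec (c.A p.1) (x p.1 p.2) i) strip := by
      change ContinuousOn (fun p : ℝ × ℝ => ∑ j, c.A p.1 i j * x p.1 p.2 j) strip
      exact continuousOn_finsetSum _ fun j _ =>
        ((c.contA_apply i j).comp continuous_fst).continuousOn.mul
          ((continuous_apply j).comp_continuousOn cx)
    exact (((continuous_apply i).comp_continuousOn cxt).sub hAx).div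
      ((c.continuous_v i).comp continuous_fst).continuousOn fun p _ => c.v_ne_zero i p.1
  have dt : ∀ z ∈ Icc (0 : ℝ) 1, ∀ t ∈ Ici (0 : ℝ), ∀ i,
      HasDerivWithinAt (fun t => x z t i) (xt z t i) (Ici 0) t := by
    intro z hz t ht i
    refine HasDerivWithinAt.congr (f := fun t => volterraInv c.pcI.ker (fun ζ => y ζ t) z i) ?_
      (fun s hs => congrFun (hx s hs hz) i) (congrFun (hx t ht hz) i)
    exact (hy.deriv_time z hz t ht i).add
      (c.pcI.hasDerivWithinAt_integral_strip hy.cont hy.cont_deriv hy.deriv_time i hz ht)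
  have dz : ∀ z ∈ Icc (0 : ℝ) 1, ∀ t ∈ Ici (0 : ℝ), ∀ i,
      HasDerivWithinAt (fun z => x z t i) (xz z t i) (Icc 0 1) z := by
    intro z hz t ht i
    have hd := c.hasDerivWithinAt_volterraInv (y := fun z => y z t)
      (y' := fun z i => (yt z t i - c.alpha i z * y 0 t (Sum.inl 0)) / c.v i z)
      (f := fun z => yt z t) (fun i z hz => hy.deriv_space z hz t ht i) (hy.bc_zero t ht)
      (hy.cont_deriv.comp (f := fun z : ℝ => (z, t)) (by fun_prop) fun z hz => ⟨hz, ht⟩)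
      (fun i z hz => by
        have := c.v_ne_zero i z
        field_simp
        ring) i hz
    refine (hd.congr (fun w hw => congrFun (hx t ht hw) i)
      (congrFun (hx t ht hz) i)).congr_deriv ?_
    rw [← hx t ht hz]
  refine ⟨?_, fun z hz t ht => ?_, fun t ht k => ?_, fun t ht k => ?_⟩
  · exact contDiffOn_pi.2 fun i => contDiffOn_one_of_partial (f := fun z t => x z t i)
      (convex_Icc 0 1) (convex_Ici 0) uI uJ (fun z hz t ht => dz z hz t ht i)
      (fun z hz t ht => dt z hz t ht i) (cxz i) ((continuous_apply i).comp_continuousOn cxt)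
  · rw [(hasDerivWithinAt_pi.2 (dt z hz t ht)).derivWithin (uJ t ht),
      (hasDerivWithinAt_pi.2 (dz z hz t ht)).derivWithin (uI z hz)]
    funext i
    have := c.v_ne_zero i z
    rw [Pi.add_apply, LamT, Matrix.mulVec_diagonal, h.speed_eq i hz, h.A_eq z hz]
    simp only [xz]
    field_simp
    ring
  · have e := hx t ht hI0
    simp only at e
    rw [e, volterraInv_zero, volterraInv_zero, hy.bc_zero t ht]
  · have hV : volterra c.K (fun z => x z t) 1 = y 1 t := by
      rw [PCKernel.volterra_congr (hx t ht) hI1]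
      exact c.volterra_volterraInv (hy.slice_mem ht).1 hI1
    rw [feedback_eq, Matrix.mulVec_mulVec, Matrix.mul_nonsing_inv B hB, Matrix.one_mulVec, hV, hu t ht]
    ring

end Coeffs

namespace Coeffs

variable {c : Coeffs} {lam : Fin 2 → ℝ → ℝ} {A : ℝ → Matrix Idx Idx ℝ}

/-- A continuously differentiable function on `[0,∞)` extends to the real line, with slope `f' 0` on
the left. -/
lemma exists_extension_Ici {f f' : ℝ → ℝ} (hd : ∀ t ∈ Ici (0 : ℝ),
      HasDerivWithinAt f (f' t) (Ici 0) t) (hc : ContinuousOn f' (Ici 0)) :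
    ∃ F F' : ℝ → ℝ, Continuous F' ∧ (∀ t, HasDerivAt F (F' t) t) ∧ EqOn F f (Ici 0) := by
  have hc' : Continuous fun t => f' (max t 0) :=
    hc.comp_continuous (by fun_prop) fun t => mem_Ici.2 (le_max_right _ _)
  refine ⟨fun t => f 0 + ∫ τ in (0 : ℝ)..t, f' (max τ 0), _, hc',
    fun t => (hc'.integral_hasStrictDerivAt 0 t).hasDerivAt.const_add _, fun t ht => ?_⟩
  have := intervalIntegral.integral_eq_sub_of_hasDeriv_right_of_le (mem_Ici.1 ht)
    (f := f) (f' := fun τ => f' (max τ 0))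
    (fun τ hτ => (hd τ hτ.1).continuousWithinAt.mono Icc_subset_Ici_self)
    (fun τ hτ => by
      rw [max_eq_left hτ.1.le]
      exact (hd τ hτ.1.le).mono (Ioi_subset_Ici hτ.1.le)) (hc'.intervalIntegrable _ _)
  simp only
  rw [this]
  ring

/-- A classical solution of the controller form is a shift of the signals `ηₖ(0,·)`. -/
lemma Extends.exists_output (h : c.Extends lam A) {am ap : ℝ → ℝ} {η : Fin 2 → ℝ → ℝ → ℝ}
    {ubar : ℝ → Fin 2 → ℝ} (hη : IsHCFSolution lam am ap η ubar) (k : Fin 2) :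
    ∃ Y Y' : ℝ → ℝ, Continuous Y' ∧ (∀ t, HasDerivAt Y (Y' t) t) ∧
      ∀ t ∈ Ici (0 : ℝ), ∀ σ ∈ Icc 0 (2 * c.T k), η k σ t = Y (t + σ) := by
  have hT : 0 < 2 * c.T k := by linarith [c.T_pos k]
  have uI : UniqueDiffOn ℝ (Icc (0 : ℝ) (2 * c.T k)) := uniqueDiffOn_Icc hT
  have uJ : UniqueDiffOn ℝ (Ici (0 : ℝ)) := uniqueDiffOn_Ici 0
  have hsm := hη.smooth k
  have hpde := hη.pde k
  rw [h.tau_eq] at hsm hpde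
  obtain ⟨ησ, ηt, cσ, ct, dσ, dt⟩ := exists_partial_of_contDiffOn uI uJ hsm
  have h0 : (0 : ℝ) ∈ Icc 0 (2 * c.T k) := ⟨le_rfl, hT.le⟩
  obtain ⟨Y, Y', hY', hY, hE⟩ := exists_extension_Ici (dt 0 h0)
    (ct.comp (f := fun t : ℝ => ((0 : ℝ), t)) (by fun_prop) fun t ht => ⟨h0, ht⟩)
  refine ⟨Y, Y', hY', hY, fun t ht σ hσ => ?_⟩
  rw [mem_Ici] at ht
  have hmem : ∀ θ ∈ Icc 0 σ, (σ - θ, t + θ) ∈ Icc 0 (2 * c.T k) ×ˢ Ici (0 : ℝ) := fun θ hθ =>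
    ⟨⟨by linarith [hθ.2], by linarith [hθ.1, hσ.2]⟩, mem_Ici.2 (by linarith [hθ.1])⟩
  -- `η` is constant along `θ ↦ (σ - θ, t + θ)`
  have key := MeasureTheory.integral_eq_of_hasDerivAt_off_countable_of_le
    (fun θ => η k (σ - θ) (t + θ)) (fun _ => 0) hσ.1 countable_empty
    (hsm.continuousOn.comp (f := fun θ => (σ - θ, t + θ)) (by fun_prop) hmem)
    (fun θ hθ => by
      obtain ⟨hθ, -⟩ := hθ
      have hm := hmem θ ⟨hθ.1.le, hθ.2.le⟩
      have hp := hpde (σ - θ) ⟨hm.1.1, by linarith [hθ.1, hσ.2]⟩ (t + θ) hm.2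
      rw [(dt _ hm.1 _ hm.2).derivWithin (uJ _ hm.2),
        (dσ _ hm.1 _ hm.2).derivWithin (uI _ hm.1)] at hp
      have hd := (hasFDerivWithinAt_of_partial (f := η k) (convex_Icc 0 (2 * c.T k)) (convex_Ici 0)
        dσ dt cσ ct hm).comp_hasDerivAt θ (((hasDerivAt_id θ).const_sub σ).prodMk
          ((hasDerivAt_id θ).const_add t)) (by
            filter_upwards [Ioo_mem_nhds hθ.1 hθ.2] with θ' h'
            exact hmem θ' ⟨h'.1.le, h'.2.le⟩)
      refine hd.congr_deriv ?_
      simp [hp]) intervalIntegrable_const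
  rw [intervalIntegral.integral_zero, sub_self, sub_zero, add_zero] at key
  rw [hE (mem_Ici.2 (by linarith [hσ.1]))]
  linarith

/-- On the state of the controller form, which is a shift of the outputs, the inverse transformation
is `barState`. The boundary conditions at `τ = 2τᵢ` say that `x̄⁻(1) = ū`. -/
theorem Extends.beam_of_hcf (h : c.Extends lam A) {B : Matrix (Fin 2) (Fin 2) ℝ}
    (hB : IsUnit B.det) {η : Fin 2 → ℝ → ℝ → ℝ} {ubar : ℝ → Fin 2 → ℝ}
    (hη : IsHCFSolution lam (c.alpha (Sum.inl 1)) (fun z => -c.alpha (Sum.inr 1) z) η ubar) :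
    IsBeamSolution lam A B
      (fun z t => ofHCF lam (c.alpha (Sum.inl 1)) (fun z => -c.alpha (Sum.inr 1) z) c.pcI.ker
        (fun s => ubar (t + s) 0) (fun i σ => η i σ t) z)
      (fun t => feedback B c.K
        (fun z => ofHCF lam (c.alpha (Sum.inl 1)) (fun z => -c.alpha (Sum.inr 1) z) c.pcI.ker
          (fun s => ubar (t + s) 0) (fun i σ => η i σ t) z)
        (ubar t)) := by
  choose Y Y' hY' hd hE using fun k => h.exists_output hη k
  have hYc : ∀ k, Continuous (Y k) := fun k =>
    continuous_iff_continuousAt.2 fun t => (hd k t).continuousAt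
  have p0 := c.T_pos 0
  have p1 := c.T_lt
  -- by the boundary condition for `η₁`, the first output continues `η₁` by the predicted input
  have hw : ∀ t ∈ Ici (0 : ℝ), c.IsSignal (fun σ => η 0 σ t) (fun s => ubar (t + s) 0)
      fun σ => Y 0 (t + σ) := by
    intro t ht
    refine ⟨fun σ hσ => ?_, fun σ hσ => ?_, ?_⟩
    · exact (hE 0 t ht σ ⟨by linarith [hσ.1], hσ.2.le⟩).symm
    · have ht' : t + (σ - 2 * c.T 0) ∈ Ici (0 : ℝ) :=
        mem_Ici.2 (by linarith [mem_Ici.1 ht, hσ.1])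
      have hb := hη.bc_one _ ht'
      rw [h.tau_eq, hE 0 _ ht' _ ⟨by linarith, le_rfl⟩, add_assoc, sub_add_cancel] at hb
      exact hb
    · exact ((hYc 0).comp (by fun_prop : Continuous fun σ => t + σ)).intervalIntegrable _ _
  have hbar : ∀ t ∈ Ici (0 : ℝ), EqOn (barOfEta lam (c.alpha (Sum.inl 1))
      (fun z => -c.alpha (Sum.inr 1) z) (fun s => ubar (t + s) 0) (fun i σ => η i σ t))
      (fun z => c.barState Y z t) (Icc 0 1) := by
    intro t ht z hz
    funext i
    rcases i with k | k <;> obtain ⟨q0, q1⟩ := c.Phi_mem k hz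
    · rw [(h.barOfEta_eq (hw t ht) hz k).2, c.conv_eq_convMinus k (hYc 0) t (by linarith),
        hE k t ht _ ⟨by linarith, by linarith⟩, ← add_assoc]
      rfl
    · rw [(h.barOfEta_eq (hw t ht) hz k).1, c.conv_eq_convPlus k _ t ⟨by linarith, by linarith⟩,
        hE k t ht _ ⟨by linarith, by linarith [c.T_pos k]⟩, ← add_sub_assoc]
      rfl
  refine h.isBeamSolution_of_isTarget hB (c.isTarget_barState hd hY') (fun t ht k => ?_)
    fun t ht => PCKernel.volterraInv_congr (hbar t ht)
  have h1 : (1 : ℝ) ∈ Icc (0 : ℝ) 1 := by simp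
  have e := congrFun (hbar t ht h1) (Sum.inl k)
  simp only at e
  rw [← e, (h.barOfEta_eq (hw t ht) h1 k).2]
  change -(η k (c.T k + c.T k) t - c.conv k _ (c.T k + c.T k)) = _
  rw [← two_mul]
  fin_cases k
  · have hb := hη.bc_one t ht
    rw [h.tau_eq] at hb
    simp only [Fin.zero_eta, conv_fast]
    rw [hb]
    ring
  · have hb := hη.bc_two t ht
    simp only [h.tau_eq, h.dtau_eq] at hb
    simp only [Fin.mk_one]
    rw [h.conv_end (hw t ht), hb]
    ring

/-! ### Coefficients given on the unit interval -/

/-- Outside the unit interval the coefficients are continued by their boundary values; the bounds and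
the ratio of the speeds come from compactness. -/
lemma exists_extends (hlam : ∀ i, ContinuousOn (lam i) (Icc 0 1))
    (hpos : ∀ z ∈ Icc (0 : ℝ) 1, 0 < lam 1 z) (hlt : ∀ z ∈ Icc (0 : ℝ) 1, lam 1 z < lam 0 z)
    (hA : ContinuousOn A (Icc 0 1)) (hdiag : ∀ z ∈ Icc (0 : ℝ) 1, ∀ i, A z i i = 0) :
    ∃ c : Coeffs, c.Extends lam A := by
  have hne : (Icc (0 : ℝ) 1).Nonempty := ⟨0, by simp⟩
  obtain ⟨z₁, hz₁, h₁⟩ := isCompact_Icc.exists_isMinOn hne (hlam 1)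
  obtain ⟨z₂, hz₂, h₂⟩ := isCompact_Icc.exists_isMaxOn hne (hlam 0)
  obtain ⟨z₃, hz₃, h₃⟩ := isCompact_Icc.exists_isMinOn hne
    ((hlam 0).div (hlam 1) fun z hz => (hpos z hz).ne')
  have hc := fun k => (hlam k).comp_continuous continuous_clamp clamp_mem
  have hAc := hA.comp_continuous continuous_clamp clamp_mem
  have hb : ∀ ij : Idx × Idx, ∃ C, ∀ z ∈ Icc (0 : ℝ) 1, |A z ij.1 ij.2| ≤ C := fun ij =>
    isCompact_Icc.exists_bound_of_continuousOn (f := fun z => A z ij.1 ij.2)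
      ((continuous_id.matrix_elem ij.1 ij.2).comp_continuousOn hA)
  choose C hC using hb
  have hlow : ∀ k, ∀ z ∈ Icc (0 : ℝ) 1, lam 1 z₁ ≤ lam k z := by
    intro k z hz
    fin_cases k
    · exact (h₁ hz).trans (hlt z hz).le
    · exact h₁ hz
  have hhi : ∀ k, ∀ z ∈ Icc (0 : ℝ) 1, lam k z ≤ lam 0 z₂ := by
    intro k z hz
    fin_cases k
    · exact h₂ hz
    · exact (hlt z hz).le.trans (h₂ hz)
  let s : Speeds :=
    { L := fun k z => lam k (clamp z)
      lo := lam 1 z₁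
      hi := lam 0 z₂
      -- `z₃` minimizes the ratio of the speeds
      δ := lam 0 z₃ / lam 1 z₃ - 1
      cont := hc
      lo_pos := hpos z₁ hz₁
      lo_le := fun k z => hlow k _ (clamp_mem z)
      le_hi := fun k z => hhi k _ (clamp_mem z)
      δ_pos := by
        rw [sub_pos, one_lt_div (hpos z₃ hz₃)]
        exact hlt z₃ hz₃
      gap := fun z => by
        have h := h₃ (clamp_mem z)
        have hp := hpos _ (clamp_mem z)
        simp only [Pi.div_apply, mem_ofPred_eq] at h
        rw [le_div_iff₀ hp] at h
        rw [add_sub_cancel]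
        exact h }
  exact ⟨{
    s := s
    A := fun z => A (clamp z)
    bound := ∑ ij, |C ij|
    contA := hAc
    boundA := fun z i j => ((hC (i, j) _ (clamp_mem z)).trans (le_abs_self _)).trans
      (Finset.single_le_sum (f := fun ij => |C ij|) (fun _ _ => abs_nonneg _)
        (Finset.mem_univ (i, j)))
    diagA := fun z i => hdiag _ (clamp_mem z) i },
    fun k z hz => by simp only [s, clamp_of_mem hz], fun z hz => by simp only [clamp_of_mem hz]⟩

end Coeffs

end HCFBeam

end

open HCFBeam
theorem lemma1 (lam : Fin 2 → ℝ → ℝ) (A : ℝ → Matrix Idx Idx ℝ)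
    (B : Matrix (Fin 2) (Fin 2) ℝ)
    (hlam : ∀ i, ContDiffOn ℝ 1 (lam i) (Icc 0 1))
    (hpos : ∀ z ∈ Icc (0 : ℝ) 1, 0 < lam 1 z)
    (hlt : ∀ z ∈ Icc (0 : ℝ) 1, lam 1 z < lam 0 z)
    (hA : ContinuousOn A (Icc 0 1))
    (hdiag : ∀ z ∈ Icc (0 : ℝ) 1, ∀ i, A z i i = 0)
    (hB : IsUnit B.det) :
    ∃ (K KI : ℝ → ℝ → Matrix Idx Idx ℝ) (am ap : ℝ → ℝ),
      ContinuousOn am (Icc 0 1) ∧ ContinuousOn ap (Icc 0 1) ∧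
      -- the Volterra kernel and the kernel of the inverse Volterra transformation
      IsKernel lam A am ap K ∧ PiecewiseContinuous lam KI ∧ IsInverseKernel K KI ∧
      -- for every prediction of the first input, the transformation is a bijection of the states
      (∀ v : ℝ → ℝ, IntervalIntegrable v volume 0 (dtau lam + tau lam 1) →
        (∀ ξ ∈ beamStates, toHCF lam am ap K v ξ ∈ hcfStates lam ∧
          EqOn (ofHCF lam am ap KI v (toHCF lam am ap K v ξ)) ξ (Icc 0 1)) ∧
        (∀ e ∈ hcfStates lam, ofHCF lam am ap KI v e ∈ beamStates ∧
          ∀ i, EqOn (toHCF lam am ap K v (ofHCF lam am ap KI v e) i) (e i)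
            (Icc 0 (2 * tau lam i)))) ∧
      -- it maps solutions of the beam system to solutions of the controller form,
      -- whose state consists of the predictions of the flat output
      (∀ (x : ℝ → ℝ → Idx → ℝ) (u : ℝ → Fin 2 → ℝ), IsBeamSolution lam A B x u →
        ∃ ubar : ℝ → Fin 2 → ℝ,
          (∀ t ∈ Ici (0 : ℝ), u t = feedback B K (fun z => x z t) (ubar t)) ∧
          IsHCFSolution lam am ap
            (fun i σ t => toHCF lam am ap K (fun s => ubar (t + s) 0) (fun z => x z t) i σ)
            ubar ∧
          ∀ i, ∀ t ∈ Ici (0 : ℝ), ∀ σ ∈ Icc 0 (2 * tau lam i),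
            toHCF lam am ap K (fun s => ubar (t + s) 0) (fun z => x z t) i σ =
              volterra K (fun z => x z (t + σ)) 1 (Sum.inr i)) ∧
      -- and its inverse maps solutions of the controller form to solutions of the beam system
      (∀ (η : Fin 2 → ℝ → ℝ → ℝ) (ubar : ℝ → Fin 2 → ℝ), IsHCFSolution lam am ap η ubar →
        IsBeamSolution lam A B
          (fun z t => ofHCF lam am ap KI (fun s => ubar (t + s) 0) (fun i σ => η i σ t) z)
          (fun t => feedback B K
            (fun z => ofHCF lam am ap KI (fun s => ubar (t + s) 0) (fun i σ => η i σ t) z)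
            (ubar t))) := by
  obtain ⟨c, h⟩ := Coeffs.exists_extends (fun i => (hlam i).continuousOn) hpos hlt hA hdiag
  exact ⟨c.K, c.pcI.ker, c.alpha (Sum.inl 1), fun z => -c.alpha (Sum.inr 1) z,
    (c.continuous_alpha _).continuousOn, (c.continuous_alpha _).neg.continuousOn,
    h.isKernel, h.piecewiseContinuous_ker c.pcI, c.isInverseKernel,
    fun v hv => ⟨fun ξ hξ => h.toHCF_mem hξ hv, fun e he => h.ofHCF_mem he hv⟩,
    fun x u hx => h.hcf_of_beam hB hx, fun η ubar hη => h.beam_of_hcf hB hη⟩
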